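/- All matroids are finite. A matroid $M$ is \emph{connected} if any two distinct elements of $E(M)$ lie in a common circuit, and \emph{nontrivial} if $E(M)$ is not independent. A \emph{lattice path matroid} is a matroid $M$ for which there are a linear order $e_1<e_2<\cdots<e_n$ on $E(M)$ (a \emph{path order}) and intervals $[a_1,b_1],\dots,[a_r,b_r]$ in this order, with $a_1<\cdots<a_r$, $b_1<\cdots<b_r$ and $a_i\le b_i$ for all $i$, such that the independent sets of $M$ are the partial transversals of $([a_1,b_1],\dots,[a_r,b_r])$. An element is \emph{terminal} in $M$ if it is the first or the last element of some path order of $M$. For matroids $M_1,M_2$ with $E(M_1)\cap E(M_2)=\{x\}$ such that $x$ is a loop of at most one of them, the \emph{parallel connection} $P_x(M_1,M_2)$ is the matroid on $E(M_1)\cup E(M_2)$ whose bases are the sets $B$ such that either $x\in B$ and $B\cap E(M_i)$ is a basis of $M_i$ for $i=1,2$, or $x\notin B$ and, for $(i,j)=(1,2)$ or $(i,j)=(2,1)$, $B\cap E(M_i)$ is a basis of $M_i$ and $(B\cap E(M_j))\cup\{x\}$ is a basis of $M_j$. (If $x$ is a loop of both, $P_x(M_1,M_2)$ is the matroid in which $I\subseteq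 E(M_1)\cup E(M_2)$ is independent if and only if each $I\cap E(M_i)$ is independent in $M_i$.) A matroid $M$ \emph{is a parallel connection at} $x$ if $M=P_x(N_1,N_2)$ for some $N_1,N_2$ with $|E(N_1)|,|E(N_2)|\ge 2$. Let $T_k$ denote truncation to rank $k$, let $U_{k,n}$ be the uniform matroid of rank $k$ on $n$ elements, and let $M+e=T_{r(M)}(M\oplus U_{1,1})$ be the free extension of $M$. Put $P_n=T_n(U_{n-1,n}\oplus U_{n-1,n})$, $B_{n,k}=T_n(U_{n-1,n}\oplus U_{n-1,n}\oplus U_{k-1,k})$, $C_{n+k,k}=B_{n,k}^*$ (so $C_{4,2}=B_{2,2}^*$), $E_n=\bigl((P_{n-1}\oplus U_{1,1})+e\bigr)^*$, $R_3=T_3\bigl(T_2(U_{1,2}\oplus U_{1,2}\oplus U_{1,1})\oplus U_{2,2}\bigr)$ and $R_4=R_3^*$. \textbf{Theorem.} Let $M_1,M_2$ be nontrivial connected lattice path matroids of positive rank with $E(M_1)\cap E(M_2)=\{x\}$. \begin{enumerate} \item[(i)] If $x$ is terminal in both $M_1$ and $M_2$, then $P_x(M_1,M_2)$ is a lattice path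 matroid. \item[(ii)] If $M_1$ is a parallel connection at $x$ and $M_2=U_{1,2}$ (on a set $\{x,y\}$ with $y\ne x$), then $P_x(M_1,M_2)$ is a lattice path matroid. \item[(iii)] If $x$ is not terminal in $M_1$ and, in case $M_1/x$ is disconnected, also $r(M_2)>1$, then $P_x(M_1,M_2)$ has a minor isomorphic to at least one of the following: $B_{n,2}$ for some $n\ge 2$; $C_{4,2}$; $E_n$ for some $n\ge 4$; $R_3$; $R_4$. \end{enumerate} -/

import Mathlib

open Set

namespace Matroid

/-! ### Basic notions -/

/-- `M` is connected: any two distinct elements lie in a common circuit. -/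
def IsConnected {α : Type*} (M : Matroid α) : Prop :=
  ∀ e ∈ M.E, ∀ f ∈ M.E, e ≠ f → ∃ C, M.IsCircuit C ∧ e ∈ C ∧ f ∈ C

/-- `M` is trivial if its ground set is independent, and nontrivial otherwise. -/
def IsNontrivial {α : Type*} (M : Matroid α) : Prop :=
  ¬ M.Indep M.E

/-- Some minor of `M` is isomorphic to `N`. -/
def HasMinorIso {α β : Type*} (M : Matroid α) (N : Matroid β) : Prop :=
  ∃ (f : β → α) (hf : InjOn f N.E), N.map f hf ≤m M

/-! ### Lattice path matroids -/

/-- `I` is a partial transversal of the family `A`: its elements can be matched injectively to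
members of the family that contain them. -/
def IsPartialTransversal {α ι : Type*} (A : ι → Set α) (I : Set α) : Prop :=
  ∃ φ : I → ι, Function.Injective φ ∧ ∀ y : I, (y : α) ∈ A (φ y)

/-- `M` is the transversal matroid on its ground set that is presented by the family `A`. -/
def IsPresentedBy {α ι : Type*} (M : Matroid α) (A : ι → Set α) : Prop :=
  (∀ i, A i ⊆ M.E) ∧ ∀ I, M.Indep I ↔ IsPartialTransversal A I

/-- The enumeration `e 0 < e 1 < ⋯ < e (n - 1)` is a linear order on the ground set of `M`, and the
intervals `[e (a i), e (b i)]`, with strictly increasing lower and strictly increasing upper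
endpoints (so that none of them contains another), form a presentation of `M`. -/
structure IsIntervalPresentation {α : Type*} (M : Matroid α) {n r : ℕ} (e : Fin n → α)
    (a b : Fin r → Fin n) : Prop where
  injective : Function.Injective e
  range_eq : range e = M.E
  strictMono_lower : StrictMono a
  strictMono_upper : StrictMono b
  lower_le_upper : ∀ i, a i ≤ b i
  presents : M.IsPresentedBy (fun i => e '' Icc (a i) (b i))

/-- The linear order on the ground set given by the enumeration `e` is a path order of `M`. -/
def IsPathOrder {α : Type*} (M : Matroid α) {n : ℕ} (e : Fin n → α) : Prop :=
  ∃ (r : ℕ) (a b : Fin r → Fin n), M.IsIntervalPresentation e a b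

/-- `M` is a lattice path matroid. -/
def IsLatticePath {α : Type*} (M : Matroid α) : Prop :=
  ∃ (n : ℕ) (e : Fin n → α), M.IsPathOrder e

/-- `x` is a terminal element of `M`: it is the first or the last element in some path order. -/
def IsTerminal {α : Type*} (M : Matroid α) (x : α) : Prop :=
  ∃ (n : ℕ) (e : Fin n → α), M.IsPathOrder e ∧
    ∃ i : Fin n, e i = x ∧ ((i : ℕ) = 0 ∨ (i : ℕ) + 1 = n)

/-! ### Truncations, uniform matroids, free extensions -/

/-- The truncation `T_k(M)` to rank `k`: the independent sets are the independent sets of `M` with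
at most `k` elements. -/
def truncation {α : Type*} (M : Matroid α) (k : ℕ) : Matroid α :=
  (IndepMatroid.ofBddAugment M.E (fun I => M.Indep I ∧ I.encard ≤ k)
    ⟨M.empty_indep, by simp⟩
    (fun _ _ hJ hIJ => ⟨hJ.1.subset hIJ, (encard_le_encard hIJ).trans hJ.2⟩)
    (fun I J hI hJ hlt => by
      obtain ⟨e, he, hi⟩ := hI.1.augment hJ.1 hlt
      refine ⟨e, he.1, he.2, hi, ?_⟩
      rw [encard_insert_of_notMem he.2]
      exact (Order.add_one_le_of_lt hlt).trans hJ.2)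
    ⟨k, fun _ hI => hI.2⟩
    (fun _ hI => hI.1.subset_ground)).matroid

@[simp] theorem truncation_ground {α : Type*} (M : Matroid α) (k : ℕ) :
    (M.truncation k).E = M.E := rfl

@[simp] theorem truncation_indep_iff {α : Type*} (M : Matroid α) (k : ℕ) (I : Set α) :
    (M.truncation k).Indep I ↔ M.Indep I ∧ I.encard ≤ k := Iff.rfl

/-- The uniform matroid on the set `E` in which the independent sets are the subsets of `E` with at
most `k` elements. -/
def uniformOnSet {α : Type*} (E : Set α) (k : ℕ) : Matroid α :=
  (freeOn E).truncation k

/-- The uniform matroid `U_{k,n}`. -/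
def unif (k n : ℕ) : Matroid (Fin n) :=
  uniformOnSet univ k

/-- The free extension `M + e` of `M` by one new element `e`, namely `T_r(M ⊕ U_{1,1})` where `r` is
the rank of `M`. -/
noncomputable def freeExtension {α : Type*} (M : Matroid α) : Matroid (α ⊕ Fin 1) :=
  (M.sum (unif 1 1)).truncation M.eRank.toNat

/-! ### The excluded minors that occur in the statement -/

/-- `P_n = T_n(U_{n-1,n} ⊕ U_{n-1,n})`. -/
def matP (n : ℕ) : Matroid (Fin n ⊕ Fin n) :=
  ((unif (n - 1) n).sum (unif (n - 1) n)).truncation n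

/-- `B_{n,k} = T_n(U_{n-1,n} ⊕ U_{n-1,n} ⊕ U_{k-1,k})`. -/
def matB (n k : ℕ) : Matroid ((Fin n ⊕ Fin n) ⊕ Fin k) :=
  (((unif (n - 1) n).sum (unif (n - 1) n)).sum (unif (k - 1) k)).truncation n

/-- `matC n k` is the matroid `C_{n+k,k}`, the dual of `B_{n,k}`. -/
def matC (n k : ℕ) : Matroid ((Fin n ⊕ Fin n) ⊕ Fin k) :=
  (matB n k)✶

/-- `D_n = (P_{n-1} ⊕ U_{1,1}) + x`. -/
noncomputable def matD (n : ℕ) :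
    Matroid (((Fin (n - 1) ⊕ Fin (n - 1)) ⊕ Fin 1) ⊕ Fin 1) :=
  ((matP (n - 1)).sum (unif 1 1)).freeExtension

/-- `E_n` is the dual of `D_n`. -/
noncomputable def matE (n : ℕ) :
    Matroid (((Fin (n - 1) ⊕ Fin (n - 1)) ⊕ Fin 1) ⊕ Fin 1) :=
  (matD n)✶

/-- `R_3`, the rank-`3` matroid on seven elements obtained by adding two elements freely to a
rank-`2` flat that consists of two `2`-circuits and one further element:
`R_3 = T_3(T_2(U_{1,2} ⊕ U_{1,2} ⊕ U_{1,1}) ⊕ U_{2,2})`. -/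
def matR₃ : Matroid (((Fin 2 ⊕ Fin 2) ⊕ Fin 1) ⊕ Fin 2) :=
  (((((unif 1 2).sum (unif 1 2)).sum (unif 1 1)).truncation 2).sum (unif 2 2)).truncation 3

/-- `R_4` is the dual of `R_3`. -/
def matR₄ : Matroid (((Fin 2 ⊕ Fin 2) ⊕ Fin 1) ⊕ Fin 2) :=
  matR₃✶

/-! ### Parallel connections -/

/-- The independent sets of the parallel connection of `M₁` and `M₂` with basepoint `x`. When `x`
is a loop in at most one of `M₁` and `M₂`, the maximal ones are exactly the sets
`B ⊆ E(M₁) ∪ E(M₂)` such that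
* `x ∈ B` and each `B ∩ E(Mᵢ)` is a basis of `Mᵢ`, or
* `x ∉ B` and, for one choice of `{i, j} = {1, 2}`, the set `B ∩ E(Mᵢ)` is a basis of `Mᵢ` and
  `(B ∩ E(Mⱼ)) ∪ {x}` is a basis of `Mⱼ`.
If `x` is a loop of both, the matroid is the direct sum with the two loops identified. -/
def ParallelIndep {α : Type*} (M₁ M₂ : Matroid α) (x : α) (I : Set α) : Prop :=
  I ⊆ M₁.E ∪ M₂.E ∧ M₁.Indep (I ∩ M₁.E) ∧ M₂.Indep (I ∩ M₂.E) ∧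
    (M₁.Indep (insert x (I ∩ M₁.E)) ∨ M₂.Indep (insert x (I ∩ M₂.E)) ∨
      (M₁.IsLoop x ∧ M₂.IsLoop x))

/-- A cardinality argument for the augmentation step. -/
theorem Indep.exists_augment_of_ncard_lt {α : Type*} {M : Matroid α} [M.Finite] {I J : Set α}
    (hI : M.Indep I) (hJ : M.Indep J) (h : I.ncard < J.ncard) :
    ∃ e ∈ J, e ∉ I ∧ M.Indep (insert e I) := by
  have hIf : I.Finite := M.ground_finite.subset hI.subset_ground
  have hJf : J.Finite := M.ground_finite.subset hJ.subset_ground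
  obtain ⟨e, he, hi⟩ := hI.augment hJ (by
    rw [← hIf.cast_ncard_eq, ← hJf.cast_ncard_eq]; exact_mod_cast h)
  exact ⟨e, he.1, he.2, hi⟩

theorem ParallelIndep.symm {α : Type*} {M₁ M₂ : Matroid α} {x : α} {I : Set α}
    (h : ParallelIndep M₁ M₂ x I) : ParallelIndep M₂ M₁ x I := by
  obtain ⟨h1, h2, h3, h4⟩ := h
  exact ⟨union_comm M₁.E M₂.E ▸ h1, h3, h2, by tauto⟩

theorem ParallelIndep.subset {α : Type*} {M₁ M₂ : Matroid α} {x : α} {I J : Set α}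
    (h : ParallelIndep M₁ M₂ x J) (hIJ : I ⊆ J) : ParallelIndep M₁ M₂ x I := by
  obtain ⟨h1, h2, h3, h4⟩ := h
  refine ⟨hIJ.trans h1, h2.subset (by gcongr), h3.subset (by gcongr), ?_⟩
  rcases h4 with h4 | h4 | h4
  · exact Or.inl (h4.subset (by gcongr))
  · exact Or.inr (Or.inl (h4.subset (by gcongr)))
  · exact Or.inr (Or.inr h4)

theorem ParallelIndep.ncard_add {α : Type*} {M₁ M₂ : Matroid α} [M₁.Finite] [M₂.Finite]
    {x : α} (hx : M₁.E ∩ M₂.E = {x}) {I : Set α} (hI : ParallelIndep M₁ M₂ x I) :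
    I.ncard + (I ∩ {x}).ncard = (I ∩ M₁.E).ncard + (I ∩ M₂.E).ncard := by
  have h1 : (I ∩ M₁.E) ∪ (I ∩ M₂.E) = I := by
    rw [← inter_union_distrib_left, inter_eq_left]; exact hI.1
  have h2 : (I ∩ M₁.E) ∩ (I ∩ M₂.E) = I ∩ {x} := by
    rw [← inter_inter_distrib_left, hx]
  rw [← ncard_union_add_ncard_inter (I ∩ M₁.E) (I ∩ M₂.E)
    (M₁.ground_finite.subset inter_subset_right) (M₂.ground_finite.subset inter_subset_right),
    h1, h2]

/-- Adding an element of `M₁` other than the basepoint. -/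
theorem ParallelIndep.insert_left {α : Type*} {M₁ M₂ : Matroid α} {x e : α}
    (hx : M₁.E ∩ M₂.E = {x}) {I : Set α} (hI : ParallelIndep M₁ M₂ x I) (hex : e ≠ x)
    (heE : e ∈ M₁.E) (he : M₁.Indep (insert e (I ∩ M₁.E)))
    (h : M₁.Indep (insert x (insert e (I ∩ M₁.E))) ∨ M₂.Indep (insert x (I ∩ M₂.E)) ∨
      (M₁.IsLoop x ∧ M₂.IsLoop x)) :
    ParallelIndep M₁ M₂ x (insert e I) := by
  have he2 : e ∉ M₂.E := fun h2 => hex (by simpa using hx.subset ⟨heE, h2⟩)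
  refine ⟨insert_subset (Or.inl heE) hI.1, ?_, ?_, ?_⟩
  · rwa [insert_inter_of_mem heE]
  · rw [insert_inter_of_notMem he2]; exact hI.2.2.1
  · rwa [insert_inter_of_mem heE, insert_inter_of_notMem he2]

/-- Adding the basepoint. -/
theorem ParallelIndep.insert_basepoint {α : Type*} {M₁ M₂ : Matroid α} {x : α}
    (hx : M₁.E ∩ M₂.E = {x}) {I : Set α} (hI : ParallelIndep M₁ M₂ x I)
    (h1 : M₁.Indep (insert x (I ∩ M₁.E))) (h2 : M₂.Indep (insert x (I ∩ M₂.E))) :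
    ParallelIndep M₁ M₂ x (insert x I) := by
  have hx1 : x ∈ M₁.E ∩ M₂.E := by rw [hx]; rfl
  refine ⟨insert_subset (Or.inl hx1.1) hI.1, ?_, ?_, Or.inl ?_⟩
  · rwa [insert_inter_of_mem hx1.1]
  · rwa [insert_inter_of_mem hx1.2]
  · rwa [insert_inter_of_mem hx1.1, insert_idem]

/-- The augmentation step when `I ∪ x` is independent in `M₁`. -/
theorem ParallelIndep.augment_aux {α : Type*} {M₁ M₂ : Matroid α} [M₁.Finite] [M₂.Finite]
    {x : α} (hx : M₁.E ∩ M₂.E = {x}) {I J : Set α} (hI : ParallelIndep M₁ M₂ x I)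
    (hJ : ParallelIndep M₁ M₂ x J) (hlt : I.ncard < J.ncard)
    (hI₁ : M₁.Indep (insert x (I ∩ M₁.E))) :
    ∃ e ∈ J, e ∉ I ∧ ParallelIndep M₁ M₂ x (insert e I) := by
  have hx1 : x ∈ M₁.E := (hx.symm.subset rfl : x ∈ M₁.E ∩ M₂.E).1
  have hx2 : x ∈ M₂.E := (hx.symm.subset rfl : x ∈ M₁.E ∩ M₂.E).2
  have hx21 : M₂.E ∩ M₁.E = {x} := by rw [inter_comm, hx]
  have cI := hI.ncard_add hx
  have cJ := hJ.ncard_add hx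
  have hcx : ∀ K : Set α, (x ∈ K ∧ (K ∩ {x}).ncard = 1) ∨ (x ∉ K ∧ (K ∩ {x}).ncard = 0) := by
    intro K
    by_cases hK : x ∈ K
    · exact Or.inl ⟨hK, by simp [hK]⟩
    · exact Or.inr ⟨hK, by simp [hK]⟩
  have hfin1 : ∀ K : Set α, (K ∩ M₁.E).Finite := fun K => M₁.ground_finite.subset inter_subset_right
  have hfin2 : ∀ K : Set α, (K ∩ M₂.E).Finite := fun K => M₂.ground_finite.subset inter_subset_right
  have ci1 : ∀ K : Set α, x ∉ K → (insert x (K ∩ M₁.E)).ncard = (K ∩ M₁.E).ncard + 1 :=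
    fun K hK => ncard_insert_of_notMem (fun h => hK h.1) (hfin1 K)
  have ci2 : ∀ K : Set α, x ∉ K → (insert x (K ∩ M₂.E)).ncard = (K ∩ M₂.E).ncard + 1 :=
    fun K hK => ncard_insert_of_notMem (fun h => hK h.1) (hfin2 K)
  have cm1 : ∀ K : Set α, x ∈ K → (insert x (K ∩ M₁.E)) = (K ∩ M₁.E) :=
    fun K hK => insert_eq_of_mem ⟨hK, hx1⟩
  have cm2 : ∀ K : Set α, x ∈ K → (insert x (K ∩ M₂.E)) = (K ∩ M₂.E) :=
    fun K hK => insert_eq_of_mem ⟨hK, hx2⟩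
  -- adding on the first side, keeping `x` available there
  have A1 : ∀ S : Set α, S ⊆ insert x (J ∩ M₁.E) → M₁.Indep S →
      (insert x (I ∩ M₁.E)).ncard < S.ncard →
      ∃ e ∈ J, e ∉ I ∧ ParallelIndep M₁ M₂ x (insert e I) := by
    intro S hS hSi hc
    obtain ⟨e, heS, hen, hei⟩ := hI₁.exists_augment_of_ncard_lt hSi hc
    have hex : e ≠ x := fun h => hen (Or.inl h)
    have heJ : e ∈ J ∩ M₁.E := (hS heS).resolve_left hex
    refine ⟨e, heJ.1, fun h => hen (Or.inr ⟨h, heJ.2⟩), hI.insert_left hx hex heJ.2 ?_ ?_⟩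
    · exact hei.subset (insert_subset_insert (subset_insert _ _))
    · exact Or.inl (by rwa [insert_comm])
  -- adding on the second side
  have A2 : (I ∩ M₂.E).ncard < (J ∩ M₂.E).ncard →
      ∃ e ∈ J, e ∉ I ∧ ParallelIndep M₁ M₂ x (insert e I) := by
    intro hc
    obtain ⟨e, heS, hen, hei⟩ := hI.2.2.1.exists_augment_of_ncard_lt hJ.2.2.1 hc
    have heI : e ∉ I := fun h => hen ⟨h, heS.2⟩
    refine ⟨e, heS.1, heI, ?_⟩
    by_cases hex : e = x
    · subst hex
      exact hI.insert_basepoint hx hI₁ hei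
    · exact (hI.symm.insert_left hx21 hex heS.2 hei (Or.inr (Or.inl hI₁))).symm
  rcases hJ.2.2.2 with hJ4 | hJ4 | hJ4
  · by_cases hc : (insert x (I ∩ M₁.E)).ncard < (insert x (J ∩ M₁.E)).ncard
    · exact A1 _ subset_rfl hJ4 hc
    · apply A2
      rcases hcx I with ⟨a, a'⟩ | ⟨a, a'⟩ <;> rcases hcx J with ⟨b, b'⟩ | ⟨b, b'⟩
      · rw [cm1 I a, cm1 J b] at hc; omega
      · rw [cm1 I a, ci1 J b] at hc; omega
      · rw [ci1 I a, cm1 J b] at hc; omega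
      · rw [ci1 I a, ci1 J b] at hc; omega
  · by_cases hc2 : (I ∩ M₂.E).ncard < (J ∩ M₂.E).ncard
    · exact A2 hc2
    by_cases hc1 : (insert x (I ∩ M₁.E)).ncard < (J ∩ M₁.E).ncard
    · exact A1 _ (subset_insert _ _) hJ.2.1 hc1
    have hxJ : x ∉ J := by
      intro b
      have b' : (J ∩ {x}).ncard = 1 := by simp [b]
      rcases hcx I with ⟨a, a'⟩ | ⟨a, a'⟩
      · rw [cm1 I a] at hc1; omega
      · rw [ci1 I a] at hc1; omega
    have b' : (J ∩ {x}).ncard = 0 := by simp [hxJ]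
    have hc3 : (I ∩ M₂.E).ncard < (insert x (J ∩ M₂.E)).ncard := by
      rw [ci2 J hxJ]
      rcases hcx I with ⟨a, a'⟩ | ⟨a, a'⟩
      · rw [cm1 I a] at hc1; omega
      · rw [ci1 I a] at hc1; omega
    obtain ⟨e, heS, hen, hei⟩ := hI.2.2.1.exists_augment_of_ncard_lt hJ4 hc3
    rcases heS with rfl | heS
    · have a' : (I ∩ {e}).ncard = 0 := by
        have : e ∉ I := fun h => hen ⟨h, hx2⟩
        simp [this]
      obtain ⟨f, hfS, hfn, hfi⟩ := hI.2.1.exists_augment_of_ncard_lt hJ.2.1 (by omega)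
      have hfe : f ≠ e := fun h => hxJ (h ▸ hfS.1)
      exact ⟨f, hfS.1, fun h => hfn ⟨h, hfS.2⟩,
        hI.insert_left hx hfe hfS.2 hfi (Or.inr (Or.inl hei))⟩
    · have hex : e ≠ x := fun h => hxJ (h ▸ heS.1)
      exact ⟨e, heS.1, fun h => hen ⟨h, heS.2⟩,
        (hI.symm.insert_left hx21 hex heS.2 hei (Or.inr (Or.inl hI₁))).symm⟩
  · exact (hJ4.1.not_indep_of_mem (mem_insert _ _) hI₁).elim

theorem ParallelIndep.augment {α : Type*} {M₁ M₂ : Matroid α} [M₁.Finite] [M₂.Finite]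
    {x : α} (hx : M₁.E ∩ M₂.E = {x}) {I J : Set α} (hI : ParallelIndep M₁ M₂ x I)
    (hJ : ParallelIndep M₁ M₂ x J) (hlt : I.ncard < J.ncard) :
    ∃ e ∈ J, e ∉ I ∧ ParallelIndep M₁ M₂ x (insert e I) := by
  have hx21 : M₂.E ∩ M₁.E = {x} := by rw [inter_comm, hx]
  rcases hI.2.2.2 with h | h | h
  · exact hI.augment_aux hx hJ hlt h
  · obtain ⟨e, he, he', hi⟩ := hI.symm.augment_aux hx21 hJ.symm hlt h
    exact ⟨e, he, he', hi.symm⟩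
  · have hxI : ∀ K, ParallelIndep M₁ M₂ x K → (K ∩ {x}).ncard = 0 := by
      intro K hK
      have hx1 : x ∈ M₁.E := (hx.symm.subset rfl : x ∈ M₁.E ∩ M₂.E).1
      have hKx : x ∉ K := fun hm => h.1.not_indep_of_mem (X := K ∩ M₁.E) ⟨hm, hx1⟩ hK.2.1
      simp [hKx]
    have cI := hI.ncard_add hx
    have cJ := hJ.ncard_add hx
    rw [hxI I hI] at cI
    rw [hxI J hJ] at cJ
    by_cases hc : (I ∩ M₁.E).ncard < (J ∩ M₁.E).ncard
    · obtain ⟨e, heS, hen, hei⟩ := hI.2.1.exists_augment_of_ncard_lt hJ.2.1 hc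
      exact ⟨e, heS.1, fun h => hen ⟨h, heS.2⟩, hI.insert_left hx
        (fun hh => h.1.not_indep_of_mem (hh ▸ mem_insert _ _) hei) heS.2 hei (Or.inr (Or.inr h))⟩
    · obtain ⟨e, heS, hen, hei⟩ := hI.2.2.1.exists_augment_of_ncard_lt hJ.2.2.1 (by omega)
      exact ⟨e, heS.1, fun h => hen ⟨h, heS.2⟩, (hI.symm.insert_left hx21
        (fun hh => h.2.not_indep_of_mem (hh ▸ mem_insert _ _) hei) heS.2 hei
        (Or.inr (Or.inr h.symm))).symm⟩

theorem ParallelIndep.empty {α : Type*} {M₁ M₂ : Matroid α} {x : α}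
    (hx : M₁.E ∩ M₂.E = {x}) : ParallelIndep M₁ M₂ x ∅ := by
  have hx' : x ∈ M₁.E ∩ M₂.E := hx.symm.subset rfl
  refine ⟨empty_subset _, by simp, by simp, ?_⟩
  rcases M₁.isLoop_or_isNonloop x hx'.1 with h1 | h1
  · rcases M₂.isLoop_or_isNonloop x hx'.2 with h2 | h2
    · exact Or.inr (Or.inr ⟨h1, h2⟩)
    · exact Or.inr (Or.inl (by simpa using h2.indep))
  · exact Or.inl (by simpa using h1.indep)

/-- The parallel connection `P_x(M₁, M₂)` of finite matroids that meet in the basepoint `x` only. -/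
def parallelConnection {α : Type*} (M₁ M₂ : Matroid α) [M₁.Finite] [M₂.Finite] (x : α)
    (hx : M₁.E ∩ M₂.E = {x}) : Matroid α :=
  (IndepMatroid.ofFinite (M₁.ground_finite.union M₂.ground_finite) (ParallelIndep M₁ M₂ x)
    (ParallelIndep.empty hx)
    (fun _ _ hJ hIJ => hJ.subset hIJ)
    (fun _ _ hI hJ hlt => hI.augment hx hJ hlt)
    (fun _ hI => hI.1)).matroid

@[simp] theorem parallelConnection_ground {α : Type*} (M₁ M₂ : Matroid α) [M₁.Finite] [M₂.Finite]
    (x : α) (hx : M₁.E ∩ M₂.E = {x}) :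
    (parallelConnection M₁ M₂ x hx).E = M₁.E ∪ M₂.E := rfl

@[simp] theorem parallelConnection_indep_iff {α : Type*} (M₁ M₂ : Matroid α) [M₁.Finite]
    [M₂.Finite] (x : α) (hx : M₁.E ∩ M₂.E = {x}) (I : Set α) :
    (parallelConnection M₁ M₂ x hx).Indep I ↔ ParallelIndep M₁ M₂ x I := Iff.rfl

/-- `M` is a parallel connection using basepoint `x`, of two matroids that both have elements other
than `x`. -/
def IsParallelConnectionAt {α : Type*} (M : Matroid α) (x : α) : Prop :=
  ∃ (N₁ N₂ : Matroid α) (_ : N₁.Finite) (_ : N₂.Finite) (hx : N₁.E ∩ N₂.E = {x}),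
    N₁.E.Nontrivial ∧ N₂.E.Nontrivial ∧ M = parallelConnection N₁ N₂ x hx

end Matroid

/-! A presentation by `r` intervals is encoded by two height functions: `P v` and `Q v` count the
lower and the upper endpoints below position `v`. The intervals that meet `[u, v)` number `P v - Q
u`. By Hall's theorem for intervals, a set is independent exactly when it has at most that many
elements in every `[u, v)`; its bases are the lattice paths that stay between `Q` and `P`
(`Bounds.isPartialTransversal_iff`, `PathRep.isBase_iff`). All questions about lattice path matroids
become arithmetic of two step functions. Reversing the order and taking the dual correspond to
simple operations on the pair, which halve the case analysis. For a connected matroid the two paths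
meet only at their ends.

Part (i): reverse the order of `M₁` so that `x` is last, and let it be first in `M₂`. By
connectedness `x` lies in one interval on each side, and merging these two intervals into one gives
a pair of paths for the parallel connection (`PathRep.glue`).

Part (ii): write `x = e t`. If `M₁` is a parallel connection at `x`, the two sides separate the
contraction of `x`. If at least two intervals contained `x`, exchanges within suitable bases
containing `x` would put all other elements on the same side. Hence `P (t + 1) ≤ Q t + 1`
(`PathRep.le_of_separates`), so at most one interval contains `x`, and a parallel copy `y` can be
inserted right after `x` (`PathRep.double`).

Part (iii): if neither path turns the wrong way before `x`, the elements up to `x` are clones and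
`x` can be moved to the front. So for a non-terminal `x`, at least one path has such a turn on each
side of `x` (`PathRep.left_of_not_isTerminal` and its mirror image). If only one interval contains
`x`, the contraction of `x` is disconnected, so `M₂` has rank above one; then `M₁` has a
five-element minor at `x` (`pat_of_cut`), which becomes `C_{4,2}` when `x` is replaced by two
elements of a triangle with `x` found in a minor of `M₂`. Otherwise `exists_pat` distinguishes which
paths turn. When the deletion of `x` pinches the paths, `P_2 + x` appears. If `P` turns on both
sides, or `Q` does, a rank-three minor with a parallel pair and two more points on a line appears.
If `P` turns on the left and `Q` on the right, `P_m + x` appears. The remaining combination is dual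
to this one and yields the dual of `P_m + x` with `m ≥ 3`, or the dual of a rank-two matroid with
two parallel pairs and two points.

A circuit of `M₂` through `x` and another element, with all but these two contracted, makes that
element parallel to `x`. So the parallel connection contains each of these minors with `x` doubled
(`PathRep.hasMinorIso_parallelConnection`), and the doubled matroids are `B_{m,2}`, `R_3`, `E_{m+1}`
and `R_4`. -/

namespace LatticePath

/-! ### Counting elements of a set of positions -/

open Classical in
/-- The number of elements of `S` that are smaller than `v`. -/
noncomputable def cnt (S : Set ℕ) (v : ℕ) : ℕ := Nat.count (· ∈ S) v

open Classical in
/-- The indicator of a proposition. -/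
noncomputable def ind (p : Prop) : ℕ := if p then 1 else 0

theorem ind_true {p : Prop} (h : p) : ind p = 1 := if_pos h

theorem ind_false {p : Prop} (h : ¬ p) : ind p = 0 := if_neg h

theorem ind_le_one (p : Prop) : ind p ≤ 1 := by unfold ind; split_ifs <;> simp

theorem ind_congr {p q : Prop} (h : p ↔ q) : ind p = ind q := by rw [propext h]

@[simp] theorem cnt_zero (S : Set ℕ) : cnt S 0 = 0 := by simp [cnt]

theorem cnt_succ (S : Set ℕ) (v : ℕ) : cnt S (v + 1) = cnt S v + ind (v ∈ S) := by
  classical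
  simp only [cnt, ind, Nat.count_succ]

theorem cnt_mono (S : Set ℕ) {u v : ℕ} (h : u ≤ v) : cnt S u ≤ cnt S v :=
  open Classical in Nat.count_monotone _ h

theorem cnt_le_add (S : Set ℕ) {u v : ℕ} (h : u ≤ v) : cnt S v ≤ cnt S u + (v - u) := by
  induction v, h using Nat.le_induction with
  | base => omega
  | succ v hv ih => have := ind_le_one (v ∈ S); rw [cnt_succ]; omega

theorem cnt_le (S : Set ℕ) (v : ℕ) : cnt S v ≤ v := by
  simpa using cnt_le_add S (Nat.zero_le v)

theorem cnt_congr {S T : Set ℕ} {v : ℕ} (h : ∀ j < v, j ∈ S ↔ j ∈ T) : cnt S v = cnt T v := by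
  induction v with
  | zero => simp
  | succ v ih =>
    rw [cnt_succ, cnt_succ, ih (fun j hj => h j (by omega)), ind_congr (h v (by omega))]

theorem cnt_insert {S : Set ℕ} {k : ℕ} (hk : k ∉ S) (v : ℕ) :
    cnt (insert k S) v = cnt S v + ind (k < v) := by
  induction v with
  | zero => simp [ind]
  | succ v ih =>
    rw [cnt_succ, cnt_succ, ih]
    rcases lt_trichotomy k v with h | rfl | h
    · rw [ind_true h, ind_true (show k < v + 1 by omega),
        ind_congr (show v ∈ insert k S ↔ v ∈ S by simp; omega)]; omega
    · rw [ind_true (show k ∈ insert k S by simp), ind_false hk, ind_false (lt_irrefl k),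
        ind_true (show k < k + 1 by omega)]
    · rw [ind_false (show ¬ k < v by omega), ind_false (show ¬ k < v + 1 by omega),
        ind_congr (show v ∈ insert k S ↔ v ∈ S by simp; omega)]; omega

theorem cnt_union {S T : Set ℕ} (h : Disjoint S T) (v : ℕ) :
    cnt (S ∪ T) v = cnt S v + cnt T v := by
  induction v with
  | zero => simp
  | succ v ih =>
    rw [cnt_succ, cnt_succ, cnt_succ, ih]
    by_cases h1 : v ∈ S
    · have h2 : v ∉ T := fun h2 => h.notMem_of_mem_left h1 h2
      rw [ind_true h1, ind_false h2, ind_true (show v ∈ S ∪ T from Or.inl h1)]; omega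
    · rw [ind_false h1, ind_congr (show v ∈ S ∪ T ↔ v ∈ T by simp [h1])]; omega

theorem cnt_compl (S : Set ℕ) (v : ℕ) : cnt S v + cnt Sᶜ v = v := by
  induction v with
  | zero => simp
  | succ v ih =>
    rw [cnt_succ, cnt_succ]
    by_cases h1 : v ∈ S
    · rw [ind_true h1, ind_false (by simpa using h1)]; omega
    · rw [ind_false h1, ind_true (by simpa using h1)]; omega

/-- Counting after a shift of the positions. -/
theorem cnt_add (S : Set ℕ) (u w : ℕ) : cnt S (u + w) = cnt S u + cnt ((u + ·) ⁻¹' S) w := by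
  induction w with
  | zero => simp
  | succ w ih => rw [← add_assoc, cnt_succ, cnt_succ, ih, add_assoc]; rfl

theorem cnt_eq_ncard (S : Set ℕ) (v : ℕ) : cnt S v = (S ∩ Iio v).ncard := by
  classical
  rw [cnt, Nat.count_eq_card_filter_range, ← ncard_coe_finset]
  congr 1; ext; simp [and_comm]

theorem cnt_eq_add_card (S : Set ℕ) {u v : ℕ} (h : u ≤ v) :
    cnt S v = cnt S u + (S ∩ Ico u v).ncard := by
  rw [cnt_eq_ncard, cnt_eq_ncard, ← ncard_union_eq]
  · congr 1; ext j; simp only [mem_inter_iff, mem_Iio, mem_union, mem_Ico]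
    constructor
    · rintro ⟨h1, h2⟩
      by_cases h3 : j < u
      · exact Or.inl ⟨h1, h3⟩
      · exact Or.inr ⟨h1, by omega, h2⟩
    · rintro (⟨h1, h2⟩ | ⟨h1, h2, h3⟩)
      · exact ⟨h1, by omega⟩
      · exact ⟨h1, h3⟩
  · rw [Set.disjoint_left]; intro j hj hj'
    have := hj.2; have := hj'.2.1; simp at *; omega

/-! ### Pairs of bounding paths -/

/-- `P` and `Q` are the height functions of two lattice paths with the same end, and `Q` stays
weakly below `P`. -/
structure Bounds (n : ℕ) (P Q : ℕ → ℕ) : Prop where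
  P0 : P 0 = 0
  Q0 : Q 0 = 0
  P_step : ∀ j, P j ≤ P (j + 1) ∧ P (j + 1) ≤ P j + 1
  Q_step : ∀ j, Q j ≤ Q (j + 1) ∧ Q (j + 1) ≤ Q j + 1
  eq_n : P n = Q n
  le : ∀ j ≤ n, Q j ≤ P j

/-- The path that has its north steps at the positions in `S` stays between `Q` and `P`. -/
def Good (n : ℕ) (P Q : ℕ → ℕ) (S : Set ℕ) : Prop :=
  ∀ v ≤ n, Q v ≤ cnt S v ∧ cnt S v ≤ P v

/-- In every interval of positions, `S` has no more elements than there are intervals of the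
presentation that meet it. -/
def IndepCond (n : ℕ) (P Q : ℕ → ℕ) (S : Set ℕ) : Prop :=
  ∀ u v, u ≤ v → v ≤ n → cnt S v + Q u ≤ P v + cnt S u

section Steps

variable {f : ℕ → ℕ}

theorem step_mono (hf : ∀ j, f j ≤ f (j + 1) ∧ f (j + 1) ≤ f j + 1) {u v : ℕ} (h : u ≤ v) :
    f u ≤ f v :=
  monotone_nat_of_le_succ (fun j => (hf j).1) h

theorem step_le_add (hf : ∀ j, f j ≤ f (j + 1) ∧ f (j + 1) ≤ f j + 1) {u v : ℕ} (h : u ≤ v) :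
    f v ≤ f u + (v - u) := by
  induction v, h using Nat.le_induction with
  | base => omega
  | succ v hv ih => have := hf v; omega

/-- A function with steps `0` and `1` counts the positions of its north steps. -/
theorem cnt_steps (n : ℕ) (hf0 : f 0 = 0) (hf : ∀ j < n, f j ≤ f (j + 1) ∧ f (j + 1) ≤ f j + 1)
    {v : ℕ} (hv : v ≤ n) : cnt {j | j < n ∧ f j < f (j + 1)} v = f v := by
  induction v with
  | zero => simp [hf0]
  | succ v ih =>
    rw [cnt_succ, ih (by omega)]
    have h1 := hf v (by omega)
    by_cases h : f v < f (v + 1)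
    · rw [ind_true (by simp [h]; omega)]; omega
    · rw [ind_false (by simp [h])]; omega

end Steps

theorem Good.indepCond {n : ℕ} {P Q : ℕ → ℕ} {S : Set ℕ} (h : Good n P Q S) :
    IndepCond n P Q S := fun u v huv hv => by
  have := (h u (huv.trans hv)).1; have := (h v hv).2; omega

/-- For a set of full size, the intervals `[0, v)` give the upper bound of the path condition and
the intervals `[v, n)` give the lower one. -/
theorem Bounds.good_iff {n : ℕ} {P Q : ℕ → ℕ} (hB : Bounds n P Q) (S : Set ℕ) :
    Good n P Q S ↔ IndepCond n P Q S ∧ cnt S n = P n := by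
  constructor
  · intro h
    refine ⟨h.indepCond, ?_⟩
    have := h n le_rfl; have := hB.eq_n; omega
  · rintro ⟨h, hn⟩ v hv
    have h1 := h 0 v (by omega) hv
    have h2 := h v n hv le_rfl
    rw [hB.Q0, cnt_zero] at h1
    have := hB.eq_n
    constructor <;> omega

theorem Bounds.good_P {n : ℕ} {P Q : ℕ → ℕ} (hB : Bounds n P Q) :
    Good n P Q {j | j < n ∧ P j < P (j + 1)} := fun v hv => by
  rw [cnt_steps n hB.P0 (fun j _ => hB.P_step j) hv]
  exact ⟨hB.le v hv, le_rfl⟩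

theorem cnt_image_congr {α : Type*} {e : ℕ → α} {n : ℕ} (he : InjOn e (Iio n)) {S : Set ℕ}
    (hS : S ⊆ Iio n) {v : ℕ} (hv : v ≤ n) : cnt (e ⁻¹' (e '' S)) v = cnt S v := by
  apply cnt_congr
  intro j hj
  constructor
  · rintro ⟨i, hi, hij⟩
    rwa [← he (hS hi) (show j ∈ Iio n by simp; omega) hij]
  · exact fun h => ⟨j, h, rfl⟩

/-! ### Matchings into intervals -/

/-- Matching a set of positions into intervals from left to right. -/
noncomputable def greedy (Q : ℕ → ℕ) (S : Set ℕ) : ℕ → ℕ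
  | 0 => Q 0
  | j + 1 => max (Q (j + 1)) (greedy Q S j + ind (j ∈ S))

theorem le_greedy (Q : ℕ → ℕ) (S : Set ℕ) (j : ℕ) : Q j ≤ greedy Q S j := by
  cases j with
  | zero => simp [greedy]
  | succ j => simp [greedy]

/-- The witness `u` is the last place where the maximum was attained by `Q`; from there on the
greedy value only counts elements of `S`. -/
theorem greedy_eq (Q : ℕ → ℕ) (S : Set ℕ) (j : ℕ) :
    ∃ u ≤ j, greedy Q S j + cnt S u = Q u + cnt S j := by
  induction j with
  | zero => exact ⟨0, le_rfl, by simp [greedy]⟩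
  | succ j ih =>
    rcases le_total (greedy Q S j + ind (j ∈ S)) (Q (j + 1)) with h | h
    · exact ⟨j + 1, le_rfl, by rw [greedy, max_eq_left h]⟩
    · obtain ⟨u, hu, h1⟩ := ih
      refine ⟨u, by omega, ?_⟩
      rw [greedy, max_eq_right h, cnt_succ]; omega

theorem greedy_mono (Q : ℕ → ℕ) (S : Set ℕ) : Monotone (greedy Q S) :=
  monotone_nat_of_le_succ (fun j => by
    rw [greedy]; exact le_max_of_le_right (Nat.le_add_right _ _))

theorem greedy_lt (Q : ℕ → ℕ) {S : Set ℕ} {i j : ℕ} (hi : i ∈ S) (hij : i < j) :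
    greedy Q S i < greedy Q S j := by
  refine lt_of_lt_of_le ?_ (greedy_mono Q S (Nat.succ_le_of_lt hij))
  show _ < greedy Q S (i + 1)
  rw [greedy, ind_true hi]
  exact lt_of_lt_of_le (Nat.lt_succ_self _) (le_max_right _ _)

/-- Hall's condition for intervals. A matching sends the elements in `[u, v)` injectively to indices
in `[Q u, P v)`. Conversely each element is matched to its greedy index, the least one that has not
been passed by `Q` and exceeds the indices already used. -/
theorem Bounds.isPartialTransversal_iff {α : Type*} {n r : ℕ} {e : ℕ → α}
    (he : InjOn e (Iio n)) {P Q : ℕ → ℕ} (hB : Bounds n P Q) (hr : P n = r) {a b : Fin r → ℕ}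
    (ha : ∀ i, ∀ v ≤ n, a i < v ↔ (i : ℕ) < P v)
    (hb : ∀ i, ∀ v ≤ n, b i < v ↔ (i : ℕ) < Q v) {I : Set α} (hI : I ⊆ e '' Iio n) :
    Matroid.IsPartialTransversal (fun i => e '' {j | j < n ∧ a i ≤ j ∧ j ≤ b i}) I ↔
      IndepCond n P Q (e ⁻¹' I) := by
  classical
  constructor
  · rintro ⟨φ, hφ, hm⟩ u v huv hv
    rw [cnt_eq_add_card _ huv]
    have h : ((e ⁻¹' I) ∩ Ico u v).ncard ≤ (Ico (Q u) (P v)).ncard := by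
      refine ncard_le_ncard_of_injOn
        -- The value `0` is never taken by this branch on the set in question, where always `e j ∈
        -- I`.
        (fun j => if h : e j ∈ I then (φ ⟨e j, h⟩ : ℕ) else 0) ?_ ?_ (finite_Ico _ _)
      · rintro j ⟨hj, hju, hjv⟩
        have hj' : e j ∈ I := hj
        obtain ⟨i, ⟨hin, hai, hbi⟩, hie⟩ := hm ⟨e j, hj'⟩
        obtain rfl : i = j := he hin (show j < n by omega) hie
        simp only [hj', dif_pos, mem_Ico]
        refine ⟨?_, (ha _ v hv).1 (by omega)⟩
        by_contra hlt
        have := (hb (φ ⟨e i, hj'⟩) u (by omega)).2 (by omega)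
        omega
      · rintro j ⟨hj, hju, hjv⟩ k ⟨hk, hku, hkv⟩ hjk
        have hj' : e j ∈ I := hj
        have hk' : e k ∈ I := hk
        simp only [hj', hk', dif_pos] at hjk
        have := congrArg Subtype.val (hφ (Fin.ext hjk))
        exact he (show j < n by omega) (show k < n by omega) this
    rw [← Finset.coe_Ico (Q u), ncard_coe_finset, Nat.card_Ico] at h
    have := step_mono hB.Q_step huv
    have := hB.le v hv
    omega
  · intro h
    have hmem : ∀ y : I, ∃ j < n, e j = y := fun y => hI y.2
    choose p hp hpe using hmem
    have hpS : ∀ y, p y ∈ e ⁻¹' I := fun y => by simp [hpe]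
    -- The condition on `[u, p y + 1)`, with `u` the last reset of the greedy index, says that the
    -- interval with this index has already started.
    have hlt : ∀ y, greedy Q (e ⁻¹' I) (p y) < P (p y + 1) := fun y => by
      obtain ⟨u, hu, h1⟩ := greedy_eq Q (e ⁻¹' I) (p y)
      have h2 := h u (p y + 1) (by omega) (hp y)
      rw [cnt_succ, ind_true (hpS y)] at h2
      omega
    refine ⟨fun y => ⟨greedy Q (e ⁻¹' I) (p y), hr ▸ (hlt y).trans_le
      (step_mono hB.P_step (hp y))⟩, ?_, fun y => ⟨p y, ⟨hp y, ?_, ?_⟩, hpe y⟩⟩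
    · intro y z hyz
      have hyz' : greedy Q (e ⁻¹' I) (p y) = greedy Q (e ⁻¹' I) (p z) := congrArg Fin.val hyz
      rcases lt_trichotomy (p y) (p z) with h1 | h1 | h1
      · have := greedy_lt Q (hpS y) h1; omega
      · exact Subtype.ext (by rw [← hpe, ← hpe, h1])
      · have := greedy_lt Q (hpS z) h1; omega
    · exact Nat.lt_succ_iff.1 ((ha _ _ (hp y)).2 (hlt y))
    · by_contra hc
      have := (hb _ _ (hp y).le).1 (not_le.1 hc)
      have := le_greedy Q (e ⁻¹' I) (p y)
      simp only at *
      omega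

/-! ### Matroids described by bounding paths -/

/-- The matroid `M` has ground set `{e 0, …, e (n - 1)}`, and its bases correspond to the lattice
paths between `Q` and `P`. -/
structure PathRep {α : Type*} (M : Matroid α) (n : ℕ) (e : ℕ → α) (P Q : ℕ → ℕ) : Prop where
  bounds : Bounds n P Q
  injOn : InjOn e (Iio n)
  ground : e '' Iio n = M.E
  indep_iff : ∀ I ⊆ M.E, M.Indep I ↔ IndepCond n P Q (e ⁻¹' I)

/-- The number of values of a strictly increasing sequence that are smaller than a bound. -/
theorem lt_card_filter_iff {r : ℕ} {a : Fin r → ℕ} (ha : StrictMono a) (i : Fin r) (v : ℕ) :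
    a i < v ↔ (i : ℕ) < (Finset.univ.filter fun k => a k < v).card := by
  constructor
  · intro h
    have h1 : Finset.Iic i ⊆ Finset.univ.filter fun k => a k < v := fun k hk => by
      simp only [Finset.mem_Iic] at hk
      simpa using (ha.monotone hk).trans_lt h
    have := Finset.card_le_card h1
    rw [Fin.card_Iic] at this; omega
  · intro h
    by_contra hc
    have h1 : (Finset.univ.filter fun k => a k < v) ⊆ Finset.Iio i := fun k hk => by
      simp only [Finset.mem_filter, Finset.mem_univ, true_and] at hk
      simp only [Finset.mem_Iio]
      by_contra hik
      exact hc ((ha.monotone (not_lt.1 hik)).trans_lt hk)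
    have := Finset.card_le_card h1
    rw [Fin.card_Iio] at this; omega

/-- Distinct intervals have distinct endpoints, so at most one endpoint sits at each position. -/
theorem card_filter_step {r : ℕ} {a : Fin r → ℕ} (ha : StrictMono a) (v : ℕ) :
    (Finset.univ.filter fun k => a k < v).card ≤ (Finset.univ.filter fun k => a k < v + 1).card ∧
    (Finset.univ.filter fun k => a k < v + 1).card ≤
      (Finset.univ.filter fun k => a k < v).card + 1 := by
  constructor
  · exact Finset.card_le_card (fun k hk => by simp at *; omega)
  · by_contra hc
    push Not at hc
    set c := (Finset.univ.filter fun k => a k < v).card with hcdef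
    have hr : (Finset.univ.filter fun k => a k < v + 1).card ≤ r := by
      simpa using Finset.card_le_univ (Finset.univ.filter fun k : Fin r => a k < v + 1)
    have h1 := (lt_card_filter_iff ha ⟨c, by omega⟩ (v + 1)).2 (by show c < _; omega)
    have h2 := (lt_card_filter_iff ha ⟨c + 1, by omega⟩ (v + 1)).2 (by show c + 1 < _; omega)
    have h3 := mt (lt_card_filter_iff ha ⟨c, by omega⟩ v).1 (by show ¬ c < _; omega)
    have h4 := mt (lt_card_filter_iff ha ⟨c + 1, by omega⟩ v).1 (by show ¬ c + 1 < _; omega)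
    have h5 : a ⟨c, by omega⟩ < a ⟨c + 1, by omega⟩ := ha (by simp)
    omega

/-- The paths count the endpoints below a position. The element `x` only serves as a default value
that extends the enumeration to all natural numbers. -/
theorem exists_pathRep {α : Type*} {M : Matroid α} {n : ℕ} {e : Fin n → α} (x : α)
    (h : M.IsPathOrder e) :
    ∃ P Q, PathRep M n (fun j => if h : j < n then e ⟨j, h⟩ else x) P Q := by
  obtain ⟨r, a, b, hab⟩ := h
  have ha : StrictMono fun i => (a i : ℕ) := hab.strictMono_lower
  have hb : StrictMono fun i => (b i : ℕ) := hab.strictMono_upper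
  set P : ℕ → ℕ := fun v => (Finset.univ.filter fun k => (a k : ℕ) < v).card with hP
  set Q : ℕ → ℕ := fun v => (Finset.univ.filter fun k => (b k : ℕ) < v).card with hQ
  have hPn : P n = r := by
    rw [hP]; simp
  have hQn : Q n = r := by
    rw [hQ]; simp
  have hB : Bounds n P Q := by
    refine ⟨by simp [hP], by simp [hQ], card_filter_step ha, card_filter_step hb,
      hPn.trans hQn.symm, fun j _ => Finset.card_le_card fun k hk => ?_⟩
    have := hab.lower_le_upper k
    simp only [Finset.mem_filter, Finset.mem_univ, true_and] at *
    exact lt_of_le_of_lt this hk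
  have hinj : InjOn (fun j => if h : j < n then e ⟨j, h⟩ else x) (Iio n) := by
    intro i hi j hj hij
    simp only [mem_Iio] at hi hj
    simp only [hi, hj, dif_pos] at hij
    simpa using hab.injective hij
  have hgr : (fun j => if h : j < n then e ⟨j, h⟩ else x) '' Iio n = M.E := by
    rw [← hab.range_eq]
    ext y
    constructor
    · rintro ⟨j, hj, rfl⟩
      simp only [mem_Iio] at hj
      exact ⟨⟨j, hj⟩, by simp [hj]⟩
    · rintro ⟨j, rfl⟩
      exact ⟨j, j.2, by simp⟩
  refine ⟨P, Q, hB, hinj, hgr, fun I hI => ?_⟩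
  rw [hab.presents.2, ← hB.isPartialTransversal_iff hinj hPn
    (fun i v _ => lt_card_filter_iff ha i v) (fun i v _ => lt_card_filter_iff hb i v)
    (hI.trans hgr.symm.subset)]
  have : (fun i => e '' Icc (a i) (b i)) = fun i =>
      (fun j => if h : j < n then e ⟨j, h⟩ else x) ''
        {j | j < n ∧ (a i : ℕ) ≤ j ∧ j ≤ (b i : ℕ)} := by
    funext i
    ext y
    constructor
    · rintro ⟨j, ⟨hj1, hj2⟩, rfl⟩
      exact ⟨j, ⟨j.2, hj1, hj2⟩, by simp⟩
    · rintro ⟨j, ⟨hj, hj1, hj2⟩, rfl⟩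
      exact ⟨⟨j, hj⟩, ⟨hj1, hj2⟩, by simp [hj]⟩
  rw [this]

/-- The positions of the north steps of a path. -/
theorem exists_steps {f : ℕ → ℕ} {n r : ℕ} (hf0 : f 0 = 0)
    (hf : ∀ j, f j ≤ f (j + 1) ∧ f (j + 1) ≤ f j + 1) (hr : f n = r) :
    ∃ a : Fin r → Fin n, StrictMono a ∧ ∀ i v, (a i : ℕ) < v ↔ (i : ℕ) < f v := by
  have hex : ∀ i : Fin r, ∃ a : ℕ, a < n ∧ f a ≤ i ∧ (i : ℕ) < f (a + 1) := by
    intro i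
    have h1 : ∃ v, (i : ℕ) < f v := ⟨n, hr ▸ i.2⟩
    classical
    have h2 := Nat.find_spec h1
    have h3 : Nat.find h1 ≤ n := Nat.find_min' h1 (hr ▸ i.2)
    have h4 : Nat.find h1 ≠ 0 := fun h => by rw [h, hf0] at h2; omega
    obtain ⟨a, ha⟩ := Nat.exists_eq_succ_of_ne_zero h4
    have h5 := Nat.find_min h1 (m := a) (by omega)
    rw [ha] at h2
    exact ⟨a, by omega, by omega, h2⟩
  choose a ha1 ha2 ha3 using hex
  have hiff : ∀ i v, a i < v ↔ (i : ℕ) < f v := fun i v =>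
    ⟨fun h => (ha3 i).trans_le (step_mono hf h), fun h => by
      by_contra hc
      have := step_mono hf (not_lt.1 hc)
      have := ha2 i
      omega⟩
  refine ⟨fun i => ⟨a i, ha1 i⟩, fun i k hik => ?_, hiff⟩
  have h1 : (i : ℕ) < k := hik
  have h2 := ha3 k
  have h3 := (hf (a k)).2
  exact (hiff i (a k)).2 (by omega)

/-- The `i`-th interval runs from the `i`-th north step of `P` to the `i`-th north step of `Q`; it
is nonempty because `Q` stays below `P`. -/
theorem PathRep.isPathOrder {α : Type*} {M : Matroid α} {n : ℕ} {e : ℕ → α} {P Q : ℕ → ℕ}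
    (h : PathRep M n e P Q) : M.IsPathOrder (fun i : Fin n => e i) := by
  have hB := h.bounds
  obtain ⟨a, ha, ha'⟩ := exists_steps hB.P0 hB.P_step (rfl : P n = P n)
  obtain ⟨b, hb, hb'⟩ := exists_steps hB.Q0 hB.Q_step hB.eq_n.symm
  have himg : (fun i => (fun i : Fin n => e i) '' Icc (a i) (b i)) = fun i =>
      e '' {j | j < n ∧ (a i : ℕ) ≤ j ∧ j ≤ (b i : ℕ)} := by
    funext i
    ext y
    constructor
    · rintro ⟨j, ⟨hj1, hj2⟩, rfl⟩
      exact ⟨j, ⟨j.2, hj1, hj2⟩, rfl⟩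
    · rintro ⟨j, ⟨hj, hj1, hj2⟩, rfl⟩
      exact ⟨⟨j, hj⟩, ⟨hj1, hj2⟩, rfl⟩
  have hsub : ∀ i, (fun i : Fin n => e i) '' Icc (a i) (b i) ⊆ M.E := fun i => by
    rw [← h.ground]
    rintro _ ⟨j, -, rfl⟩
    exact ⟨j, j.2, rfl⟩
  refine ⟨P n, a, b, ?_, ?_, ha, hb, ?_, hsub, ?_⟩
  · intro i j hij
    exact Fin.ext (h.injOn i.2 j.2 hij)
  · rw [← h.ground]
    ext y
    constructor
    · rintro ⟨j, rfl⟩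
      exact ⟨j, j.2, rfl⟩
    · rintro ⟨j, hj, rfl⟩
      exact ⟨⟨j, hj⟩, rfl⟩
  · intro i
    have h1 := (hb' i (b i + 1)).1 (by omega)
    have h2 := hB.le (b i + 1) (b i).2
    have h3 := (ha' i (b i + 1)).2 (by omega)
    exact Fin.le_def.2 (by omega)
  · intro I
    by_cases hI : I ⊆ M.E
    · rw [h.indep_iff I hI, himg, hB.isPartialTransversal_iff h.injOn rfl
        (fun i v _ => ha' i v) (fun i v _ => hb' i v) (hI.trans h.ground.symm.subset)]
    · refine iff_of_false (fun hc => hI hc.subset_ground) ?_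
      rintro ⟨φ, -, hφ⟩
      exact hI fun y hy => hsub _ (hφ ⟨y, hy⟩)

theorem PathRep.ncard_eq {α : Type*} {M : Matroid α} {n : ℕ} {e : ℕ → α} {P Q : ℕ → ℕ}
    (h : PathRep M n e P Q) {I : Set α} (hI : I ⊆ M.E) : I.ncard = cnt (e ⁻¹' I) n := by
  rw [cnt_eq_ncard, ← (h.injOn.mono inter_subset_right).ncard_image]
  congr 1
  ext y
  constructor
  · intro hy
    obtain ⟨j, hj, rfl⟩ := h.ground.symm.subset (hI hy)
    exact ⟨j, ⟨hy, hj⟩, rfl⟩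
  · rintro ⟨j, ⟨hj, -⟩, rfl⟩
    exact hj

theorem PathRep.indep_image_iff {α : Type*} {M : Matroid α} {n : ℕ} {e : ℕ → α} {P Q : ℕ → ℕ}
    (h : PathRep M n e P Q) {S : Set ℕ} (hS : S ⊆ Iio n) :
    M.Indep (e '' S) ↔ IndepCond n P Q S := by
  rw [h.indep_iff _ ((image_mono hS).trans h.ground.subset)]
  refine forall₂_congr fun u v => forall₂_congr fun huv hv => ?_
  rw [cnt_image_congr h.injOn hS hv, cnt_image_congr h.injOn hS (huv.trans hv)]

/-- The interval `[0, n)` bounds independent sets by `P n`, and the north steps of `P` form an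
independent set of that size, so bases are the independent sets with `P n` elements. -/
theorem PathRep.isBase_iff {α : Type*} {M : Matroid α} {n : ℕ} {e : ℕ → α} {P Q : ℕ → ℕ}
    (h : PathRep M n e P Q) {I : Set α} (hI : I ⊆ M.E) :
    M.IsBase I ↔ Good n P Q (e ⁻¹' I) := by
  have hfin : M.E.Finite := h.ground ▸ (finite_Iio n).image e
  have hle : ∀ J, M.Indep J → J.ncard ≤ P n := fun J hJ => by
    rw [h.ncard_eq hJ.subset_ground]
    have := (h.indep_iff J hJ.subset_ground).1 hJ 0 n (by omega) le_rfl
    simpa [h.bounds.Q0] using this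
  have hmax : ∀ J, M.Indep J → J.ncard = P n → M.IsBase J := fun J hJ hc => by
    obtain ⟨B, hB, hJB⟩ := hJ.exists_isBase_superset
    rwa [eq_of_subset_of_ncard_le hJB (by rw [hc]; exact hle B hB.indep)
      (hfin.subset hB.subset_ground)]
  rw [h.bounds.good_iff, ← h.indep_iff I hI, ← h.ncard_eq hI]
  refine ⟨fun hb => ⟨hb.indep, ?_⟩, fun hb => hmax I hb.1 hb.2⟩
  have hS : {j | j < n ∧ P j < P (j + 1)} ⊆ Iio n := fun j hj => hj.1
  have h1 := (h.indep_image_iff hS).2 h.bounds.good_P.indepCond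
  have h2 : (e '' {j | j < n ∧ P j < P (j + 1)}).ncard = P n := by
    rw [h.ncard_eq h1.subset_ground, cnt_image_congr h.injOn hS le_rfl,
      cnt_steps n h.bounds.P0 (fun j _ => h.bounds.P_step j) le_rfl]
  rw [← h2]
  exact hb.ncard_eq_ncard_of_isBase (hmax _ h1 h2)

theorem PathRep.isBase_image_iff {α : Type*} {M : Matroid α} {n : ℕ} {e : ℕ → α} {P Q : ℕ → ℕ}
    (h : PathRep M n e P Q) {S : Set ℕ} (hS : S ⊆ Iio n) :
    M.IsBase (e '' S) ↔ Good n P Q S := by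
  rw [h.isBase_iff ((image_mono hS).trans h.ground.subset)]
  refine forall₂_congr fun v hv => ?_
  rw [cnt_image_congr h.injOn hS hv]

end LatticePath

namespace LatticePath

/-! ### Reversing the order -/

/-- The upper bounding path for the reversed order. -/
def revP (n : ℕ) (P Q : ℕ → ℕ) (j : ℕ) : ℕ := P n - Q (n - j)

/-- The lower bounding path for the reversed order. -/
def revQ (n : ℕ) (P : ℕ → ℕ) (j : ℕ) : ℕ := P n - P (n - j)

theorem Bounds.Q_le_P_last {n : ℕ} {P Q : ℕ → ℕ} (hB : Bounds n P Q) {j : ℕ} (hj : j ≤ n) :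
    Q j ≤ P n :=
  hB.eq_n ▸ step_mono hB.Q_step hj

theorem Bounds.rev {n : ℕ} {P Q : ℕ → ℕ} (hB : Bounds n P Q) :
    Bounds n (revP n P Q) (revQ n P) := by
  have key : ∀ f : ℕ → ℕ, (∀ j, f j ≤ f (j + 1) ∧ f (j + 1) ≤ f j + 1) → ∀ j,
      P n - f (n - j) ≤ P n - f (n - (j + 1)) ∧ P n - f (n - (j + 1)) ≤ P n - f (n - j) + 1 := by
    intro f hf j
    by_cases hj : j < n
    · have h1 := hf (n - (j + 1))
      rw [show n - (j + 1) + 1 = n - j by omega] at h1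
      omega
    · rw [show n - (j + 1) = n - j by omega]; omega
  refine ⟨?_, ?_, key Q hB.Q_step, key P hB.P_step, ?_, fun j hj => ?_⟩
  · simp [revP, hB.eq_n]
  · simp [revQ]
  · simp [revP, revQ, hB.P0, hB.Q0]
  · have := hB.le (n - j) (by omega)
    simp only [revP, revQ]; omega

theorem cnt_reflect (n : ℕ) (S : Set ℕ) {v : ℕ} (hv : v ≤ n) :
    cnt ((n - 1 - ·) ⁻¹' S) v + cnt S (n - v) = cnt S n := by
  induction v with
  | zero => simp
  | succ v ih =>
    have h1 := ih (by omega)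
    have h2 := cnt_succ S (n - (v + 1))
    rw [show n - (v + 1) + 1 = n - v by omega] at h2
    have h3 : ind (v ∈ (n - 1 - ·) ⁻¹' S) = ind (n - (v + 1) ∈ S) :=
      ind_congr (by rw [mem_preimage, show n - 1 - v = n - (v + 1) by omega])
    rw [cnt_succ, h3]; omega

/-- The inequality for `[u, v)` in the reversed order is the one for `[n - v, n - u)` in the
original order. -/
theorem Bounds.indepCond_rev_iff {n : ℕ} {P Q : ℕ → ℕ} (hB : Bounds n P Q) (S : Set ℕ) :
    IndepCond n (revP n P Q) (revQ n P) ((n - 1 - ·) ⁻¹' S) ↔ IndepCond n P Q S := by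
  have key : ∀ u v, u ≤ v → v ≤ n →
      (cnt ((n - 1 - ·) ⁻¹' S) v + revQ n P u ≤ revP n P Q v + cnt ((n - 1 - ·) ⁻¹' S) u ↔
        cnt S (n - u) + Q (n - v) ≤ P (n - u) + cnt S (n - v)) := by
    intro u v huv hv
    have h1 := cnt_reflect n S hv
    have h2 := cnt_reflect n S (huv.trans hv)
    have h3 := step_mono hB.P_step (show n - u ≤ n by omega)
    have h4 := hB.Q_le_P_last (show n - v ≤ n by omega)
    simp only [revP, revQ]
    omega
  constructor
  · intro h u v huv hv
    have := (key (n - v) (n - u) (by omega) (by omega)).1 (h _ _ (by omega) (by omega))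
    rwa [show n - (n - v) = v by omega, show n - (n - u) = u by omega] at this
  · intro h u v huv hv
    exact (key u v huv hv).2 (h _ _ (by omega) (by omega))

theorem Bounds.good_rev_iff {n : ℕ} {P Q : ℕ → ℕ} (hB : Bounds n P Q) (S : Set ℕ) :
    Good n (revP n P Q) (revQ n P) ((n - 1 - ·) ⁻¹' S) ↔ Good n P Q S := by
  have h1 : cnt ((n - 1 - ·) ⁻¹' S) n = cnt S n := by simpa using cnt_reflect n S le_rfl
  have h2 : revP n P Q n = P n := by simp [revP, hB.Q0]
  rw [hB.rev.good_iff, hB.good_iff, hB.indepCond_rev_iff, h1, h2]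

theorem PathRep.rev {α : Type*} {M : Matroid α} {n : ℕ} {e : ℕ → α} {P Q : ℕ → ℕ}
    (h : PathRep M n e P Q) :
    PathRep M n (fun j => e (n - 1 - j)) (revP n P Q) (revQ n P) := by
  refine ⟨h.bounds.rev, ?_, ?_, fun I hI => ?_⟩
  · intro i hi j hj hij
    simp only [mem_Iio] at hi hj
    have := h.injOn (show n - 1 - i < n by omega) (show n - 1 - j < n by omega) hij
    omega
  · rw [← h.ground]
    ext y
    constructor
    · rintro ⟨j, hj, rfl⟩
      simp only [mem_Iio] at hj
      exact ⟨n - 1 - j, by simp; omega, rfl⟩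
    · rintro ⟨j, hj, rfl⟩
      simp only [mem_Iio] at hj
      exact ⟨n - 1 - j, by simp; omega, by simp only; congr 1; omega⟩
  · rw [h.indep_iff I hI, ← h.bounds.indepCond_rev_iff]; rfl

/-! ### Steps of one path -/

section Steps

variable {f : ℕ → ℕ}

theorem exists_flat_step (hf : ∀ j, f j ≤ f (j + 1) ∧ f (j + 1) ≤ f j + 1) {u v : ℕ} (huv : u ≤ v)
    (h : f v < f u + (v - u)) : ∃ j, u ≤ j ∧ j < v ∧ f (j + 1) = f j := by
  by_contra! hc
  have key : ∀ w, u ≤ w → w ≤ v → f u + (w - u) ≤ f w := by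
    intro w hw
    induction w, hw using Nat.le_induction with
    | base => omega
    | succ w hw ih =>
      intro hwv
      have := ih (by omega)
      have := hc w hw (by omega)
      have := hf w
      omega
  have := key v huv le_rfl
  omega

theorem exists_north_step (hf : ∀ j, f j ≤ f (j + 1) ∧ f (j + 1) ≤ f j + 1) {u v : ℕ}
    (huv : u ≤ v) (h : f u < f v) : ∃ j, u ≤ j ∧ j < v ∧ f (j + 1) = f j + 1 := by
  by_contra! hc
  have key : ∀ w, u ≤ w → w ≤ v → f w ≤ f u := by
    intro w hw
    induction w, hw using Nat.le_induction with
    | base => omega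
    | succ w hw ih =>
      intro hwv
      have := ih (by omega)
      have := hc w hw (by omega)
      have := hf w
      omega
  have := key v huv le_rfl
  omega

end Steps

/-- The upper path has an east step and later a north step, the latter at `t` or earlier. -/
def LeftP (P : ℕ → ℕ) (t : ℕ) : Prop :=
  ∃ i k, i < k ∧ k ≤ t ∧ P (i + 1) = P i ∧ P (k + 1) = P k + 1

/-- The lower path has a north step and later an east step, the latter at `t` or earlier. -/
def LeftQ (Q : ℕ → ℕ) (t : ℕ) : Prop :=
  ∃ i k, i < k ∧ k ≤ t ∧ Q (i + 1) = Q i + 1 ∧ Q (k + 1) = Q k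

/-- The upper path has an east step at `t` or later that is followed by a north step. -/
def RightP (n : ℕ) (P : ℕ → ℕ) (t : ℕ) : Prop :=
  ∃ l w, t ≤ l ∧ l < w ∧ w < n ∧ P (l + 1) = P l ∧ P (w + 1) = P w + 1

/-- The lower path has a north step at `t` or later that is followed by an east step. -/
def RightQ (n : ℕ) (Q : ℕ → ℕ) (t : ℕ) : Prop :=
  ∃ l w, t ≤ l ∧ l < w ∧ w < n ∧ Q (l + 1) = Q l + 1 ∧ Q (w + 1) = Q w

/-- Step `j` of the reversed upper path has the same type as step `n - 1 - j` of `Q`. The additive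
form avoids truncated differences of heights. -/
theorem revP_step {n : ℕ} {P Q : ℕ → ℕ} (hB : Bounds n P Q) {j : ℕ} (hj : j < n) :
    revP n P Q (j + 1) + Q (n - 1 - j) = revP n P Q j + Q (n - 1 - j + 1) := by
  have h1 := hB.Q_le_P_last (show n - 1 - j + 1 ≤ n by omega)
  have h2 := hB.Q_le_P_last (show n - 1 - j ≤ n by omega)
  simp only [revP]
  rw [show n - (j + 1) = n - 1 - j by omega, show n - j = n - 1 - j + 1 by omega]
  omega

theorem revQ_step {n : ℕ} {P Q : ℕ → ℕ} (hB : Bounds n P Q) {j : ℕ} (hj : j < n) :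
    revQ n P (j + 1) + P (n - 1 - j) = revQ n P j + P (n - 1 - j + 1) := by
  have h1 := step_mono hB.P_step (show n - 1 - j + 1 ≤ n by omega)
  have h2 := step_mono hB.P_step (show n - 1 - j ≤ n by omega)
  simp only [revQ]
  rw [show n - (j + 1) = n - 1 - j by omega, show n - j = n - 1 - j + 1 by omega]
  omega

theorem rightQ_of_rev {n : ℕ} {P Q : ℕ → ℕ} (hB : Bounds n P Q) {t : ℕ} (ht : t < n)
    (h : LeftP (revP n P Q) (n - 1 - t)) : RightQ n Q t := by
  obtain ⟨i, k, h1, h2, h3, h4⟩ := h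
  have h5 := revP_step hB (show i < n by omega)
  have h6 := revP_step hB (show k < n by omega)
  exact ⟨n - 1 - k, n - 1 - i, by omega, by omega, by omega, by omega, by omega⟩

theorem rightP_of_rev {n : ℕ} {P Q : ℕ → ℕ} (hB : Bounds n P Q) {t : ℕ} (ht : t < n)
    (h : LeftQ (revQ n P) (n - 1 - t)) : RightP n P t := by
  obtain ⟨i, k, h1, h2, h3, h4⟩ := h
  have h5 := revQ_step hB (show i < n by omega)
  have h6 := revQ_step hB (show k < n by omega)
  exact ⟨n - 1 - k, n - 1 - i, by omega, by omega, by omega, by omega, by omega⟩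

theorem leftP_rev {n : ℕ} {P Q : ℕ → ℕ} (hB : Bounds n P Q) {t : ℕ} (ht : t < n)
    (h : RightQ n Q t) : LeftP (revP n P Q) (n - 1 - t) := by
  obtain ⟨l, w, h1, h2, h3, h4, h5⟩ := h
  have h6 := revP_step hB (show n - 1 - w < n by omega)
  have h7 := revP_step hB (show n - 1 - l < n by omega)
  rw [show n - 1 - (n - 1 - w) = w by omega] at h6
  rw [show n - 1 - (n - 1 - l) = l by omega] at h7
  exact ⟨n - 1 - w, n - 1 - l, by omega, by omega, by omega, by omega⟩

theorem rightP_rev {n : ℕ} {P Q : ℕ → ℕ} (hB : Bounds n P Q) {t : ℕ} (ht : t < n)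
    (h : LeftQ Q t) : RightP n (revP n P Q) (n - 1 - t) := by
  obtain ⟨i, k, h1, h2, h3, h4⟩ := h
  have h6 := revP_step hB (show n - 1 - i < n by omega)
  have h7 := revP_step hB (show n - 1 - k < n by omega)
  rw [show n - 1 - (n - 1 - i) = i by omega] at h6
  rw [show n - 1 - (n - 1 - k) = k by omega] at h7
  exact ⟨n - 1 - k, n - 1 - i, by omega, by omega, by omega, by omega, by omega⟩

/-- With no north step after an east step, `P` goes straight north and then straight east on this
range. -/
theorem eq_min_of_not_leftP {n : ℕ} {P Q : ℕ → ℕ} (hB : Bounds n P Q) {t : ℕ}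
    (h : ¬ LeftP P t) : ∀ j ≤ t + 1, P j = min j (P (t + 1)) := by
  intro j hj
  have h1 := step_le_add hB.P_step (Nat.zero_le j)
  have h2 := step_mono hB.P_step hj
  rw [hB.P0] at h1
  by_cases hc : P j = j
  · omega
  obtain ⟨i, hi1, hi2, hi3⟩ := exists_flat_step hB.P_step (Nat.zero_le j) (by rw [hB.P0]; omega)
  have h3 : P (t + 1) ≤ P j := by
    by_contra hlt
    obtain ⟨k, hk1, hk2, hk3⟩ := exists_north_step hB.P_step hj (by omega)
    exact h ⟨i, k, by omega, by omega, hi3, hk3⟩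
  omega

/-- With no east step after a north step, `Q` goes straight east and then straight north; the
truncated difference describes both stretches at once. -/
theorem eq_sub_of_not_leftQ {n : ℕ} {P Q : ℕ → ℕ} (hB : Bounds n P Q) {t : ℕ}
    (h : ¬ LeftQ Q t) : ∀ j ≤ t + 1, Q j = j - (t + 1 - Q (t + 1)) := by
  intro j hj
  have h0 := step_le_add hB.Q_step (Nat.zero_le (t + 1))
  rw [hB.Q0] at h0
  have h2 := step_le_add hB.Q_step hj
  by_cases hc : Q j = 0
  · omega
  obtain ⟨i, hi1, hi2, hi3⟩ := exists_north_step hB.Q_step (Nat.zero_le j) (by rw [hB.Q0]; omega)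
  have h3 : Q j + (t + 1 - j) ≤ Q (t + 1) := by
    by_contra hlt
    obtain ⟨k, hk1, hk2, hk3⟩ := exists_flat_step hB.Q_step hj (by omega)
    exact h ⟨i, k, by omega, by omega, hi3, hk3⟩
  omega

/-! ### Terminal elements -/

/-- When the first `K` elements are clones, only the intervals that contain all of them or none of
them matter for independence. -/
theorem indepCond_iff_of_clones {n : ℕ} {P Q : ℕ → ℕ} (hB : Bounds n P Q) {K : ℕ} (hK : K ≤ n)
    (hP : ∀ j ≤ K, P j = min j (P K)) (hQ : ∀ j ≤ K, Q j = j - (K - Q K)) (S : Set ℕ) :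
    IndepCond n P Q S ↔ ∀ u v, (u = 0 ∨ K ≤ u) → K ≤ v → u ≤ v → v ≤ n →
      cnt S v + Q u ≤ P v + cnt S u := by
  refine ⟨fun h u v _ _ huv hv => h u v huv hv, fun h u v huv hv => ?_⟩
  have hle := hB.le K hK
  have hKK : Q K ≤ K := by
    have := step_le_add hB.Q_step (Nat.zero_le K); rw [hB.Q0] at this; omega
  have h00 := h 0 K (Or.inl rfl) le_rfl (by omega) hK
  rw [hB.Q0, cnt_zero] at h00
  have h1 := cnt_le_add S huv
  rcases le_or_gt v K with hvK | hvK
  · have h2 := cnt_mono S hvK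
    have h3 := hP v hvK
    have h4 := hQ u (huv.trans hvK)
    have h5 := cnt_mono S huv
    omega
  · rcases le_or_gt K u with huK | huK
    · exact h u v (Or.inr huK) hvK.le huv hv
    -- Here `u` is inside the block. If `Q u = 0`, the interval from `0` suffices. Otherwise `Q`
    -- runs straight north from `u` to `K`, while `S` gains at most `K - u` elements there, and the
    -- interval from `K` suffices.
    · have h2 := h 0 v (Or.inl rfl) hvK.le (by omega) hv
      have h3 := h K v (Or.inr le_rfl) hvK.le hvK.le hv
      have h4 := hQ u huK.le
      have h5 := cnt_le_add S huK.le
      rw [hB.Q0, cnt_zero] at h2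
      omega

theorem swap_lt {t v j : ℕ} (h : t < v) (hj : j < v) : Equiv.swap 0 t j < v := by
  by_cases h0 : j = 0
  · subst h0; rwa [Equiv.swap_apply_left]
  by_cases h1 : j = t
  · subst h1; rw [Equiv.swap_apply_right]; omega
  · rwa [Equiv.swap_apply_of_ne_of_ne h0 h1]

theorem cnt_swap (S : Set ℕ) {t v : ℕ} (h : t < v) :
    cnt (Equiv.swap 0 t ⁻¹' S) v = cnt S v := by
  rw [cnt_eq_ncard, cnt_eq_ncard, ← ncard_image_of_injective _ (Equiv.swap 0 t).injective]
  congr 1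
  have hlt : ∀ j, j < v → Equiv.swap 0 t j < v := fun j hj => swap_lt h hj
  ext j
  constructor
  · rintro ⟨i, ⟨hi, hiv⟩, rfl⟩
    exact ⟨hi, hlt i hiv⟩
  · rintro ⟨hj, hjv⟩
    exact ⟨Equiv.swap 0 t j, ⟨by simpa using hj, hlt j hjv⟩, by simp⟩

/-- The first `t + 1` elements are clones: independence only involves counts at `0` and at positions
beyond `t`, and exchanging positions `0` and `t` preserves those. -/
theorem PathRep.swap {α : Type*} {M : Matroid α} {n : ℕ} {e : ℕ → α} {P Q : ℕ → ℕ}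
    (h : PathRep M n e P Q) {t : ℕ} (ht : t < n)
    (hP : ∀ j ≤ t + 1, P j = min j (P (t + 1)))
    (hQ : ∀ j ≤ t + 1, Q j = j - (t + 1 - Q (t + 1))) :
    PathRep M n (fun j => e (Equiv.swap 0 t j)) P Q := by
  have hlt : ∀ j, j < n → Equiv.swap 0 t j < n := fun j hj => swap_lt ht hj
  refine ⟨h.bounds, fun i hi j hj hij => ?_, ?_, fun I hI => ?_⟩
  · exact (Equiv.swap 0 t).injective (h.injOn (hlt i hi) (hlt j hj) hij)
  · rw [← h.ground]
    ext y
    constructor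
    · rintro ⟨j, hj, rfl⟩
      exact ⟨_, hlt j hj, rfl⟩
    · rintro ⟨j, hj, rfl⟩
      exact ⟨_, hlt j hj, by simp⟩
  · rw [h.indep_iff I hI, indepCond_iff_of_clones h.bounds ht hP hQ,
      indepCond_iff_of_clones h.bounds ht hP hQ]
    refine forall₂_congr fun u v => forall₄_congr fun hu hv huv hvn => ?_
    have h1 : cnt ((fun j => e (Equiv.swap 0 t j)) ⁻¹' I) v = cnt (e ⁻¹' I) v :=
      cnt_swap (e ⁻¹' I) hv
    have h2 : cnt ((fun j => e (Equiv.swap 0 t j)) ⁻¹' I) u = cnt (e ⁻¹' I) u := by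
      rcases hu with rfl | hu
      · simp
      · exact cnt_swap (e ⁻¹' I) hu
    rw [h1, h2]

theorem PathRep.isTerminal_of_first {α : Type*} {M : Matroid α} {n : ℕ} {e : ℕ → α}
    {P Q : ℕ → ℕ} (h : PathRep M n e P Q) (hn : 0 < n) : M.IsTerminal (e 0) :=
  ⟨n, _, h.isPathOrder, ⟨0, hn⟩, rfl, Or.inl rfl⟩

/-- If both turns were absent, `e t` could be swapped to the front of a path order. -/
theorem PathRep.left_of_not_isTerminal {α : Type*} {M : Matroid α} {n : ℕ} {e : ℕ → α}
    {P Q : ℕ → ℕ} (h : PathRep M n e P Q) {t : ℕ} (ht : t < n) (hx : ¬ M.IsTerminal (e t)) :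
    LeftP P t ∨ LeftQ Q t := by
  by_contra! hc
  refine hx ?_
  have h1 := h.swap ht (eq_min_of_not_leftP h.bounds hc.1) (eq_sub_of_not_leftQ h.bounds hc.2)
  simpa using h1.isTerminal_of_first (by omega)

theorem PathRep.right_of_not_isTerminal {α : Type*} {M : Matroid α} {n : ℕ} {e : ℕ → α}
    {P Q : ℕ → ℕ} (h : PathRep M n e P Q) {t : ℕ} (ht : t < n) (hx : ¬ M.IsTerminal (e t)) :
    RightP n P t ∨ RightQ n Q t := by
  have h1 := h.rev.left_of_not_isTerminal (t := n - 1 - t) (by omega)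
    (by rwa [show n - 1 - (n - 1 - t) = t by omega])
  exact h1.symm.imp (rightP_of_rev h.bounds ht) (rightQ_of_rev h.bounds ht)

/-! ### Connected lattice path matroids -/

section Connected

variable {α : Type*} {M : Matroid α} {n : ℕ} {e : ℕ → α} {P Q : ℕ → ℕ}

theorem PathRep.mem_ground (h : PathRep M n e P Q) {i : ℕ} (hi : i < n) : e i ∈ M.E :=
  h.ground.subset ⟨i, hi, rfl⟩

theorem PathRep.cnt_insert (h : PathRep M n e P Q) {i : ℕ} (hi : i < n) {K : Set α}
    (hK : e i ∉ K) {v : ℕ} (hv : v ≤ n) :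
    cnt (e ⁻¹' insert (e i) K) v = cnt (e ⁻¹' K) v + ind (i < v) := by
  rw [← LatticePath.cnt_insert (show i ∉ e ⁻¹' K from hK)]
  apply cnt_congr
  intro j hj
  simp only [mem_preimage, mem_insert_iff]
  exact or_congr_left ⟨fun hij => h.injOn (show j < n by omega) hi hij, fun hij => by rw [hij]⟩

theorem PathRep.cnt_diff (h : PathRep M n e P Q) {i : ℕ} (hi : i < n) {K : Set α}
    (hK : e i ∈ K) {v : ℕ} (hv : v ≤ n) :
    cnt (e ⁻¹' (K \ {e i})) v + ind (i < v) = cnt (e ⁻¹' K) v := by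
  rw [← h.cnt_insert hi (by simp) hv, insert_sdiff_singleton, insert_eq_of_mem hK]

/-- Where the paths meet, the matroid is a direct sum. A circuit `K` through `e 0` and `e j` would
be independent: intervals up to `j` are controlled by `K` without `e j`, those from `j` on by `K`
without `e 0`, and the others split at `j`. -/
theorem PathRep.depth_of_isConnected (h : PathRep M n e P Q) (hc : M.IsConnected) {j : ℕ}
    (hj0 : 0 < j) (hjn : j < n) : Q j < P j := by
  by_contra hcon
  have hPQ : P j = Q j := le_antisymm (not_lt.1 hcon) (h.bounds.le j hjn.le)
  have hne : e 0 ≠ e j := fun he => by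
    have := h.injOn (show 0 < n by omega) hjn he; omega
  obtain ⟨K, hK, h0, hj⟩ := hc _ (h.mem_ground (by omega)) _ (h.mem_ground hjn) hne
  refine hK.not_indep ((h.indep_iff K hK.subset_ground).2 fun u v huv hv => ?_)
  have c1 := (h.indep_iff _ (sdiff_subset.trans hK.subset_ground)).1
    (hK.sdiff_singleton_indep h0)
  have c2 := (h.indep_iff _ (sdiff_subset.trans hK.subset_ground)).1
    (hK.sdiff_singleton_indep hj)
  have d1 : ∀ w ≤ n, 0 < w → cnt (e ⁻¹' (K \ {e 0})) w + 1 = cnt (e ⁻¹' K) w := fun w hw hw0 => by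
    have := h.cnt_diff (by omega) h0 hw; rwa [ind_true hw0] at this
  have d2 : ∀ w ≤ j, cnt (e ⁻¹' (K \ {e j})) w = cnt (e ⁻¹' K) w := fun w hw => by
    have := h.cnt_diff hjn hj (show w ≤ n by omega); rwa [ind_false (by omega)] at this
  rcases le_or_gt v j with hvj | hvj
  · have := c2 u v huv hv
    rwa [d2 v hvj, d2 u (by omega)] at this
  · rcases le_or_gt j u with huj | huj
    · have := c1 u v huv hv
      have := d1 u (by omega) (by omega)
      have := d1 v hv (by omega)
      omega
    · have := c1 j v hvj.le hv
      have := d1 j (by omega) (by omega)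
      have := d1 v hv (by omega)
      have := c2 u j huj.le hjn.le
      rw [d2 j le_rfl, d2 u (by omega)] at this
      omega

/-- An inner element that belongs to only one interval of the presentation is a cut element. -/
theorem PathRep.not_isConnected_contract (h : PathRep M n e P Q) {t : ℕ} (ht0 : 0 < t)
    (htn : t + 1 < n) (hx : M.Indep {e t}) (hPQ : P (t + 1) = Q t + 1) :
    ¬ (M.contract {e t}).IsConnected := by
  intro hc
  have hne : ∀ i j, i < n → j < n → i ≠ j → e i ≠ e j := fun i j hi hj hij he =>
    hij (h.injOn hi hj he)
  obtain ⟨K, hK, h0, hl⟩ := hc (e 0) ⟨h.mem_ground (by omega), hne _ _ (by omega) (by omega) (by omega)⟩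
    (e (n - 1)) ⟨h.mem_ground (by omega), hne _ _ (by omega) (by omega) (by omega)⟩
    (hne _ _ (by omega) (by omega) (by omega))
  have hKE := hK.subset_ground
  have hxK : e t ∉ K := fun hm => (hKE hm).2 rfl
  have hKE' : K ⊆ M.E := hKE.trans sdiff_subset
  have key : ∀ J ⊆ K, (M.contract {e t}).Indep J ↔ IndepCond n P Q (e ⁻¹' insert (e t) J) := by
    intro J hJ
    rw [hx.contract_indep_iff, ← h.indep_iff _ (insert_subset (h.mem_ground (by omega))
      (hJ.trans hKE')), union_singleton]
    exact and_iff_right (disjoint_singleton_right.2 fun hm => hxK (hJ hm))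
  have c1 := (key _ sdiff_subset).1 (hK.sdiff_singleton_indep h0)
  have c2 := (key _ sdiff_subset).1 (hK.sdiff_singleton_indep hl)
  refine hK.not_indep ((key K subset_rfl).2 fun u v huv hv => ?_)
  have e1 : ∀ w ≤ n, 0 < w → cnt (e ⁻¹' insert (e t) (K \ {e 0})) w + 1
      = cnt (e ⁻¹' insert (e t) K) w := fun w hw hw0 => by
    rw [h.cnt_insert (by omega) hxK hw, h.cnt_insert (by omega) (fun hm => hxK hm.1) hw,
      ← h.cnt_diff (show 0 < n by omega) h0 hw, ind_true hw0]; omega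
  have e2 : ∀ w ≤ n, w < n → cnt (e ⁻¹' insert (e t) (K \ {e (n - 1)})) w
      = cnt (e ⁻¹' insert (e t) K) w := fun w hw hw0 => by
    rw [h.cnt_insert (by omega) hxK hw, h.cnt_insert (by omega) (fun hm => hxK hm.1) hw,
      ← h.cnt_diff (show n - 1 < n by omega) hl hw, ind_false (show ¬ n - 1 < w by omega)]
    omega
  rcases lt_or_ge v n with hvn | hvn
  · have := c2 u v huv hv
    rwa [e2 v hv hvn, e2 u (by omega) (by omega)] at this
  · rcases Nat.eq_zero_or_pos u with hu | hu
    · subst hu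
      obtain rfl : v = n := by omega
      -- The whole range is covered by `[0, t + 1)` and `[t, n)`, which overlap in `t`. The element
      -- `e t` is counted twice, and so is the single interval that contains it.
      have a1 := c1 t v (by omega) le_rfl
      have a2 := e1 t (by omega) ht0
      have a3 := e1 v le_rfl (by omega)
      have a4 := c2 0 (t + 1) (by omega) (by omega)
      have a5 := e2 (t + 1) (by omega) (by omega)
      have a6 := cnt_succ (e ⁻¹' insert (e t) K) t
      rw [ind_true (show t ∈ e ⁻¹' insert (e t) K by simp)] at a6
      simp only [cnt_zero] at *
      omega
    · have := c1 u v huv hv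
      have := e1 u (by omega) hu
      have := e1 v hv (by omega)
      omega

/-- On a ground set with at most one element, positive rank would make the whole ground set a basis.
-/
theorem ground_nontrivial_of_isNontrivial (hn : M.IsNontrivial) (hr : 0 < M.eRank) :
    M.E.Nontrivial := by
  by_contra hc
  rw [not_nontrivial_iff] at hc
  obtain ⟨B, hB⟩ := M.exists_isBase
  have hne : B.Nonempty := by
    rw [← encard_pos, hB.encard_eq_eRank]; exact hr
  obtain ⟨b, hb⟩ := hne
  refine hn ?_
  have : M.E = B := by
    refine subset_antisymm (fun y hy => ?_) hB.subset_ground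
    rwa [hc hy (hB.subset_ground hb)]
  rw [this]; exact hB.indep

theorem PathRep.two_le (h : PathRep M n e P Q) (hE : M.E.Nontrivial) : 2 ≤ n := by
  by_contra hc
  obtain ⟨a, ha, b, hb, hab⟩ := hE
  rw [← h.ground] at ha hb
  obtain ⟨i, hi, rfl⟩ := ha
  obtain ⟨j, hj, rfl⟩ := hb
  simp only [mem_Iio] at hi hj
  exact hab (by rw [show i = j by omega])

end Connected

/-- Consequences of the strict separation of the two paths at the ends. -/
theorem Bounds.ends {n : ℕ} {P Q : ℕ → ℕ} (hB : Bounds n P Q) (hn : 2 ≤ n)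
    (hd : ∀ j, 0 < j → j < n → Q j < P j) :
    P 1 = 1 ∧ Q 1 = 0 ∧ P (n - 1) = P n ∧ Q (n - 1) + 1 = P n := by
  have h1 := hd 1 (by omega) (by omega)
  have h2 := hB.P_step 0
  have h3 := hd (n - 1) (by omega) (by omega)
  have h4 := hB.P_step (n - 1)
  have h5 := hB.Q_step (n - 1)
  rw [show n - 1 + 1 = n by omega] at h4 h5
  have := hB.P0
  have := hB.eq_n
  simp only [zero_add] at h2
  omega

end LatticePath

namespace LatticePath

/-! ### Minors in terms of positions -/

theorem Good.congr {n : ℕ} {P Q : ℕ → ℕ} {S T : Set ℕ} (h : ∀ j < n, j ∈ S ↔ j ∈ T) :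
    Good n P Q S ↔ Good n P Q T :=
  forall₂_congr fun v hv => by rw [cnt_congr (fun j hj => h j (by omega))]

/-- There are positions `φ b` and a disjoint set `C` of positions such that the bases of the
form `φ '' I ∪ C` are given by the sets `I` with the property `cond`. So contracting `C` and
restricting to the image of `φ` yields a matroid with these bases. The position `t` is one of the
positions that are kept. -/
def Pat (n : ℕ) (P Q : ℕ → ℕ) (t : ℕ) {β : Type} (x₀ : β) (cond : Set β → Prop) : Prop :=
  ∃ (φ : β → ℕ) (C : Set ℕ), Function.Injective φ ∧ φ x₀ = t ∧ (∀ b, φ b < n ∧ φ b ∉ C) ∧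
    C ⊆ Iio n ∧ ∀ I, Good n P Q (φ '' I ∪ C) ↔ cond I

theorem Pat.of_rev {n : ℕ} {P Q : ℕ → ℕ} (hB : Bounds n P Q) {t : ℕ} (ht : t < n) {β : Type}
    {x₀ : β} {cond : Set β → Prop}
    (h : Pat n (revP n P Q) (revQ n P) (n - 1 - t) x₀ cond) : Pat n P Q t x₀ cond := by
  obtain ⟨φ, C, h1, h2, h3, h4, h5⟩ := h
  refine ⟨fun b => n - 1 - φ b, {j | j < n ∧ n - 1 - j ∈ C}, fun a b hab => h1 ?_, ?_,
    fun b => ⟨?_, ?_⟩, fun j hj => hj.1, fun I => ?_⟩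
  · have := (h3 a).1; have := (h3 b).1; simp only at hab; omega
  · simp only [h2]; omega
  · have := (h3 b).1; show n - 1 - φ b < n; omega
  · rintro ⟨-, hb⟩
    rw [show n - 1 - (n - 1 - φ b) = φ b by have := (h3 b).1; omega] at hb
    exact (h3 b).2 hb
  · rw [← h5, ← hB.good_rev_iff]
    refine Good.congr fun j hj => ?_
    simp only [mem_preimage, mem_union, mem_image, mem_ofPred_eq]
    refine or_congr (exists_congr fun b => and_congr_right fun _ => ?_) ?_
    · have := (h3 b).1; omega
    · rw [show n - 1 - (n - 1 - j) = j by omega]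
      exact and_iff_right (by omega)

/-- The upper bounding path for the dual matroid. -/
def dualP (Q : ℕ → ℕ) (j : ℕ) : ℕ := j - Q j

theorem le_self_of_step {f : ℕ → ℕ} (h0 : f 0 = 0)
    (hf : ∀ j, f j ≤ f (j + 1) ∧ f (j + 1) ≤ f j + 1) (j : ℕ) : f j ≤ j := by
  have := step_le_add hf (Nat.zero_le j); omega

theorem Bounds.dual {n : ℕ} {P Q : ℕ → ℕ} (hB : Bounds n P Q) :
    Bounds n (dualP Q) (dualP P) := by
  have hP := le_self_of_step hB.P0 hB.P_step
  have hQ := le_self_of_step hB.Q0 hB.Q_step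
  refine ⟨by simp [dualP], by simp [dualP], fun j => ?_, fun j => ?_, ?_, fun j hj => ?_⟩
  · have := hQ j; have := hQ (j + 1); have := hB.Q_step j; simp only [dualP]; omega
  · have := hP j; have := hP (j + 1); have := hB.P_step j; simp only [dualP]; omega
  · simp only [dualP, hB.eq_n]
  · have := hB.le j hj; simp only [dualP]; omega

/-- Complementing the set of north steps turns height `h` at position `v` into `v - h`, which
reverses the two inequalities. -/
theorem Bounds.good_dual_iff {n : ℕ} {P Q : ℕ → ℕ} (hB : Bounds n P Q) (S : Set ℕ) :
    Good n (dualP Q) (dualP P) Sᶜ ↔ Good n P Q S := by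
  refine forall₂_congr fun v hv => ?_
  have := le_self_of_step hB.P0 hB.P_step v
  have := le_self_of_step hB.Q0 hB.Q_step v
  have := cnt_compl S v
  simp only [dualP]; omega

/-- Duality exchanges contraction and deletion, so the new contracted set consists of the positions
that were neither kept nor contracted. -/
theorem Pat.of_dual {n : ℕ} {P Q : ℕ → ℕ} (hB : Bounds n P Q) {t : ℕ} {β : Type}
    {x₀ : β} {cond : Set β → Prop}
    (h : Pat n (dualP Q) (dualP P) t x₀ cond) : Pat n P Q t x₀ (fun I => cond Iᶜ) := by
  obtain ⟨φ, C, h1, h2, h3, h4, h5⟩ := h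
  refine ⟨φ, Iio n \ (range φ ∪ C), h1, h2, fun b => ⟨(h3 b).1, fun hb => ?_⟩, sdiff_subset,
    fun I => ?_⟩
  · exact hb.2 (Or.inl ⟨b, rfl⟩)
  · show _ ↔ cond Iᶜ
    rw [← h5, ← hB.good_dual_iff]
    refine Good.congr fun j hj => ?_
    by_cases hr : j ∈ range φ
    · obtain ⟨b, rfl⟩ := hr
      have := (h3 b).2
      simp [h1.eq_iff, this]
    · have h6 : ∀ J : Set β, j ∉ φ '' J := fun J hJ => hr (image_subset_range _ _ hJ)
      simp [h6, hr, hj]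

/-- The number of elements of a set in one block of its type. -/
noncomputable def blk {β γ : Type*} (g : γ → β) (I : Set β) : ℕ := (g ⁻¹' I).ncard

theorem blk_fin_one {β : Type*} (g : Fin 1 → β) (I : Set β) : blk g I = ind (g 0 ∈ I) := by
  unfold blk
  by_cases h : g 0 ∈ I
  · rw [ind_true h, show g ⁻¹' I = {0} by ext i; fin_cases i; simpa using h, ncard_singleton]
  · rw [ind_false h, show g ⁻¹' I = ∅ by ext i; fin_cases i; simpa using h, ncard_empty]

theorem blk_eq_sum {β γ : Type*} [Fintype γ] (g : γ → β) (I : Set β) :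
    blk g I = ∑ i, ind (g i ∈ I) := by
  classical
  unfold blk ind
  rw [Finset.sum_boole, Nat.cast_id, ← ncard_coe_finset]
  congr 1; ext; simp

theorem blk_fin_two {β : Type*} (g : Fin 2 → β) (I : Set β) :
    blk g I = ind (g 0 ∈ I) + ind (g 1 ∈ I) := by
  rw [blk_eq_sum, Fin.sum_univ_two]

theorem blk_compl {β : Type*} {m : ℕ} {g : Fin m → β} (I : Set β) :
    blk g I + blk g Iᶜ = m := by
  unfold blk
  rw [preimage_compl, ncard_add_ncard_compl, Nat.card_eq_fintype_card, Fintype.card_fin]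

theorem cnt_image {β : Type*} [Fintype β] {φ : β → ℕ} (hφ : Function.Injective φ) (I : Set β)
    (v : ℕ) : cnt (φ '' I) v = ∑ b, ind (b ∈ I ∧ φ b < v) := by
  classical
  rw [cnt_eq_ncard]
  have h1 : φ '' I ∩ Iio v = φ '' {b | b ∈ I ∧ φ b < v} := by
    ext j; constructor
    · rintro ⟨⟨b, hb, rfl⟩, hv⟩; exact ⟨b, ⟨hb, hv⟩, rfl⟩
    · rintro ⟨b, ⟨hb, hv⟩, rfl⟩; exact ⟨⟨b, hb, rfl⟩, hv⟩
  rw [h1, ncard_image_of_injective _ hφ]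
  exact blk_eq_sum id {b | b ∈ I ∧ φ b < v}

theorem ind_and (p q : Prop) : ind (p ∧ q) = ind p * ind q := by
  unfold ind; by_cases hp : p <;> by_cases hq : q <;> simp [hp, hq]

/-- Two blocks of `m` elements and one further element. -/
abbrev TwoBlocks (m : ℕ) : Type := (Fin m ⊕ Fin m) ⊕ Fin 1

/-- Two pairs and two further elements. -/
abbrev TwoPairs : Type := ((Fin 2 ⊕ Fin 2) ⊕ Fin 1) ⊕ Fin 1

/-- A pair, two single elements, and a second pair. -/
abbrev PairSinglesPair : Type := ((Fin 2 ⊕ Fin 1) ⊕ Fin 1) ⊕ Fin 2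

/-- The bases of `P_m + x`. -/
def condB (m : ℕ) (I : Set (TwoBlocks m)) : Prop :=
  blk (Sum.inl ∘ Sum.inl) I < m ∧ blk (Sum.inl ∘ Sum.inr) I < m ∧
    blk (Sum.inl ∘ Sum.inl) I + blk (Sum.inl ∘ Sum.inr) I + blk Sum.inr I = m

/-- The bases of the dual of `P_m + x`. -/
def condE (m : ℕ) (I : Set (TwoBlocks m)) : Prop :=
  1 ≤ blk (Sum.inl ∘ Sum.inl) I ∧ 1 ≤ blk (Sum.inl ∘ Sum.inr) I ∧
    blk (Sum.inl ∘ Sum.inl) I + blk (Sum.inl ∘ Sum.inr) I + blk Sum.inr I = m + 1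

/-- The bases of the rank-`2` matroid with two parallel pairs and two further points. -/
def condR (I : Set TwoPairs) : Prop :=
  blk (Sum.inl ∘ Sum.inl ∘ Sum.inl) I ≤ 1 ∧ blk (Sum.inl ∘ Sum.inl ∘ Sum.inr) I ≤ 1 ∧
    blk (Sum.inl ∘ Sum.inl ∘ Sum.inl) I + blk (Sum.inl ∘ Sum.inl ∘ Sum.inr) I +
      blk (Sum.inl ∘ Sum.inr) I + blk Sum.inr I = 2

/-- The bases of the rank-`3` matroid in which a parallel pair and two further points are
collinear, and the last two points are free. -/
def condPlane (I : Set PairSinglesPair) : Prop :=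
  blk (Sum.inl ∘ Sum.inl ∘ Sum.inl) I ≤ 1 ∧
    blk (Sum.inl ∘ Sum.inl ∘ Sum.inl) I + blk (Sum.inl ∘ Sum.inl ∘ Sum.inr) I +
      blk (Sum.inl ∘ Sum.inr) I ≤ 2 ∧
    blk (Sum.inl ∘ Sum.inl ∘ Sum.inl) I + blk (Sum.inl ∘ Sum.inl ∘ Sum.inr) I +
      blk (Sum.inl ∘ Sum.inr) I + blk Sum.inr I = 3

theorem condB_compl {m : ℕ} (I : Set (TwoBlocks m)) : condB m Iᶜ ↔ condE m I := by
  have h1 := blk_compl (g := Sum.inl ∘ Sum.inl) I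
  have h2 := blk_compl (g := Sum.inl ∘ Sum.inr) I
  have h3 := blk_compl (g := Sum.inr) I
  unfold condB condE
  omega

/-- The minor that keeps the positions `φ b` and contracts the other north steps of a path `π`
between `Q` and `P`. The numbers `w b` tell which of the kept positions are north steps of `π`. -/
theorem Pat.of_path {n : ℕ} {P Q π : ℕ → ℕ} (hπ0 : π 0 = 0)
    (hπ : ∀ j < n, π j ≤ π (j + 1) ∧ π (j + 1) ≤ π j + 1) {β : Type} [Fintype β] {φ : β → ℕ}
    (hφ : Function.Injective φ) (hlt : ∀ b, φ b < n) {w : β → ℕ}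
    (hw : ∀ b, π (φ b + 1) = π (φ b) + w b) (x₀ : β) {cond : Set β → Prop}
    (hcond : ∀ I, (∀ v ≤ n,
      Q v + ∑ b, w b * ind (φ b < v) ≤ π v + ∑ b, ind (b ∈ I) * ind (φ b < v) ∧
      π v + ∑ b, ind (b ∈ I) * ind (φ b < v) ≤ P v + ∑ b, w b * ind (φ b < v)) ↔ cond I) :
    Pat n P Q (φ x₀) x₀ cond := by
  set N := {j | j < n ∧ π j < π (j + 1)} with hN
  have hwN : ∀ b, φ b ∈ N ↔ w b = 1 := fun b => by
    have := hw b; have := hπ _ (hlt b); have := hlt b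
    simp only [hN, mem_ofPred_eq]; omega
  refine ⟨φ, N \ φ '' {b | w b = 1}, hφ, rfl, fun b => ⟨hlt b, fun hb => ?_⟩, fun j hj => hj.1.1,
    fun I => ?_⟩
  · exact hb.2 ⟨b, (hwN b).1 hb.1, rfl⟩
  rw [← hcond]
  refine forall₂_congr fun v hv => ?_
  have hd : Disjoint (φ '' I) (N \ φ '' {b | w b = 1}) := by
    rw [Set.disjoint_left]
    rintro _ ⟨b, -, rfl⟩ hb
    exact hb.2 ⟨b, (hwN b).1 hb.1, rfl⟩
  have c1 : cnt (N \ φ '' {b | w b = 1}) v + cnt (φ '' {b | w b = 1}) v = π v := by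
    rw [← cnt_steps n hπ0 hπ hv, ← cnt_union disjoint_sdiff_left, sdiff_union_self,
      union_eq_left.2]
    rintro _ ⟨b, hb, rfl⟩
    exact (hwN b).2 hb
  have c2 : cnt (φ '' {b | w b = 1}) v = ∑ b, w b * ind (φ b < v) := by
    rw [cnt_image hφ]
    refine Finset.sum_congr rfl fun b _ => ?_
    rw [ind_and]
    congr 1
    have := hw b; have := hπ _ (hlt b)
    by_cases hb : w b = 1
    · rw [ind_true (show b ∈ {b | w b = 1} from hb), hb]
    · rw [ind_false (show b ∉ {b | w b = 1} from hb)]; omega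
  have c3 : cnt (φ '' I) v = ∑ b, ind (b ∈ I) * ind (φ b < v) := by
    rw [cnt_image hφ]
    exact Finset.sum_congr rfl fun b _ => ind_and _ _
  rw [cnt_union hd, c3, ← c2]
  omega

/-- Used to locate `v` among the kept positions, after which each path inequality is linear
arithmetic. -/
theorem ind_lt_cases (a v : ℕ) : (a < v ∧ ind (a < v) = 1) ∨ (v ≤ a ∧ ind (a < v) = 0) :=
  (lt_or_ge a v).imp (fun h => ⟨h, ind_true h⟩) (fun h => ⟨h, ind_false (by omega)⟩)

/-- The positions `k₁, k₂, k₃, k₄, t`, as a map on two pairs and a single element. -/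
def posTwoBlocks (k₁ k₂ k₃ k₄ t : ℕ) : TwoBlocks 2 → ℕ :=
  Sum.elim (Sum.elim ![k₁, k₂] ![k₃, k₄]) (fun _ => t)

theorem posTwoBlocks_injective {k₁ k₂ k₃ k₄ t : ℕ} (h1 : k₁ < k₂) (h2 : k₂ < t) (h3 : t < k₃)
    (h4 : k₃ < k₄) : Function.Injective (posTwoBlocks k₁ k₂ k₃ k₄ t) := by
  rintro ((a | a) | a) ((b | b) | b) hab <;> fin_cases a <;> fin_cases b <;>
    simp [posTwoBlocks] at hab ⊢ <;> omega

theorem forall_posTwoBlocks {k₁ k₂ k₃ k₄ t : ℕ} {p : ℕ → Prop} :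
    (∀ b, p (posTwoBlocks k₁ k₂ k₃ k₄ t b)) ↔ p k₁ ∧ p k₂ ∧ p k₃ ∧ p k₄ ∧ p t := by
  simp [posTwoBlocks, Sum.forall, Fin.forall_fin_two]
  tauto

/-- `Pat.of_path` with its sums expanded for five positions, so that membership of each position in
`I` becomes a number `0` or `1` and the hypothesis no longer mentions sets. -/
theorem Pat.twoBlocks_of_path {n : ℕ} {P Q π : ℕ → ℕ} (hπ0 : π 0 = 0)
    (hπ : ∀ j < n, π j ≤ π (j + 1) ∧ π (j + 1) ≤ π j + 1) {k₁ k₂ t k₃ k₄ : ℕ} (h1 : k₁ < k₂)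
    (h2 : k₂ < t) (h3 : t < k₃) (h4 : k₃ < k₄) (hk : k₄ < n) (w₁ w₂ w₃ w₄ w₅ : ℕ)
    (e1 : π (k₁ + 1) = π k₁ + w₁) (e2 : π (k₂ + 1) = π k₂ + w₂) (e3 : π (k₃ + 1) = π k₃ + w₃)
    (e4 : π (k₄ + 1) = π k₄ + w₄) (e5 : π (t + 1) = π t + w₅) {c : ℕ → ℕ → ℕ → Prop}
    (hc : ∀ i₁ i₂ i₃ i₄ i₅ : ℕ, i₁ ≤ 1 → i₂ ≤ 1 → i₃ ≤ 1 → i₄ ≤ 1 → i₅ ≤ 1 → ((∀ v ≤ n,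
      Q v + (w₁ * ind (k₁ < v) + w₂ * ind (k₂ < v) + (w₃ * ind (k₃ < v) + w₄ * ind (k₄ < v)) +
        w₅ * ind (t < v)) ≤ π v + (i₁ * ind (k₁ < v) + i₂ * ind (k₂ < v) +
        (i₃ * ind (k₃ < v) + i₄ * ind (k₄ < v)) + i₅ * ind (t < v)) ∧
      π v + (i₁ * ind (k₁ < v) + i₂ * ind (k₂ < v) + (i₃ * ind (k₃ < v) + i₄ * ind (k₄ < v)) +
        i₅ * ind (t < v)) ≤ P v + (w₁ * ind (k₁ < v) + w₂ * ind (k₂ < v) +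
        (w₃ * ind (k₃ < v) + w₄ * ind (k₄ < v)) + w₅ * ind (t < v))) ↔
      c (i₁ + i₂) (i₃ + i₄) i₅)) :
    Pat n P Q t (Sum.inr 0) (fun I : Set (TwoBlocks 2) =>
      c (blk (Sum.inl ∘ Sum.inl) I) (blk (Sum.inl ∘ Sum.inr) I) (blk Sum.inr I)) := by
  refine Pat.of_path hπ0 hπ (posTwoBlocks_injective h1 h2 h3 h4)
    (forall_posTwoBlocks (p := (· < n)).2 (by omega)) (w := posTwoBlocks w₁ w₂ w₃ w₄ w₅) ?_
    (Sum.inr 0) fun I => ?_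
  · simp [posTwoBlocks, Sum.forall, Fin.forall_fin_two, e1, e2, e3, e4, e5]
  simp only [blk_fin_two, blk_fin_one, Function.comp_apply, posTwoBlocks,
    Fintype.sum_sum_type, Fin.sum_univ_two, Sum.elim_inl, Sum.elim_inr, Matrix.cons_val_zero,
    Matrix.cons_val_one, Fin.sum_univ_one]
  exact hc _ _ _ _ _ (ind_le_one _) (ind_le_one _) (ind_le_one _) (ind_le_one _) (ind_le_one _)

/-- The case of an element in only one interval of the presentation. -/
theorem pat_condE_two {n : ℕ} {P Q : ℕ → ℕ} (hB : Bounds n P Q)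
    (hd : ∀ j, 0 < j → j < n → Q j < P j) {n₁ n₂ t n₃ k : ℕ} (h12 : n₁ < n₂) (h2t : n₂ < t)
    (ht3 : t < n₃) (h3k : n₃ < k) (hk : k < n) (hn₁ : P (n₁ + 1) = P n₁ + 1)
    (hn₂ : P (n₂ + 1) = P n₂ + 1) (ht : P (t + 1) = P t) (hn₃ : P (n₃ + 1) = P n₃ + 1)
    (hkE : P (k + 1) = P k) (hdt : P t = Q t + 1) (hdt' : P (t + 1) = Q (t + 1) + 1) :
    Pat n P Q t (Sum.inr 0) (condE 2) := by
  -- The reference path is `P`, with north steps at `n₁`, `n₂`, `n₃`. The constraint at `t` forces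
  -- `1 ≤ f`; those at `t + 1` and `n` give `f + ε ≤ 2` and `f + g + ε = 3`, hence `1 ≤ g`.
  refine Pat.twoBlocks_of_path hB.P0 (fun j _ => hB.P_step j) h12 h2t ht3 h3k hk 1 1 1 0 0
    hn₁ hn₂ hn₃ hkE ht (c := fun f g ε => 1 ≤ f ∧ 1 ≤ g ∧ f + g + ε = 2 + 1)
    fun i1 i2 i3 i4 i5 b1 b2 b3 b4 b5 => ?_
  have hPn := hB.eq_n
  constructor
  · intro h
    have g1 := h t (by omega)
    have g2 := h (t + 1) (by omega)
    have g3 := h n le_rfl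
    simp (disch := omega) only [ind_true, ind_false] at g1
    simp (disch := omega) only [ind_true, ind_false] at g2
    simp (disch := omega) only [ind_true] at g3
    omega
  · intro h v hv
    have hle := hB.le v hv
    have hdv := hd v
    rcases ind_lt_cases n₁ v with ⟨q1, p1⟩ | ⟨q1, p1⟩ <;>
    rcases ind_lt_cases n₂ v with ⟨q2, p2⟩ | ⟨q2, p2⟩ <;> try omega
    all_goals rcases ind_lt_cases t v with ⟨q3, p3⟩ | ⟨q3, p3⟩ <;> try omega
    all_goals rcases ind_lt_cases n₃ v with ⟨q4, p4⟩ | ⟨q4, p4⟩ <;> try omega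
    all_goals rcases ind_lt_cases k v with ⟨q5, p5⟩ | ⟨q5, p5⟩ <;> try omega
    all_goals rw [p1, p2, p3, p4, p5]; omega

/-- The case of an element whose deletion disconnects the matroid. -/
theorem pat_condB_two_of_pinch {n : ℕ} {P Q : ℕ → ℕ} (hB : Bounds n P Q)
    (hd : ∀ j, 0 < j → j < n → Q j < P j) {n₁ k₂ t k₃ k₄ : ℕ} (h12 : n₁ < k₂) (h2t : k₂ < t)
    (ht3 : t < k₃) (h34 : k₃ < k₄) (hk : k₄ < n) (hn₁ : P (n₁ + 1) = P n₁ + 1)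
    (hk₂ : P (k₂ + 1) = P k₂) (ht : P (t + 1) = P t + 1) (hk₃ : P (k₃ + 1) = P k₃)
    (hk₄ : P (k₄ + 1) = P k₄) (hdt : P t = Q t + 1) (hdt' : P (t + 1) = Q (t + 1) + 1) :
    Pat n P Q t (Sum.inr 0) (condB 2) := by
  -- The reference path is `P`, with north steps at `n₁` and `t`. The upper bound at `t` gives `f ≤
  -- 1`, the lower bound at `t + 1` gives `1 ≤ f + ε`, and the total is `2`, so `g ≤ 1`.
  refine Pat.twoBlocks_of_path hB.P0 (fun j _ => hB.P_step j) h12 h2t ht3 h34 hk 1 0 0 0 1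
    hn₁ hk₂ hk₃ hk₄ ht (c := fun f g ε => f < 2 ∧ g < 2 ∧ f + g + ε = 2)
    fun i1 i2 i3 i4 i5 b1 b2 b3 b4 b5 => ?_
  have hPn := hB.eq_n
  constructor
  · intro h
    have g1 := h t (by omega)
    have g2 := h (t + 1) (by omega)
    have g3 := h n le_rfl
    simp (disch := omega) only [ind_true, ind_false] at g1
    simp (disch := omega) only [ind_true, ind_false] at g2
    simp (disch := omega) only [ind_true] at g3
    omega
  · intro h v hv
    have hle := hB.le v hv
    have hdv := hd v
    rcases ind_lt_cases n₁ v with ⟨q1, p1⟩ | ⟨q1, p1⟩ <;>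
    rcases ind_lt_cases k₂ v with ⟨q2, p2⟩ | ⟨q2, p2⟩ <;> try omega
    all_goals rcases ind_lt_cases t v with ⟨q3, p3⟩ | ⟨q3, p3⟩ <;> try omega
    all_goals rcases ind_lt_cases k₃ v with ⟨q4, p4⟩ | ⟨q4, p4⟩ <;> try omega
    all_goals rcases ind_lt_cases k₄ v with ⟨q5, p5⟩ | ⟨q5, p5⟩ <;> try omega
    all_goals rw [p1, p2, p3, p4, p5]; omega

/-- A path that follows `P` up to `K`, stays strictly above `Q` up to `t`, has an east step at `t`,
and then goes down to `Q`. -/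
def midPath (P Q : ℕ → ℕ) (K t j : ℕ) : ℕ :=
  if j ≤ K then P j else if j ≤ t then max (P K) (Q j + 1) else
    max (max (P K) (Q t + 1)) (Q j)

/-! ### A path that passes from `P` to `Q` -/

section MidPath

variable {n : ℕ} {P Q : ℕ → ℕ} {K t l : ℕ}

theorem midPath_left {j : ℕ} (hj : j ≤ K) : midPath P Q K t j = P j := if_pos hj

theorem midPath_mid (hd : ∀ j, 0 < j → j < n → Q j < P j) (hK : 0 < K)
    (hKn : K < n) {j : ℕ} (hj : K ≤ j) (hjt : j ≤ t) :
    midPath P Q K t j = max (P K) (Q j + 1) := by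
  rcases hj.eq_or_lt with rfl | h
  · rw [midPath_left le_rfl]; have := hd K hK hKn; omega
  · rw [midPath, if_neg (by omega), if_pos hjt]

theorem midPath_right (hK : K ≤ t) {j : ℕ} (hj : t < j) :
    midPath P Q K t j = max (max (P K) (Q t + 1)) (Q j) := by
  rw [midPath, if_neg (by omega), if_neg (by omega)]

theorem midPath_flat (hB : Bounds n P Q) (hd : ∀ j, 0 < j → j < n → Q j < P j) (hK : 0 < K)
    (hKt : K ≤ t) (htn : t < n) : midPath P Q K t (t + 1) = midPath P Q K t t := by
  rw [midPath_mid hd hK (by omega) hKt le_rfl, midPath_right hKt (by omega)]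
  have := hB.Q_step t; omega

theorem midPath_step (hB : Bounds n P Q) (hd : ∀ j, 0 < j → j < n → Q j < P j) (hK : 0 < K)
    (hKt : K ≤ t) (htn : t < n) (j : ℕ) : midPath P Q K t j ≤ midPath P Q K t (j + 1) ∧
      midPath P Q K t (j + 1) ≤ midPath P Q K t j + 1 := by
  have h1 := hB.P_step j
  have h2 := hB.Q_step j
  rcases lt_or_ge j K with hj | hj
  · rwa [midPath_left hj.le, midPath_left hj]
  rcases lt_trichotomy j t with hjt | rfl | hjt
  · rw [midPath_mid hd hK (by omega) hj hjt.le,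
      midPath_mid hd hK (by omega) (show K ≤ j + 1 by omega) hjt]
    omega
  · rw [midPath_flat hB hd hK hKt htn]; omega
  · rw [midPath_right hKt hjt, midPath_right hKt (show t < j + 1 by omega)]; omega

/-- The room of one unit above `Q` up to `t` allows one north step of the path to be postponed. -/
theorem le_midPath (hB : Bounds n P Q) (hd : ∀ j, 0 < j → j < n → Q j < P j) (hK : 0 < K)
    (hKt : K ≤ t) (htn : t < n) (j : ℕ) (hj : j ≤ n) : Q j ≤ midPath P Q K t j ∧
      (0 < j → j ≤ t → Q j + 1 ≤ midPath P Q K t j) := by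
  rcases lt_or_ge j K with hjK | hjK
  · rw [midPath_left hjK.le]
    exact ⟨hB.le j hj, fun h0 _ => hd j h0 (by omega)⟩
  rcases le_or_gt j t with hjt | hjt
  · rw [midPath_mid hd hK (by omega) hjK hjt]; omega
  · rw [midPath_right hKt hjt]; omega

/-- The room of one unit below `P` after `t` allows one additional north step before that point.
Both `h1` and `h2` are needed there: the constant height after `t` is the larger of `P K` and `Q t +
1`. -/
theorem midPath_le (hB : Bounds n P Q) (hd : ∀ j, 0 < j → j < n → Q j < P j) (hK : 0 < K)
    (hKt : K ≤ t) (htn : t < n) (h1 : P K < P (t + 1)) (h2 : Q t + 2 ≤ P (t + 1))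
    (j : ℕ) (hj : j ≤ n) : midPath P Q K t j ≤ P j ∧
      (t < j → j < n → midPath P Q K t j + 1 ≤ P j) := by
  rcases lt_or_ge j K with hjK | hjK
  · rw [midPath_left hjK.le]
    exact ⟨le_rfl, fun h0 _ => by omega⟩
  have h3 := step_mono hB.P_step hjK
  have h4 := hd j (by omega)
  have h5 := hB.le j hj
  rcases le_or_gt j t with hjt | hjt
  · rw [midPath_mid hd hK (by omega) hjK hjt]
    have := h4 (by omega); omega
  · rw [midPath_right hKt hjt]
    have : P (t + 1) ≤ P j := step_mono hB.P_step hjt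
    omega

/-- By the north step at `l`, the lower path has reached both `P K` and `Q t + 1` at `l + 1`, and
the path joins it there. -/
theorem midPath_end (hB : Bounds n P Q) (hKt : K ≤ t) (htl : t ≤ l) (hl : Q (l + 1) = Q l + 1)
    (hKl : P K ≤ Q (l + 1)) {j : ℕ} (hj : l < j) : midPath P Q K t j = Q j := by
  rw [midPath_right hKt (by omega)]
  have : Q (l + 1) ≤ Q j := step_mono hB.Q_step hj
  have := step_mono hB.Q_step htl
  omega

/-- A `B_{2,2}`-minor, up to doubling the single element. -/
theorem pat_condB_two (hB : Bounds n P Q) (hd : ∀ j, 0 < j → j < n → Q j < P j)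
    {k₂ k₃ : ℕ} (h2K : k₂ < K) (hKt : K ≤ t) (htl : t ≤ l) (hl3 : l < k₃) (h3n : k₃ < n)
    (hk₂ : P (k₂ + 1) = P k₂) (hK : P (K + 1) = P K + 1) (hl : Q (l + 1) = Q l + 1)
    (hk₃ : Q (k₃ + 1) = Q k₃) (hKl : P K ≤ Q (l + 1)) (hdt : Q t + 2 ≤ P (t + 1)) :
    Pat n P Q t (Sum.inr 0) (condB 2) := by
  obtain ⟨e1, e2, e3, e4⟩ := hB.ends (by omega) hd
  have hn1 : n - 1 + 1 = n := by omega
  have hPn := hB.eq_n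
  have hk₂0 : k₂ ≠ 0 := fun h0 => by
    subst h0; have := hB.P0; simp only [zero_add] at hk₂; omega
  have hk₃n : k₃ ≠ n - 1 := fun h0 => by
    subst h0; rw [hn1] at hk₃; omega
  have hPK : P K < P (t + 1) := by
    have := step_mono hB.P_step (show K + 1 ≤ t + 1 by omega); omega
  have lo := le_midPath (t := t) hB hd (show 0 < K by omega) hKt (by omega)
  have up := midPath_le hB hd (show 0 < K by omega) hKt (by omega) hPK hdt
  have en := fun j hj => midPath_end (j := j) hB hKt htl hl hKl hj
  have st := fun j (_ : j < n) =>
    midPath_step (t := t) hB hd (show 0 < K by omega) hKt (by omega) j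
  have ft := midPath_flat (t := t) hB hd (show 0 < K by omega) hKt (by omega)
  have le := fun j hj => midPath_left (P := P) (Q := Q) (K := K) (t := t) (j := j) hj
  set π := midPath P Q K t
  -- The kept positions are `0`, `k₂`, `t`, `k₃`, `n - 1`. The path touches `P` at `K`, which gives
  -- `f < 2`, and touches `Q` at `l + 1`, which gives `1 ≤ f + ε` and, with the total, `g < 2`.
  refine Pat.twoBlocks_of_path (π := π) ((le 0 (by omega)).trans hB.P0) st
    (show 0 < k₂ by omega) (show k₂ < t by omega) (show t < k₃ by omega)
    (show k₃ < n - 1 by omega) (by omega) 1 0 0 1 0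
    ?_ ?_ ?_ ?_ ft (c := fun f g ε => f < 2 ∧ g < 2 ∧ f + g + ε = 2)
    fun i1 i2 i3 i4 i5 b1 b2 b3 b4 b5 => ?_
  · rw [le 0 (by omega), le (0 + 1) (by omega), zero_add, e1, hB.P0]
  · rw [le k₂ (by omega), le _ (by omega), hk₂, add_zero]
  · rw [en k₃ (by omega), en _ (by omega), hk₃, add_zero]
  · rw [en (n - 1) (by omega), en _ (by omega), hn1]; omega
  constructor
  · intro h
    have g1 := h K (by omega)
    have g2 := h (l + 1) (by omega)
    have g3 := h n le_rfl
    simp (disch := omega) only [ind_true, ind_false] at g1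
    simp (disch := omega) only [ind_true, ind_false] at g2
    simp (disch := omega) only [ind_true] at g3
    have := le K le_rfl
    have := en (l + 1) (by omega)
    have := en n (by omega)
    omega
  · intro h v hv
    have hlo := lo v hv
    have hup := up v hv
    rcases ind_lt_cases 0 v with ⟨q1, p1⟩ | ⟨q1, p1⟩ <;>
    rcases ind_lt_cases k₂ v with ⟨q2, p2⟩ | ⟨q2, p2⟩ <;> try omega
    all_goals rcases ind_lt_cases t v with ⟨q3, p3⟩ | ⟨q3, p3⟩ <;> try omega
    all_goals rcases ind_lt_cases k₃ v with ⟨q4, p4⟩ | ⟨q4, p4⟩ <;> try omega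
    all_goals rcases ind_lt_cases (n - 1) v with ⟨q5, p5⟩ | ⟨q5, p5⟩ <;> try omega
    all_goals rw [p1, p2, p3, p4, p5]; omega

end MidPath

end LatticePath

/-! ### The minors with six kept positions, and `P_m + x` for general `m` -/

namespace LatticePath

theorem Pat.map_equiv {n : ℕ} {P Q : ℕ → ℕ} {t : ℕ} {β γ : Type} {x₀ : β} {cond : Set β → Prop}
    (h : Pat n P Q t x₀ cond) (σ : β ≃ γ) : Pat n P Q t (σ x₀) (fun I => cond (σ ⁻¹' I)) := by
  obtain ⟨φ, C, h1, h2, h3, h4, h5⟩ := h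
  refine ⟨φ ∘ σ.symm, C, h1.comp σ.symm.injective, by simpa using h2, fun b => h3 _, h4,
    fun I => ?_⟩
  show _ ↔ cond (σ ⁻¹' I)
  rw [← h5, image_comp, ← σ.image_symm_eq_preimage]

theorem Pat.congr {n : ℕ} {P Q : ℕ → ℕ} {t : ℕ} {β : Type} {x₀ : β} {cond cond' : Set β → Prop}
    (h : Pat n P Q t x₀ cond) (hc : ∀ I, cond I ↔ cond' I) : Pat n P Q t x₀ cond' := by
  obtain ⟨φ, C, h1, h2, h3, h4, h5⟩ := h
  exact ⟨φ, C, h1, h2, h3, h4, fun I => (h5 I).trans (hc I)⟩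

/-- The positions of a pair, two single elements and a second pair. -/
def posPlane (k₁ k₂ y z k₃ k₄ : ℕ) : PairSinglesPair → ℕ :=
  Sum.elim (Sum.elim (Sum.elim ![k₁, k₂] (fun _ => y)) (fun _ => z)) ![k₃, k₄]

theorem posPlane_injective {k₁ k₂ y z k₃ k₄ : ℕ} (h1 : k₁ < k₂) (h2 : k₂ < y) (h3 : y < z)
    (h4 : z < k₃) (h5 : k₃ < k₄) : Function.Injective (posPlane k₁ k₂ y z k₃ k₄) := by
  rintro (((a | a) | a) | a) (((b | b) | b) | b) hab <;> fin_cases a <;> fin_cases b <;>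
    simp [posPlane] at hab ⊢ <;> omega

/-- The reference path is `P`, with steps north, east, north, east, north, east at the kept
positions. The upper bounds at `y` and at `k₃` give the parallel pair and the line. The depth of two
between `y` and `z` makes room for leaving out both `y` and the first pair. The two single elements
are interchangeable, so the basepoint may be either of them. -/
theorem pat_condPlane {n : ℕ} {P Q : ℕ → ℕ} (hB : Bounds n P Q)
    (hd : ∀ j, 0 < j → j < n → Q j < P j) {k₁ k₂ y z k₃ k₄ : ℕ} (h12 : k₁ < k₂) (h2y : k₂ < y)
    (hyz : y < z) (hz3 : z < k₃) (h34 : k₃ < k₄) (hk : k₄ < n)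
    (hk₁ : P (k₁ + 1) = P k₁ + 1) (hk₂ : P (k₂ + 1) = P k₂) (hy : P (y + 1) = P y + 1)
    (hz : P (z + 1) = P z) (hk₃ : P (k₃ + 1) = P k₃ + 1) (hk₄ : P (k₄ + 1) = P k₄)
    (hdd : ∀ j, y < j → j ≤ z → Q j + 2 ≤ P j) :
    Pat n P Q z (Sum.inl (Sum.inr 0)) condPlane ∧
      Pat n P Q y (Sum.inl (Sum.inr 0)) condPlane := by
  have main : ∀ x₀, Pat n P Q (posPlane k₁ k₂ y z k₃ k₄ x₀) x₀ condPlane := by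
    intro x₀
    refine Pat.of_path hB.P0 (fun j _ => hB.P_step j) (posPlane_injective h12 h2y hyz hz3 h34)
      ?_ (w := posPlane 1 0 1 0 1 0) ?_ x₀ fun I => ?_
    · simp [posPlane, Sum.forall, Fin.forall_fin_two]; omega
    · simp [posPlane, Sum.forall, Fin.forall_fin_two]; omega
    simp only [condPlane, blk_fin_two, blk_fin_one, Function.comp_apply, posPlane,
      Fintype.sum_sum_type, Fin.sum_univ_two, Sum.elim_inl, Sum.elim_inr, Matrix.cons_val_zero,
      Matrix.cons_val_one, Fin.sum_univ_one, one_mul, zero_mul]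
    have b1 := ind_le_one (Sum.inl (Sum.inl (Sum.inl 0)) ∈ I)
    have b2 := ind_le_one (Sum.inl (Sum.inl (Sum.inl 1)) ∈ I)
    have b3 := ind_le_one (Sum.inl (Sum.inl (Sum.inr 0)) ∈ I)
    have b4 := ind_le_one (Sum.inl (Sum.inr 0) ∈ I)
    have b5 := ind_le_one (Sum.inr 0 ∈ I)
    have b6 := ind_le_one (Sum.inr 1 ∈ I)
    generalize ind (Sum.inl (Sum.inl (Sum.inl 0)) ∈ I) = i1 at *
    generalize ind (Sum.inl (Sum.inl (Sum.inl 1)) ∈ I) = i2 at *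
    generalize ind (Sum.inl (Sum.inl (Sum.inr 0)) ∈ I) = i3 at *
    generalize ind (Sum.inl (Sum.inr 0) ∈ I) = i4 at *
    generalize ind (Sum.inr 0 ∈ I) = i5 at *
    generalize ind (Sum.inr 1 ∈ I) = i6 at *
    have hPn := hB.eq_n
    constructor
    · intro h
      have g1 := h y (by omega)
      have g2 := h k₃ (by omega)
      have g3 := h n le_rfl
      simp (disch := omega) only [ind_true, ind_false] at g1
      simp (disch := omega) only [ind_true, ind_false] at g2
      simp (disch := omega) only [ind_true] at g3
      omega
    · intro h v hv
      have hle := hB.le v hv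
      have hdv := hd v
      have hddv := hdd v
      rcases ind_lt_cases k₁ v with ⟨q1, p1⟩ | ⟨q1, p1⟩ <;>
      rcases ind_lt_cases k₂ v with ⟨q2, p2⟩ | ⟨q2, p2⟩ <;> try omega
      all_goals rcases ind_lt_cases y v with ⟨q3, p3⟩ | ⟨q3, p3⟩ <;> try omega
      all_goals rcases ind_lt_cases z v with ⟨q4, p4⟩ | ⟨q4, p4⟩ <;> try omega
      all_goals rcases ind_lt_cases k₃ v with ⟨q5, p5⟩ | ⟨q5, p5⟩ <;> try omega
      all_goals rcases ind_lt_cases k₄ v with ⟨q6, p6⟩ | ⟨q6, p6⟩ <;> try omega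
      all_goals rw [p1, p2, p3, p4, p5, p6]; omega
  refine ⟨main _, ?_⟩
  -- The second statement follows from the first construction by exchanging the two single elements.
  let σ : PairSinglesPair ≃ PairSinglesPair :=
    Equiv.swap (Sum.inl (Sum.inl (Sum.inr 0))) (Sum.inl (Sum.inr 0))
  have h1 := (main (Sum.inl (Sum.inl (Sum.inr 0)))).map_equiv σ
  rw [show σ (Sum.inl (Sum.inl (Sum.inr 0))) = Sum.inl (Sum.inr 0) from
    Equiv.swap_apply_left _ _] at h1
  refine h1.congr fun I => ?_
  have s1 : σ (Sum.inl (Sum.inl (Sum.inl 0))) = Sum.inl (Sum.inl (Sum.inl 0)) :=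
    Equiv.swap_apply_of_ne_of_ne (by simp) (by simp)
  have s2 : σ (Sum.inl (Sum.inl (Sum.inl 1))) = Sum.inl (Sum.inl (Sum.inl 1)) :=
    Equiv.swap_apply_of_ne_of_ne (by simp) (by simp)
  have s3 : σ (Sum.inl (Sum.inl (Sum.inr 0))) = Sum.inl (Sum.inr 0) :=
    Equiv.swap_apply_left _ _
  have s4 : σ (Sum.inl (Sum.inr 0)) = Sum.inl (Sum.inl (Sum.inr 0)) :=
    Equiv.swap_apply_right _ _
  have s5 : σ (Sum.inr 0) = Sum.inr 0 := Equiv.swap_apply_of_ne_of_ne (by simp) (by simp)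
  have s6 : σ (Sum.inr 1) = Sum.inr 1 := Equiv.swap_apply_of_ne_of_ne (by simp) (by simp)
  simp only [condPlane, blk_fin_two, blk_fin_one, Function.comp_apply, mem_preimage,
    s1, s2, s3, s4, s5, s6]
  omega

/-- The positions of two pairs and two single elements in between. -/
def posTwoPairs (k₁ k₂ y t k₃ k₄ : ℕ) : TwoPairs → ℕ :=
  Sum.elim (Sum.elim (Sum.elim ![k₁, k₂] ![k₃, k₄]) (fun _ => y)) (fun _ => t)

theorem posTwoPairs_injective {k₁ k₂ y t k₃ k₄ : ℕ} (h1 : k₁ < k₂) (h2 : k₂ < y) (h3 : y < t)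
    (h4 : t < k₃) (h5 : k₃ < k₄) : Function.Injective (posTwoPairs k₁ k₂ y t k₃ k₄) := by
  rintro (((a | a) | a) | a) (((b | b) | b) | b) hab <;> fin_cases a <;> fin_cases b <;>
    simp [posTwoPairs] at hab ⊢ <;> omega

/-- A path that starts on the path `P` and ends strictly below it leaves it for the last time. -/
theorem exists_last_crossing {π P : ℕ → ℕ}
    (hπ : ∀ j, π j ≤ π (j + 1)) (hP : ∀ j, P (j + 1) ≤ P j + 1) {K t : ℕ} (hKt : K < t)
    (hle : ∀ j, K ≤ j → j ≤ t → π j ≤ P j) (hK : π K = P K) (ht : π t < P t) :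
    ∃ y, K ≤ y ∧ y < t ∧ π (y + 1) = π y ∧ ∀ j, y < j → j ≤ t → π j < P j := by
  induction t, hKt using Nat.le_induction with
  | base =>
    refine ⟨K, le_rfl, by omega, ?_, fun j h1 h2 => ?_⟩
    · have := hπ K; have := hP K; simp only [Nat.succ_eq_add_one] at *; omega
    · rwa [show j = K + 1 by omega]
  | succ t hKt ih =>
    by_cases h : π t < P t
    · obtain ⟨y, h1, h2, h3, h4⟩ := ih (fun j h5 h6 => hle j h5 (by omega)) h
      refine ⟨y, h1, by omega, h3, fun j h5 h6 => ?_⟩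
      rcases Nat.lt_or_ge t j with h7 | h7
      · rwa [show j = t + 1 by omega]
      · exact h4 j h5 h7
    · have h7 := hle t (by simp at hKt; omega) (by omega)
      refine ⟨t, by simp at hKt; omega, by omega, ?_, fun j h1 h2 => ?_⟩
      · have := hπ t; have := hP t; omega
      · rwa [show j = t + 1 by omega]

/-- A minor of rank `2` with two parallel pairs and two further elements. -/
theorem pat_condR {n : ℕ} {P Q : ℕ → ℕ} {K t l : ℕ} (hB : Bounds n P Q)
    (hd : ∀ j, 0 < j → j < n → Q j < P j)
    {k₂ k₃ : ℕ} (h2K : k₂ < K) (hKt : K < t) (htl : t ≤ l) (hl3 : l < k₃) (h3n : k₃ < n)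
    (hk₂ : P (k₂ + 1) = P k₂) (hK : P (K + 1) = P K + 1) (hl : Q (l + 1) = Q l + 1)
    (hk₃ : Q (k₃ + 1) = Q k₃) (hKl : P K ≤ Q (l + 1)) (hdt : Q t + 2 ≤ P t) :
    Pat n P Q t (Sum.inr 0) condR := by
  obtain ⟨e1, e2, e3, e4⟩ := hB.ends (by omega) hd
  have hn1 : n - 1 + 1 = n := by omega
  have hPn := hB.eq_n
  have hk₂0 : k₂ ≠ 0 := fun h0 => by
    subst h0; have := hB.P0; simp only [zero_add] at hk₂; omega
  have hk₃n : k₃ ≠ n - 1 := fun h0 => by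
    subst h0; rw [hn1] at hk₃; omega
  have hPt : P K < P t := by
    have := step_mono hB.P_step (show K + 1 ≤ t by omega); omega
  have hPt' := (hB.P_step t).1
  have lo := le_midPath (t := t) hB hd (show 0 < K by omega) hKt.le (by omega)
  have up := midPath_le hB hd (show 0 < K by omega) hKt.le (by omega) (by omega) (by omega)
  have en := fun j hj => midPath_end (j := j) hB hKt.le htl hl hKl hj
  have st := fun j =>
    midPath_step (t := t) hB hd (show 0 < K by omega) hKt.le (by omega) j
  have ft := midPath_flat (t := t) hB hd (show 0 < K by omega) hKt.le (by omega)
  have le := fun j hj => midPath_left (P := P) (Q := Q) (K := K) (t := t) (j := j) hj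
  have mt := midPath_mid hd (show 0 < K by omega) (by omega) hKt.le le_rfl
  set π := midPath P Q K t
  -- The extra point `y` is an east step of `π` after which `π` stays strictly below `P` up to `t`,
  -- so an additional north step at `y` is possible.
  obtain ⟨y, hy1, hy2, hy3, hy4⟩ := exists_last_crossing (fun j => (st j).1)
    (fun j => (hB.P_step j).2) hKt (fun j _ _ => (up j (by omega)).1) (le K le_rfl) (by omega)
  refine Pat.of_path (π := π) (φ := posTwoPairs 0 k₂ y t k₃ (n - 1))
    ((le 0 (by omega)).trans hB.P0) (fun j _ => st j)
    (posTwoPairs_injective (by omega) (by omega) (by omega) (by omega) (by omega))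
    ?_ (w := posTwoPairs 1 0 0 0 0 1) ?_ (Sum.inr 0) fun I => ?_
  · simp [posTwoPairs, Sum.forall, Fin.forall_fin_two]; omega
  · have a1 : π (0 + 1) = π 0 + 1 := by
      rw [le 0 (by omega), le (0 + 1) (by omega), zero_add, e1, hB.P0]
    have a2 : π (k₂ + 1) = π k₂ := by rw [le k₂ (by omega), le _ (by omega), hk₂]
    have a3 : π (k₃ + 1) = π k₃ := by rw [en k₃ (by omega), en _ (by omega), hk₃]
    have a4 : π (n - 1 + 1) = π (n - 1) + 1 := by
      rw [en (n - 1) (by omega), en _ (by omega), hn1]; omega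
    simp only [zero_add] at a1
    simp [posTwoPairs, Sum.forall, Fin.forall_fin_two, a1, a2, a3, a4, ft, hy3]
  simp only [condR, blk_fin_two, blk_fin_one, Function.comp_apply, posTwoPairs,
    Fintype.sum_sum_type, Fin.sum_univ_two, Sum.elim_inl, Sum.elim_inr, Matrix.cons_val_zero,
    Matrix.cons_val_one, Fin.sum_univ_one, one_mul, zero_mul]
  have b1 := ind_le_one (Sum.inl (Sum.inl (Sum.inl 0)) ∈ I)
  have b2 := ind_le_one (Sum.inl (Sum.inl (Sum.inl 1)) ∈ I)
  have b3 := ind_le_one (Sum.inl (Sum.inl (Sum.inr 0)) ∈ I)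
  have b4 := ind_le_one (Sum.inl (Sum.inl (Sum.inr 1)) ∈ I)
  have b5 := ind_le_one (Sum.inl (Sum.inr 0) ∈ I)
  have b6 := ind_le_one (Sum.inr 0 ∈ I)
  generalize ind (Sum.inl (Sum.inl (Sum.inl 0)) ∈ I) = i1 at *
  generalize ind (Sum.inl (Sum.inl (Sum.inl 1)) ∈ I) = i2 at *
  generalize ind (Sum.inl (Sum.inl (Sum.inr 0)) ∈ I) = i3 at *
  generalize ind (Sum.inl (Sum.inl (Sum.inr 1)) ∈ I) = i4 at *
  generalize ind (Sum.inl (Sum.inr 0) ∈ I) = i5 at *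
  generalize ind (Sum.inr 0 ∈ I) = i6 at *
  have hπK := le K le_rfl
  have hπl := en (l + 1) (by omega)
  have hπn := en n (by omega)
  constructor
  · intro h
    have g1 := h K (by omega)
    have g2 := h (l + 1) (by omega)
    have g3 := h n le_rfl
    simp (disch := omega) only [ind_true, ind_false] at g1
    simp (disch := omega) only [ind_true, ind_false] at g2
    simp (disch := omega) only [ind_true] at g3
    omega
  · intro h v hv
    have hlo := lo v hv
    have hup := up v hv
    have hyv := hy4 v
    clear lo up en st le hy4
    rcases ind_lt_cases 0 v with ⟨q1, p1⟩ | ⟨q1, p1⟩ <;>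
    rcases ind_lt_cases k₂ v with ⟨q2, p2⟩ | ⟨q2, p2⟩ <;> try omega
    all_goals rcases ind_lt_cases y v with ⟨q3, p3⟩ | ⟨q3, p3⟩ <;> try omega
    all_goals rcases ind_lt_cases t v with ⟨q4, p4⟩ | ⟨q4, p4⟩ <;> try omega
    all_goals rcases ind_lt_cases k₃ v with ⟨q5, p5⟩ | ⟨q5, p5⟩ <;> try omega
    all_goals rcases ind_lt_cases (n - 1) v with ⟨q6, p6⟩ | ⟨q6, p6⟩ <;> try omega
    all_goals rw [p1, p2, p3, p4, p5, p6]; omega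

theorem cnt_Ico (a b : ℕ) (v : ℕ) : cnt (Ico a b) v = min v b - a := by
  induction v with
  | zero => simp
  | succ v ih =>
    rw [cnt_succ, ih]
    by_cases h : v ∈ Ico a b
    · rw [ind_true h]; simp at h; omega
    · rw [ind_false h]; simp at h; omega

theorem sum_ind_of_lt {β : Type*} {m : ℕ} (g : Fin m → β) (k : Fin m → ℕ) (I : Set β) {v : ℕ}
    (h : ∀ i, k i < v) : ∑ i, ind (g i ∈ I ∧ k i < v) = blk g I := by
  rw [blk_eq_sum]
  exact Finset.sum_congr rfl fun i _ => ind_congr (and_iff_left (h i))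

theorem sum_ind_of_ge {β : Type*} {m : ℕ} (g : Fin m → β) (k : Fin m → ℕ) (I : Set β) {v : ℕ}
    (h : ∀ i, v ≤ k i) : ∑ i, ind (g i ∈ I ∧ k i < v) = 0 :=
  Finset.sum_eq_zero fun i _ => ind_false fun hc => by have := h i; omega

set_option maxHeartbeats 1000000 in
/-- The minor `P_m + x` for two sets of clones at the ends and an element in between. -/
theorem pat_condB {n : ℕ} {P Q : ℕ → ℕ} {K t l p : ℕ} (hB : Bounds n P Q)
    (hKt : K ≤ t) (htl : t ≤ l) (hln : l < n) (hpK : p < K)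
    (hP : ∀ j ≤ K, P j = min j p) (hK : P (K + 1) = p + 1)
    (hQ : ∀ j, l < j → j ≤ n → P n = Q j + min (n - j) (P n - Q (l + 1)))
    (hl : Q (l + 1) = Q l + 1) (hpl : Q (l + 1) ≤ p) (hp' : P n - Q (l + 1) < n - l - 1)
    {m : ℕ} (hm : m + Q l = p + 1) :
    Pat n P Q t (Sum.inr 0) (condB m) := by
  have hPn := step_mono hB.P_step (show K + 1 ≤ n by omega)
  have hQl := step_mono hB.Q_step (show l + 1 ≤ n by omega)
  have hBn := hB.eq_n
  set c := Q l with hc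
  set s := P n - Q (l + 1) with hs
  set d := P n - p - 1 with hdef
  -- The first `p + 1` positions consist of `c` contracted ones and `m` kept ones, because `m + c =
  -- p + 1`. The last `s + 1` positions consist of `m` kept ones followed by `d` contracted ones,
  -- because `s + 1 = m + d`.
  set φ : TwoBlocks m → ℕ :=
    Sum.elim (Sum.elim (fun i => c + i) (fun i => n - s - 1 + i)) (fun _ => t) with hφ
  have hinj : Function.Injective φ := by
    rintro ((a | a) | a) ((b | b) | b) hab <;>
      simp only [hφ, Sum.elim_inl, Sum.elim_inr] at hab <;>
      first | (exfalso; omega) | (congr 2; omega)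
  have hφC : ∀ b, φ b < n ∧ φ b ∉ Ico 0 c ∪ Ico (n - d) n := by
    rintro ((a | a) | a) <;> simp only [hφ, Sum.elim_inl, Sum.elim_inr, mem_union, mem_Ico] <;>
      omega
  refine ⟨φ, Ico 0 c ∪ Ico (n - d) n, hinj, rfl, hφC, ?_, fun I => ?_⟩
  · rintro j (hj | hj) <;> simp only [mem_Ico, mem_Iio] at hj ⊢ <;> omega
  have hdisj : Disjoint (φ '' I) (Ico 0 c ∪ Ico (n - d) n) := by
    rw [Set.disjoint_left]
    rintro _ ⟨b, -, rfl⟩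
    exact (hφC b).2
  have hCd : Disjoint (Ico 0 c) (Ico (n - d) n) := by
    rw [Set.disjoint_left]
    intro j hj hj'
    simp only [mem_Ico] at hj hj'; omega
  set S := φ '' I ∪ (Ico 0 c ∪ Ico (n - d) n) with hS
  have hcnt : ∀ v, cnt S v = (∑ i, ind (Sum.inl (Sum.inl i) ∈ I ∧ c + (i : ℕ) < v) +
      ∑ i, ind (Sum.inl (Sum.inr i) ∈ I ∧ n - s - 1 + (i : ℕ) < v) +
      ind (Sum.inr 0 ∈ I ∧ t < v)) + ((min v c - 0) + (min v n - (n - d))) := fun v => by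
    rw [hS, cnt_union hdisj, cnt_union hCd, cnt_Ico, cnt_Ico, cnt_image hinj]
    simp [hφ]
  have f1 : ∀ v, p + 1 ≤ v → ∑ i, ind (Sum.inl (Sum.inl i) ∈ I ∧ c + (i : ℕ) < v) =
      blk (Sum.inl ∘ Sum.inl) I := fun v hv => sum_ind_of_lt (Sum.inl ∘ Sum.inl) _ I (by omega)
  have g0 : ∀ v, v ≤ n - s - 1 →
      ∑ i, ind (Sum.inl (Sum.inr i) ∈ I ∧ n - s - 1 + (i : ℕ) < v) = 0 :=
    fun v hv => sum_ind_of_ge (Sum.inl ∘ Sum.inr) _ I (by omega)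
  have g1 : ∑ i, ind (Sum.inl (Sum.inr i) ∈ I ∧ n - s - 1 + (i : ℕ) < n) =
      blk (Sum.inl ∘ Sum.inr) I := sum_ind_of_lt (Sum.inl ∘ Sum.inr) _ I (by omega)
  have cK := hcnt K
  rw [f1 K (by omega), g0 K (by omega), ind_false (fun h => by omega)] at cK
  have cl := hcnt (l + 1)
  rw [f1 _ (by omega), g0 _ (by omega),
    ind_congr (and_iff_left (show t < l + 1 by omega))] at cl
  have cn := hcnt n
  rw [f1 _ (by omega), g1, ind_congr (and_iff_left (show t < n by omega))] at cn
  have hε := ind_le_one (Sum.inr 0 ∈ I)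
  simp only [condB, blk_fin_one]
  constructor
  · intro h
    -- The upper bound at `K` gives `c + f ≤ p`, so `f < m`. The lower bound `c + 1` at `l + 1`
    -- leaves at most `m - 1` for the second block once the total at `n` is fixed.
    have h1 := h K (by omega)
    have h2 := h (l + 1) (by omega)
    have h3 := h n le_rfl
    have h4 := hP K le_rfl
    omega
  · rintro ⟨h1, h2, h3⟩ v hv
    have h4 := hcnt v
    have h5 := cnt_le S v
    have h6 := cnt_le_add S hv
    have h7 := cnt_mono S hv
    have hQv := le_self_of_step hB.Q0 hB.Q_step v
    have hPv := step_le_add hB.P_step hv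
    have hle := hB.le v hv
    constructor
    · rcases Nat.lt_or_ge l v with hlv | hlv
      · have h8 : cnt S (l + 1) ≤ cnt S v := cnt_mono S hlv
        have h9 := hQ v hlv hv
        omega
      · have h8 := step_mono hB.Q_step hlv
        omega
    · rcases Nat.lt_or_ge K v with hKv | hKv
      · have h8 : P (K + 1) ≤ P v := step_mono hB.P_step hKv
        -- If only contracted positions follow, the path runs straight north from `v` to the common
        -- end. Otherwise all `d` contracted positions at the end still follow, so the height is at
        -- most `P n - d = p + 1`, which `P` has reached after `K`.
        by_cases h9 : n - v ≤ d
        · have h10 : cnt S n ≥ cnt S v + (n - v) := by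
            have h11 := cnt_eq_add_card S hv
            have h12 : (Ico v n).ncard ≤ (S ∩ Ico v n).ncard :=
              ncard_le_ncard (fun j hj => ⟨Or.inr (Or.inr ⟨by have := hj.1; omega, hj.2⟩), hj⟩)
                ((finite_Ico v n).subset inter_subset_right)
            rw [← Finset.coe_Ico v n, ncard_coe_finset, Nat.card_Ico, Finset.coe_Ico] at h12
            omega
          omega
        · have h10 : cnt S n ≥ cnt S v + d := by
            have h11 := cnt_eq_add_card S hv
            have h12 : (Ico (n - d) n).ncard ≤ (S ∩ Ico v n).ncard :=
              ncard_le_ncard (fun j hj => ⟨Or.inr (Or.inr hj), by have := hj.1; omega, hj.2⟩)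
                ((finite_Ico v n).subset inter_subset_right)
            rw [← Finset.coe_Ico (n - d) n, ncard_coe_finset, Nat.card_Ico] at h12
            omega
          omega
      · have h8 := hP v hKv
        have h9 := cnt_mono S hKv
        omega

end LatticePath

namespace LatticePath

/-! ### The choice of a minor according to the turns of the paths around `t` -/

variable {n : ℕ} {P Q : ℕ → ℕ} {t : ℕ}

/-- `K` is the first north step of `P` that comes after an east step; minimality makes the first `K`
steps north steps followed by east steps. -/
theorem LeftP.exists_first (hB : Bounds n P Q) (h : LeftP P t) :
    ∃ i K, i < K ∧ K ≤ t ∧ P (i + 1) = P i ∧ P (K + 1) = P K + 1 ∧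
      (∀ j ≤ K, P j = min j (P K)) ∧ P K < K := by
  classical
  have hex : ∃ K, ∃ i < K, P (i + 1) = P i ∧ P (K + 1) = P K + 1 := by
    obtain ⟨i, k, h1, h2, h3, h4⟩ := h
    exact ⟨k, i, h1, h3, h4⟩
  obtain ⟨i, h1, h2, h3⟩ := Nat.find_spec hex
  have hmin := fun k => Nat.find_min (H := hex) (m := k)
  have hle : Nat.find hex ≤ t := by
    obtain ⟨i, k, h1, h2, h3, h4⟩ := h
    exact (Nat.find_min' hex ⟨i, h1, h3, h4⟩).trans h2
  set K := Nat.find hex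
  refine ⟨i, K, h1, hle, h2, h3, ?_, ?_⟩
  · have hno : ¬ LeftP P (K - 1) := by
      rintro ⟨i', k, q1, q2, q3, q4⟩
      exact hmin k (by omega) ⟨i', q1, q3, q4⟩
    have := eq_min_of_not_leftP hB hno
    rwa [show K - 1 + 1 = K by omega] at this
  · have q1 := le_self_of_step hB.P0 hB.P_step i
    have q2 : P K ≤ P (i + 1) + (K - (i + 1)) := step_le_add hB.P_step h1
    omega

/-- This is `LeftP.exists_first` for the reversed order. The formula for `P n` says that beyond `l`
the lower path goes straight east and then straight north. -/
theorem RightQ.exists_last (hB : Bounds n P Q) (ht : t < n) (h : RightQ n Q t) :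
    ∃ l w, t ≤ l ∧ l < w ∧ w < n ∧ Q (l + 1) = Q l + 1 ∧ Q (w + 1) = Q w ∧
      (∀ j, l < j → j ≤ n → P n = Q j + min (n - j) (P n - Q (l + 1))) ∧
      P n - Q (l + 1) < n - l - 1 := by
  obtain ⟨i, K, h1, h2, h3, h4, h5, h6⟩ := (leftP_rev hB ht h).exists_first hB.rev
  have q1 := revP_step hB (show i < n by omega)
  have q2 := revP_step hB (show K < n by omega)
  have q3 : revP n P Q K = P n - Q (n - 1 - K + 1) := by
    rw [revP, show n - K = n - 1 - K + 1 by omega]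
  refine ⟨n - 1 - K, n - 1 - i, by omega, by omega, by omega, by omega, by omega,
    fun j hj hjn => ?_, by omega⟩
  have q4 := h5 (n - j) (by omega)
  have q5 := hB.Q_le_P_last hjn
  rw [q3] at q4
  rw [revP, show n - (n - j) = j by omega] at q4
  omega

/-- The case in which the two paths have parallel north steps at `t`, at distance one. -/
theorem pat_of_pinch (hB : Bounds n P Q) (hn : 2 ≤ n)
    (hd : ∀ j, 0 < j → j < n → Q j < P j) (htn : t < n) (hL : LeftP P t ∨ LeftQ Q t)
    (hR : RightP n P t ∨ RightQ n Q t) (hP : P (t + 1) = P t + 1) (hQ : Q (t + 1) = Q t + 1)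
    (hPQ : P t = Q t + 1) : Pat n P Q t (Sum.inr 0) (condB 2) := by
  obtain ⟨e1, e2, e3, e4⟩ := hB.ends hn hd
  have hn1 : n - 1 + 1 = n := by omega
  have hEn := hB.eq_n
  -- A left turn of `P` already contains an east step before `t`. For a left turn of `Q`, the lower
  -- path has two east steps before `t`, one of them at `0`, and `P t = Q t + 1` still leaves one
  -- for `P`.
  have hPt : P t < t := by
    rcases hL with ⟨i, k, h1, h2, h3, h4⟩ | ⟨i, k, h1, h2, h3, h4⟩
    · have q1 := le_self_of_step hB.P0 hB.P_step i
      have q2 : P t ≤ P (i + 1) + (t - (i + 1)) := step_le_add hB.P_step (by omega)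
      omega
    · have hkt : k ≠ t := fun h => by subst h; omega
      have hi0 : i ≠ 0 := fun h => by
        subst h; have := hB.Q0; simp only [zero_add] at h3; omega
      have q1 : Q k ≤ Q 1 + (k - 1) := step_le_add hB.Q_step (by omega)
      have q2 : Q t ≤ Q (k + 1) + (t - (k + 1)) := step_le_add hB.Q_step (by omega)
      omega
  -- `P` needs two east steps after `t`: one is at `n - 1`, and this count yields another before it.
  have hE : P n - P (t + 1) + 2 ≤ n - (t + 1) := by
    rcases hR with ⟨l, w, h1, h2, h3, h4, h5⟩ | ⟨l, w, h1, h2, h3, h4, h5⟩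
    · have hlt : l ≠ t := fun h => by subst h; omega
      have hwn : w ≠ n - 1 := fun h => by subst h; rw [hn1] at h5; omega
      have q1 : P l ≤ P (t + 1) + (l - (t + 1)) := step_le_add hB.P_step (by omega)
      have q2 : P (n - 1) ≤ P (l + 1) + (n - 1 - (l + 1)) := step_le_add hB.P_step (by omega)
      omega
    · have q1 : Q w ≤ Q (t + 1) + (w - (t + 1)) := step_le_add hB.Q_step (by omega)
      have q2 : Q n ≤ Q (w + 1) + (n - (w + 1)) := step_le_add hB.Q_step (by omega)
      have q3 := step_mono hB.P_step (show t + 1 ≤ n by omega)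
      omega
  obtain ⟨i, hi1, hi2, hi3⟩ := exists_flat_step hB.P_step (Nat.zero_le t) (by
    rw [hB.P0]; omega)
  have hi0 : i ≠ 0 := fun h => by
    subst h; have := hB.P0; simp only [zero_add] at hi3; omega
  obtain ⟨k, hk1, hk2, hk3⟩ := exists_flat_step (u := t + 1) (v := n - 1) hB.P_step (by omega)
    (by omega)
  exact pat_condB_two_of_pinch hB hd (n₁ := 0) (k₂ := i) (k₃ := k) (k₄ := n - 1) (by omega) hi2
    (by omega) hk2 (by omega) (by rw [hB.P0]; exact e1) hi3 hP hk3 (by rw [hn1, e3]) hPQ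
    (by omega)

/-- Going back from `t`, the distance between the paths can fall below two only across a north step
of `P`; if it never does, the step at `k` serves. -/
theorem exists_deep_north_step (hP : ∀ j, P j ≤ P (j + 1) ∧ P (j + 1) ≤ P j + 1)
    (hQ : ∀ j, Q j ≤ Q (j + 1)) {k : ℕ} (hkt : k < t) (hk : P (k + 1) = P k + 1)
    (ht : Q t + 2 ≤ P t) :
    ∃ y, k ≤ y ∧ y < t ∧ P (y + 1) = P y + 1 ∧ ∀ j, y < j → j ≤ t → Q j + 2 ≤ P j := by
  induction t, hkt using Nat.le_induction with
  | base =>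
    exact ⟨k, le_rfl, by omega, hk, fun j h1 h2 => by rwa [show j = k + 1 by omega]⟩
  | succ t hkt ih =>
    have h0 : k < t := hkt
    by_cases h : Q t + 2 ≤ P t
    · obtain ⟨y, h1, h2, h3, h4⟩ := ih h
      refine ⟨y, h1, by omega, h3, fun j h5 h6 => ?_⟩
      rcases Nat.lt_or_ge t j with h7 | h7
      · rwa [show j = t + 1 by omega]
      · exact h4 j h5 h7
    · have := hP t
      have := hQ t
      exact ⟨t, by omega, by omega, by omega, fun j h1 h2 => by rwa [show j = t + 1 by omega]⟩

/-- Going forward from `u`, the distance can fall below two only across an east step of `P`; if it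
does not, the step at `l` serves. -/
theorem exists_deep_flat_step (hP : ∀ j, P j ≤ P (j + 1) ∧ P (j + 1) ≤ P j + 1)
    (hQ : ∀ j, Q (j + 1) ≤ Q j + 1) {u l : ℕ} (hul : u ≤ l) (hl : P (l + 1) = P l)
    (hu : Q u + 2 ≤ P u) :
    ∃ z, u ≤ z ∧ z ≤ l ∧ P (z + 1) = P z ∧ ∀ j, u ≤ j → j ≤ z → Q j + 2 ≤ P j := by
  obtain ⟨k, rfl⟩ := Nat.exists_eq_add_of_le hul
  induction k generalizing u with
  | zero => exact ⟨u, le_rfl, by omega, hl, fun j h1 h2 => by rwa [show j = u by omega]⟩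
  | succ k ih =>
    by_cases h : Q (u + 1) + 2 ≤ P (u + 1)
    · obtain ⟨z, h1, h2, h3, h4⟩ := ih (u := u + 1) h (by omega)
        (by rwa [show u + 1 + k = u + (k + 1) by omega])
      refine ⟨z, by omega, by omega, h3, fun j h5 h6 => ?_⟩
      rcases h5.eq_or_lt with rfl | h7
      · exact hu
      · exact h4 j h7 h6
    · have := hP u
      have := hQ u
      exact ⟨u, le_rfl, by omega, by omega, fun j h1 h2 => by rwa [show j = u by omega]⟩

/-- The turns of `P` supply the outer positions. If `P` goes east at `t`, then `t` is the second
single element and a deep north step is sought before it; if `P` goes north at `t`, then `t` is the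
first one and a deep east step is sought after it. In the second case the exclusion of the pinch
gives the depth at `t + 1`. -/
theorem pat_plane_of_left_right (hB : Bounds n P Q) (hn : 2 ≤ n)
    (hd : ∀ j, 0 < j → j < n → Q j < P j) (hL : LeftP P t)
    (hR : RightP n P t) (h2 : Q t + 2 ≤ P (t + 1))
    (hpinch : ¬ (P (t + 1) = P t + 1 ∧ Q (t + 1) = Q t + 1 ∧ P t = Q t + 1)) :
    Pat n P Q t (Sum.inl (Sum.inr 0)) condPlane := by
  obtain ⟨e1, e2, e3, e4⟩ := hB.ends hn hd
  have hn1 : n - 1 + 1 = n := by omega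
  obtain ⟨i, k, a1, a2, a3, a4⟩ := hL
  obtain ⟨l, w, b1, b2, b3, b4, b5⟩ := hR
  have hi0 : i ≠ 0 := fun h => by
    subst h; have := hB.P0; simp only [zero_add] at a3; omega
  have hwn : w ≠ n - 1 := fun h => by subst h; rw [hn1] at b5; omega
  have hP0 : P (0 + 1) = P 0 + 1 := by rw [hB.P0]; exact e1
  have hPn : P (n - 1 + 1) = P (n - 1) := by rw [hn1, e3]
  have sP := hB.P_step t
  have sQ := hB.Q_step t
  by_cases ht : P (t + 1) = P t
  · have hkt : k < t := lt_of_le_of_ne a2 fun h => by subst h; omega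
    have hwt : w ≠ t := fun h => by subst h; omega
    obtain ⟨y, y1, y2, y3, y4⟩ := exists_deep_north_step hB.P_step (fun j => (hB.Q_step j).1)
      hkt a4 (by omega)
    exact (pat_condPlane hB hd (k₁ := 0) (k₂ := i) (y := y) (z := t) (k₃ := w) (k₄ := n - 1)
      (by omega) (by omega) y2 (by omega) (by omega) (by omega) hP0 a3 y3 ht b5 hPn y4).1
  · have hlt : t < l := lt_of_le_of_ne b1 fun h => by subst h; omega
    obtain ⟨z, z1, z2, z3, z4⟩ := exists_deep_flat_step (u := t + 1) hB.P_step
      (fun j => (hB.Q_step j).2) hlt b4 (by omega)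
    exact (pat_condPlane hB hd (k₁ := 0) (k₂ := i) (y := t) (z := z) (k₃ := w) (k₄ := n - 1)
      (by omega) (by omega) z1 (by omega) (by omega) (by omega) hP0 a3 (by omega) z3 b5 hPn z4).2

theorem depth_rev (hB : Bounds n P Q) (hd : ∀ j, 0 < j → j < n → Q j < P j) :
    ∀ j, 0 < j → j < n → revQ n P j < revP n P Q j := fun j h1 h2 => by
  have q1 := hd (n - j) (by omega) (by omega)
  have q2 := step_mono hB.P_step (show n - j ≤ n by omega)
  simp only [revP, revQ]; omega

theorem revP_apply_pred (ht : t < n) : revP n P Q (n - 1 - t) = P n - Q (t + 1) := by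
  rw [revP, show n - (n - 1 - t) = t + 1 by omega]

theorem revP_apply_sub (ht : t ≤ n) : revP n P Q (n - t) = P n - Q t := by
  rw [revP, show n - (n - t) = t by omega]

theorem revQ_apply_pred (ht : t < n) : revQ n P (n - 1 - t) = P n - P (t + 1) := by
  rw [revQ, show n - (n - 1 - t) = t + 1 by omega]

theorem revQ_apply_sub (ht : t ≤ n) : revQ n P (n - t) = P n - P t := by
  rw [revQ, show n - (n - t) = t by omega]

theorem pat_plane_of_lower (hB : Bounds n P Q) (hn : 2 ≤ n)
    (hd : ∀ j, 0 < j → j < n → Q j < P j) (htn : t < n) (hL : LeftQ Q t)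
    (hR : RightQ n Q t) (h2 : Q t + 2 ≤ P (t + 1))
    (hpinch : ¬ (P (t + 1) = P t + 1 ∧ Q (t + 1) = Q t + 1 ∧ P t = Q t + 1)) :
    Pat n P Q t (Sum.inl (Sum.inr 0)) condPlane := by
  have q1 := hB.Q_le_P_last htn.le
  have q2 := hB.Q_le_P_last (show t + 1 ≤ n from htn)
  have q3 := step_mono hB.P_step htn.le
  have q4 := step_mono hB.P_step (show t + 1 ≤ n from htn)
  have r1 := revP_apply_pred (P := P) (Q := Q) htn
  have r2 := revP_apply_sub (P := P) (Q := Q) htn.le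
  have r3 := revQ_apply_pred (P := P) htn
  have r4 := revQ_apply_sub (P := P) htn.le
  have s : n - 1 - t + 1 = n - t := by omega
  refine Pat.of_rev hB htn (pat_plane_of_left_right hB.rev hn (depth_rev hB hd)
    (leftP_rev hB htn hR) (rightP_rev hB htn hL) ?_ ?_)
  · rw [s]; omega
  · rw [s]; omega

/-- The comparison of the height of `P` at its first turn with that of `Q` after its last one
decides between two constructions: if `Q (l + 1) ≤ P K`, the clone classes at the two ends give `P_m
+ x` directly; otherwise a path can touch `P` at `K` and `Q` at `l + 1`, which gives `m = 2`. -/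
theorem pat_of_upper_lower (hB : Bounds n P Q)
    (hd : ∀ j, 0 < j → j < n → Q j < P j) (htn : t < n) (hL : LeftP P t)
    (hR : RightQ n Q t) (h2 : Q t + 2 ≤ P (t + 1)) :
    ∃ m, 2 ≤ m ∧ Pat n P Q t (Sum.inr 0) (condB m) := by
  obtain ⟨i, K, a1, a2, a3, a4, a5, a6⟩ := hL.exists_first hB
  obtain ⟨l, w, b1, b2, b3, b4, b5, b6, b7⟩ := hR.exists_last hB htn
  rcases le_or_gt (Q (l + 1)) (P K) with h | h
  · exact ⟨P K + 1 - Q l, by omega, pat_condB hB a2 b1 (by omega) a6 a5 a4 b6 b4 h b7 (by omega)⟩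
  · exact ⟨2, le_rfl, pat_condB_two hB hd a1 a2 b1 b2 b3 a3 a4 b4 b5 h.le h2⟩

/-- The dual form of the case that leads to `E_n` and `R_4`. -/
theorem pat_of_upper_lower' (hB : Bounds n P Q)
    (hd : ∀ j, 0 < j → j < n → Q j < P j) (htn : t < n) (hL : LeftP P t)
    (hR : RightQ n Q t) (h2 : Q (t + 1) + 1 ≤ P t)
    (hpinch : ¬ (P (t + 1) = P t ∧ Q (t + 1) = Q t ∧ P t = Q t + 1)) :
    (∃ m, 3 ≤ m ∧ Pat n P Q t (Sum.inr 0) (condB m)) ∨ Pat n P Q t (Sum.inr 0) condR := by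
  obtain ⟨i, K, a1, a2, a3, a4, a5, a6⟩ := hL.exists_first hB
  obtain ⟨l, w, b1, b2, b3, b4, b5, b6, b7⟩ := hR.exists_last hB htn
  have sP := hB.P_step t
  have sQ := hB.Q_step t
  rcases lt_or_ge (Q (l + 1)) (P K) with h | h
  · exact Or.inl ⟨P K + 1 - Q l, by omega,
      pat_condB hB a2 b1 (by omega) a6 a5 a4 b6 b4 h.le b7 (by omega)⟩
  refine Or.inr ?_
  -- The rank-two minor needs a distance of two right before `t`, with `K < t`, or its mirror image
  -- right after `t`, with `t < l`. Excluding parallel east steps at distance one guarantees that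
  -- one of the two holds.
  by_cases h3 : K < t ∧ Q t + 2 ≤ P t
  · exact pat_condR hB hd a1 h3.1 b1 b2 b3 a3 a4 b4 b5 h h3.2
  have h4 : t < l ∧ Q (t + 1) + 2 ≤ P (t + 1) := by
    rcases a2.eq_or_lt with rfl | h5
    · refine ⟨lt_of_le_of_ne b1 fun h6 => ?_, by omega⟩
      rw [← h6] at h; omega
    · refine ⟨lt_of_le_of_ne b1 fun h6 => ?_, by omega⟩
      rw [← h6] at b4; omega
  have s1 := revP_step hB (show n - 1 - w < n by omega)
  have s2 := revP_step hB (show n - 1 - l < n by omega)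
  have s3 := revQ_step hB (show n - 1 - K < n by omega)
  have s4 := revQ_step hB (show n - 1 - i < n by omega)
  rw [show n - 1 - (n - 1 - w) = w by omega] at s1
  rw [show n - 1 - (n - 1 - l) = l by omega] at s2
  rw [show n - 1 - (n - 1 - K) = K by omega] at s3
  rw [show n - 1 - (n - 1 - i) = i by omega] at s4
  have q2 := hB.Q_le_P_last (show t + 1 ≤ n from htn)
  have q4 := step_mono hB.P_step (show t + 1 ≤ n from htn)
  refine Pat.of_rev hB htn (pat_condR hB.rev (depth_rev hB hd) (K := n - 1 - l)
    (l := n - 1 - K) (k₂ := n - 1 - w) (k₃ := n - 1 - i) (by omega) (by omega) (by omega)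
    (by omega) (by omega) (by omega) (by omega) (by omega) (by omega) ?_ ?_)
  · rw [revP_apply_pred (by omega), show n - 1 - K + 1 = n - K by omega,
      revQ_apply_sub (by omega)]
    omega
  · rw [revP_apply_pred htn, revQ_apply_pred htn]; omega

/-- Apart from the pinch, the case is determined by which path turns on each side. Turns of the same
path on both sides give the plane; `P` then `Q` gives `P_m + x`; `Q` then `P` becomes `P` then `Q`
in the dual, whence the complemented conditions. -/
theorem exists_pat (hB : Bounds n P Q) (hn : 2 ≤ n)
    (hd : ∀ j, 0 < j → j < n → Q j < P j) (htn : t < n) (hL : LeftP P t ∨ LeftQ Q t)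
    (hR : RightP n P t ∨ RightQ n Q t) (h2 : Q t + 2 ≤ P (t + 1)) :
    (∃ m, 2 ≤ m ∧ Pat n P Q t (Sum.inr 0) (condB m)) ∨
    (∃ m, 3 ≤ m ∧ Pat n P Q t (Sum.inr 0) (condE m)) ∨
    Pat n P Q t (Sum.inl (Sum.inr 0)) condPlane ∨
    Pat n P Q t (Sum.inr 0) (fun I => condR Iᶜ) := by
  by_cases hpinch : P (t + 1) = P t + 1 ∧ Q (t + 1) = Q t + 1 ∧ P t = Q t + 1
  · exact Or.inl ⟨2, le_rfl, pat_of_pinch hB hn hd htn hL hR hpinch.1 hpinch.2.1 hpinch.2.2⟩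
  rcases hL with hL | hL <;> rcases hR with hR | hR
  · exact Or.inr (Or.inr (Or.inl (pat_plane_of_left_right hB hn hd hL hR h2 hpinch)))
  · exact Or.inl (pat_of_upper_lower hB hd htn hL hR h2)
  · have lP := le_self_of_step hB.P0 hB.P_step
    have lQ := le_self_of_step hB.Q0 hB.Q_step
    have d1 : ∀ j, 0 < j → j < n → dualP P j < dualP Q j := fun j h3 h4 => by
      have := hd j h3 h4
      have := lP j
      simp only [dualP]; omega
    have d2 : LeftP (dualP Q) t := by
      obtain ⟨i, k, h3, h4, h5, h6⟩ := hL
      have := lQ i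
      have := lQ k
      exact ⟨i, k, h3, h4, by simp only [dualP]; omega, by simp only [dualP]; omega⟩
    have d3 : RightQ n (dualP P) t := by
      obtain ⟨l, w, h3, h4, h5, h6, h7⟩ := hR
      have := lP l
      have := lP w
      exact ⟨l, w, h3, h4, h5, by simp only [dualP]; omega, by simp only [dualP]; omega⟩
    have l1 := lP t
    have l2 := lP (t + 1)
    have l3 := lQ t
    have l4 := lQ (t + 1)
    have sP := hB.P_step t
    have sQ := hB.Q_step t
    rcases pat_of_upper_lower' hB.dual d1 htn d2 d3 (by simp only [dualP]; omega)
      (by simp only [dualP]; omega) with ⟨m, hm, h⟩ | h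
    · exact Or.inr (Or.inl ⟨m, hm, (Pat.of_dual hB h).congr condB_compl⟩)
    · exact Or.inr (Or.inr (Or.inr (Pat.of_dual hB h)))
  · exact Or.inr (Or.inr (Or.inl (pat_plane_of_lower hB hn hd htn hL hR h2 hpinch)))

/-- The case of a cut element. -/
theorem pat_of_cut (hB : Bounds n P Q) (hn : 2 ≤ n)
    (hd : ∀ j, 0 < j → j < n → Q j < P j) (ht0 : 0 < t) (htn : t < n)
    (hL : LeftP P t ∨ LeftQ Q t)
    (hR : RightP n P t ∨ RightQ n Q t) (h1 : P (t + 1) = Q t + 1) :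
    Pat n P Q t (Sum.inr 0) (condE 2) := by
  obtain ⟨e1, e2, e3, e4⟩ := hB.ends hn hd
  have hn1 : n - 1 + 1 = n := by omega
  have hEn := hB.eq_n
  have sP := hB.P_step t
  have sQ := hB.Q_step t
  have hdt := hd t ht0 htn
  have htn' : t + 1 < n := by
    by_contra hc
    obtain rfl : t = n - 1 := by omega
    rcases hR with ⟨l, w, h1, h2, h3, h4, h5⟩ | ⟨l, w, h1, h2, h3, h4, h5⟩ <;> omega
  have hdt' := hd (t + 1) (by omega) htn'
  -- `P` must have a second north step before `t`, besides the one at `0`. For a left turn of `Q`,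
  -- this follows from `Q t ≥ 1` and `Q t < P t`.
  have hPt : 2 ≤ P t := by
    rcases hL with ⟨i, k, h1, h2, h3, h4⟩ | ⟨i, k, h1, h2, h3, h4⟩
    · have hkt : k ≠ t := fun h => by subst h; omega
      have hi0 : i ≠ 0 := fun h => by
        subst h; have := hB.P0; simp only [zero_add] at h3; omega
      have q1 := step_mono hB.P_step (show 1 ≤ k by omega)
      have q2 : P (k + 1) ≤ P t := step_mono hB.P_step (by omega)
      omega
    · have q1 : Q (i + 1) ≤ Q t := step_mono hB.Q_step (by omega)
      omega
  have hPr : P (t + 1) < P n := by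
    rcases hR with ⟨l, w, h1, h2, h3, h4, h5⟩ | ⟨l, w, h1, h2, h3, h4, h5⟩
    · have q1 : P (t + 1) ≤ P w := step_mono hB.P_step (by omega)
      have q2 : P (w + 1) ≤ P n := step_mono hB.P_step (by omega)
      omega
    · have hlt : l ≠ t := fun h => by subst h; omega
      have hwn : w ≠ n - 1 := fun h => by subst h; rw [hn1] at h5; omega
      have q1 : Q (t + 1) ≤ Q l := step_mono hB.Q_step (by omega)
      have q2 : Q (l + 1) ≤ Q (n - 1) := step_mono hB.Q_step (by omega)
      omega
  obtain ⟨k, k1, k2, k3⟩ := exists_north_step hB.P_step (show 1 ≤ t by omega) (by omega)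
  obtain ⟨w, w1, w2, w3⟩ := exists_north_step hB.P_step (show t + 1 ≤ n by omega) hPr
  have hwn : w ≠ n - 1 := fun h => by subst h; rw [hn1] at w3; omega
  exact pat_condE_two hB hd (n₁ := 0) (n₂ := k) (n₃ := w) (k := n - 1) (by omega) k2 (by omega)
    (by omega) (by omega) (by rw [hB.P0]; exact e1) k3 (by omega) w3 (by rw [hn1, e3])
    (by omega) (by omega)

end LatticePath

namespace LatticePath

/-! ### From positions to minors -/

/-- The minor contracts `C` and deletes what is outside the image of `f`. The hypothesis for `I = ∅`
makes `C` independent, so independence in the contraction is independence together with `C`. -/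
theorem hasMinorIso_of_indep_iff {α β : Type*} {M : Matroid α} {N : Matroid β} {C : Set α}
    {f : β → α} (hf : Function.Injective f) (hfE : ∀ b, f b ∈ M.E ∧ f b ∉ C) (hNE : N.E = univ)
    (h : ∀ I, N.Indep I ↔ M.Indep (f '' I ∪ C)) : M.HasMinorIso N := by
  have hC : M.Indep C := by simpa using (h ∅).1 N.empty_indep
  refine ⟨f, hf.injOn, C, (range f)ᶜ, Matroid.ext_indep ?_ fun I hI => ?_⟩
  · ext a
    simp only [Matroid.map_ground, hNE, image_univ, Matroid.delete_ground,
      Matroid.contract_ground, mem_sdiff, mem_compl_iff, not_not]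
    refine ⟨?_, fun ha => ha.2⟩
    rintro ⟨b, rfl⟩
    exact ⟨hfE b, b, rfl⟩
  · rw [Matroid.map_indep_iff, Matroid.delete_indep_iff, hC.contract_indep_iff]
    constructor
    · rintro ⟨J, hJ, rfl⟩
      refine ⟨⟨?_, (h J).1 hJ⟩, ?_⟩
      · rw [Set.disjoint_left]; rintro _ ⟨b, -, rfl⟩; exact (hfE b).2
      · exact disjoint_compl_right_iff_subset.2 (image_subset_range _ _)
    · rintro ⟨⟨-, h1⟩, h2⟩
      obtain ⟨J, rfl⟩ := subset_range_iff_exists_image_eq.1 (disjoint_compl_right_iff_subset.1 h2)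
      exact ⟨J, (h J).2 h1, rfl⟩

/-- An independent set containing the contracted part extends to a basis inside its union with a
basis of the prescribed form, and the result again has this form. The existence of one set with
`cond` supplies the basis to extend by. -/
theorem PathRep.indep_iff_exists_of_pat {α : Type*} {M : Matroid α} {n : ℕ} {e : ℕ → α}
    {P Q : ℕ → ℕ} (hM : PathRep M n e P Q) {γ : Type} {φ : γ → ℕ} {C : Set ℕ}
    (hφC : ∀ b, φ b < n ∧ φ b ∉ C) (hC : C ⊆ Iio n) {cond : Set γ → Prop}
    (hcond : ∀ I, Good n P Q (φ '' I ∪ C) ↔ cond I) (hex : ∃ I, cond I) (I : Set γ) :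
    M.Indep (e '' (φ '' I ∪ C)) ↔ ∃ J, I ⊆ J ∧ cond J := by
  have hsub : ∀ J : Set γ, φ '' J ∪ C ⊆ Iio n := fun J => by
    refine union_subset ?_ hC
    rintro _ ⟨b, -, rfl⟩; exact (hφC b).1
  have hbase : ∀ J, M.IsBase (e '' (φ '' J ∪ C)) ↔ cond J := fun J => by
    rw [← hcond, hM.isBase_image_iff (hsub J)]
  constructor
  · intro h
    obtain ⟨I₀, hI₀⟩ := hex
    obtain ⟨B, hB, hIB, hBI⟩ := h.exists_isBase_subset_union_isBase ((hbase I₀).2 hI₀)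
    rw [← image_union] at hBI
    have hT : B = e '' (φ '' {b | e (φ b) ∈ B} ∪ C) := by
      refine subset_antisymm (fun a ha => ?_) ?_
      · obtain ⟨j, hj, rfl⟩ := hBI ha
        rcases hj with (⟨b, -, rfl⟩ | hj) | (⟨b, -, rfl⟩ | hj)
        · exact ⟨_, Or.inl ⟨b, ha, rfl⟩, rfl⟩
        · exact ⟨_, Or.inr hj, rfl⟩
        · exact ⟨_, Or.inl ⟨b, ha, rfl⟩, rfl⟩
        · exact ⟨_, Or.inr hj, rfl⟩
      · rintro _ ⟨j, ⟨b, hb, rfl⟩ | hj, rfl⟩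
        · exact hb
        · exact hIB ⟨_, Or.inr hj, rfl⟩
    exact ⟨_, fun b hb => hIB ⟨_, Or.inl ⟨b, hb, rfl⟩, rfl⟩, (hbase _).1 (hT ▸ hB)⟩
  · rintro ⟨J, hIJ, hJ⟩
    exact ((hbase J).2 hJ).indep.subset (image_mono (union_subset_union_left _ (image_mono hIJ)))

theorem PathRep.indep_iff_of_pat {α β : Type*} {M : Matroid α} {n : ℕ} {e : ℕ → α} {P Q : ℕ → ℕ}
    (hM : PathRep M n e P Q) {γ : Type} {φ : γ → ℕ} {C : Set ℕ}
    (hφC : ∀ b, φ b < n ∧ φ b ∉ C) (hC : C ⊆ Iio n) {cond : Set γ → Prop}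
    (hcond : ∀ I, Good n P Q (φ '' I ∪ C) ↔ cond I) {N : Matroid β} {ι : γ → β}
    (hι : Function.Injective ι) (hN : ∀ I, N.IsBase (ι '' I) ↔ cond I) (hex : ∃ I, cond I)
    (I : Set γ) : N.Indep (ι '' I) ↔ M.Indep (e '' (φ '' I ∪ C)) := by
  rw [hM.indep_iff_exists_of_pat hφC hC hcond hex]
  constructor
  · intro h
    obtain ⟨I₀, hI₀⟩ := hex
    obtain ⟨B, hB, hIB, hBI⟩ := h.exists_isBase_subset_union_isBase ((hN I₀).2 hI₀)
    rw [← image_union] at hBI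
    obtain ⟨J, rfl⟩ := subset_range_iff_exists_image_eq.1 (hBI.trans (image_subset_range _ _))
    exact ⟨J, (image_subset_image_iff hι).1 hIB, (hN J).1 hB⟩
  · rintro ⟨J, hIJ, hJ⟩
    exact ((hN J).2 hJ).indep.subset (image_mono hIJ)

section Parallel

variable {α : Type*} {M₁ M₂ : Matroid α} {x : α}

/-- `C` is a circuit through `x` and `y` without these two elements; contracting it makes `x` and
`y` parallel. -/
theorem exists_parallel (hc : M₂.IsConnected) (hx : x ∈ M₂.E) (hE : M₂.E.Nontrivial) :
    ∃ y C, y ∈ M₂.E ∧ y ≠ x ∧ C ⊆ M₂.E ∧ x ∉ C ∧ y ∉ C ∧ M₂.Indep (insert x C) ∧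
      M₂.Indep (insert y C) ∧ ¬ M₂.Indep (insert x (insert y C)) := by
  obtain ⟨y, hy, hyx⟩ := hE.exists_ne x
  obtain ⟨K, hK, hxK, hyK⟩ := hc x hx y hy hyx.symm
  have e1 : insert x (K \ {x, y}) = K \ {y} := by
    ext a; by_cases h : a = x <;> simp [h, hxK, hyx.symm]
  have e2 : insert y (K \ {x, y}) = K \ {x} := by
    ext a; by_cases h : a = y <;> simp [h, hyK, hyx]
  refine ⟨y, K \ {x, y}, hy, hyx, sdiff_subset.trans hK.subset_ground, by simp, by simp, ?_, ?_, ?_⟩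
  · rw [e1]; exact hK.sdiff_singleton_indep hyK
  · rw [e2]; exact hK.sdiff_singleton_indep hxK
  · rw [e2, insert_sdiff_singleton, insert_eq_of_mem hxK]; exact hK.not_indep

/-- If every circuit through `x` had at most two elements, connectedness would put the ground set
into the closure of `x`, against the rank. A larger circuit, with all but three elements contracted,
becomes a triangle. -/
theorem exists_triangle (hc : M₂.IsConnected) (hx : x ∈ M₂.E) (hr : 1 < M₂.eRank) :
    ∃ y z C, y ∈ M₂.E ∧ z ∈ M₂.E ∧ y ≠ x ∧ z ≠ x ∧ y ≠ z ∧ C ⊆ M₂.E ∧ x ∉ C ∧ y ∉ C ∧ z ∉ C ∧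
      M₂.Indep (insert x (insert y C)) ∧ M₂.Indep (insert x (insert z C)) ∧
      M₂.Indep (insert y (insert z C)) ∧ ¬ M₂.Indep (insert x (insert y (insert z C))) := by
  have hK : ∃ K, M₂.IsCircuit K ∧ x ∈ K ∧ ∃ y ∈ K, ∃ z ∈ K, y ≠ x ∧ z ≠ x ∧ y ≠ z := by
    by_contra! hcon
    have hcl : M₂.E ⊆ M₂.closure {x} := by
      intro y hy
      by_cases hyx : y = x
      · subst hyx; exact M₂.mem_closure_of_mem rfl (by simpa using hx)
      obtain ⟨K, hK, hxK, hyK⟩ := hc x hx y hy (Ne.symm hyx)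
      have hKeq : K \ {y} ⊆ {x} := by
        intro z hz
        by_contra hzx
        exact hz.2 (hcon K hK hxK y hyK z hz.1 hyx hzx).symm
      exact M₂.closure_subset_closure hKeq (hK.mem_closure_sdiff_singleton_of_mem hyK)
    have h1 : M₂.eRank ≤ 1 := by
      rw [← M₂.eRk_ground, ← encard_singleton x]
      calc M₂.eRk M₂.E ≤ M₂.eRk (M₂.closure {x}) := M₂.eRk_mono hcl
        _ = M₂.eRk {x} := M₂.eRk_closure_eq _
        _ ≤ _ := M₂.eRk_le_encard _
    exact absurd hr (not_lt.2 h1)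
  obtain ⟨K, hK, hxK, y, hyK, z, hzK, hyx, hzx, hyz⟩ := hK
  have e1 : insert x (insert y (K \ {x, y, z})) = K \ {z} := by
    ext a; by_cases h : a = x <;> by_cases h' : a = y <;>
      simp_all [Ne.symm hyx, Ne.symm hzx]
  have e2 : insert x (insert z (K \ {x, y, z})) = K \ {y} := by
    ext a; by_cases h : a = x <;> by_cases h' : a = z <;>
      simp_all [Ne.symm hyx, Ne.symm hzx, Ne.symm hyz]
  have e3 : insert y (insert z (K \ {x, y, z})) = K \ {x} := by
    ext a; by_cases h : a = y <;> by_cases h' : a = z <;>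
      simp_all [Ne.symm hyz]
  refine ⟨y, z, K \ {x, y, z}, hK.subset_ground hyK, hK.subset_ground hzK, hyx, hzx, hyz,
    sdiff_subset.trans hK.subset_ground, by simp, by simp, by simp, ?_, ?_, ?_, ?_⟩
  · rw [e1]; exact hK.sdiff_singleton_indep hzK
  · rw [e2]; exact hK.sdiff_singleton_indep hyK
  · rw [e3]; exact hK.sdiff_singleton_indep hxK
  · rw [e3, insert_sdiff_singleton, insert_eq_of_mem hxK]; exact hK.not_indep

/-- Contracting `C` leaves `M₁` unchanged, because `C` does not span `x` in `M₂`. -/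
theorem parallelIndep_union_iff (hx : M₁.E ∩ M₂.E = {x}) {C : Set α} (hC : C ⊆ M₂.E)
    (hxC : x ∉ C) (hiC : M₂.Indep (insert x C)) {J : Set α} (hJ : J ⊆ M₁.E) :
    Matroid.ParallelIndep M₁ M₂ x (J ∪ C) ↔ M₁.Indep J := by
  have hx2 : x ∈ M₂.E := (hx.symm.subset rfl).2
  have hmem : ∀ a ∈ M₁.E, a ∈ M₂.E → a = x := fun a h1 h2 => hx.subset ⟨h1, h2⟩
  have e1 : (J ∪ C) ∩ M₁.E = J := by
    ext a
    refine ⟨?_, fun h => ⟨Or.inl h, hJ h⟩⟩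
    rintro ⟨h | h, h'⟩
    · exact h
    · exact absurd (hmem a h' (hC h) ▸ h) hxC
  have e2 : insert x ((J ∪ C) ∩ M₂.E) = insert x C := by
    ext a
    constructor
    · rintro (h | ⟨h | h, h'⟩)
      · exact Or.inl h
      · exact Or.inl (hmem a (hJ h) h')
      · exact Or.inr h
    · rintro (h | h)
      · exact Or.inl h
      · exact Or.inr ⟨Or.inr h, hC h⟩
  rw [Matroid.ParallelIndep, e1, e2]
  refine ⟨fun h => h.2.1, fun h => ⟨union_subset_union hJ hC, h, ?_, Or.inr (Or.inl hiC)⟩⟩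
  exact hiC.subset (e2 ▸ subset_insert _ _)

/-- After `C` is contracted, `y` is a second copy of `x`: it can only be used without `x`, and it
then imposes on `M₁` the same requirement as `x`. -/
theorem parallelIndep_insert_union_iff (hx : M₁.E ∩ M₂.E = {x}) {C : Set α} {y : α}
    (hy : y ∈ M₂.E) (hyx : y ≠ x) (hC : C ⊆ M₂.E) (hxC : x ∉ C) (hiC : M₂.Indep (insert x C))
    (hiy : M₂.Indep (insert y C)) (hdep : ¬ M₂.Indep (insert x (insert y C))) {J : Set α}
    (hJ : J ⊆ M₁.E) : Matroid.ParallelIndep M₁ M₂ x (insert y J ∪ C) ↔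
      x ∉ J ∧ M₁.Indep (insert x J) := by
  have hx2 : x ∈ M₂.E := (hx.symm.subset rfl).2
  have hmem : ∀ a ∈ M₁.E, a ∈ M₂.E → a = x := fun a h1 h2 => hx.subset ⟨h1, h2⟩
  have e1 : (insert y J ∪ C) ∩ M₁.E = J := by
    ext a
    refine ⟨?_, fun h => ⟨Or.inl (Or.inr h), hJ h⟩⟩
    rintro ⟨(rfl | h) | h, h'⟩
    · exact absurd (hmem a h' hy) hyx
    · exact h
    · exact absurd (hmem a h' (hC h) ▸ h) hxC
  have e2 : (insert y J ∪ C) ∩ M₂.E = insert y ((J ∩ {x}) ∪ C) := by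
    ext a
    constructor
    · rintro ⟨(h | h) | h, h'⟩
      · exact Or.inl h
      · exact Or.inr (Or.inl ⟨h, hmem a (hJ h) h'⟩)
      · exact Or.inr (Or.inr h)
    · rintro (rfl | ⟨h, rfl⟩ | h)
      · exact ⟨Or.inl (Or.inl rfl), hy⟩
      · exact ⟨Or.inl (Or.inr h), hx2⟩
      · exact ⟨Or.inr h, hC h⟩
  rw [Matroid.ParallelIndep, e1, e2]
  by_cases hxJ : x ∈ J
  · refine iff_of_false (fun h => hdep ?_) (fun h => h.1 hxJ)
    have := h.2.2.1
    rwa [inter_eq_right.2 (singleton_subset_iff.2 hxJ), singleton_union, insert_comm] at this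
  · rw [inter_singleton_eq_empty.2 hxJ, empty_union]
    constructor
    · rintro ⟨-, -, -, h | h | h⟩
      · exact ⟨hxJ, h⟩
      · exact absurd h hdep
      · exact absurd hiC (h.2.not_indep_of_mem (mem_insert _ _))
    · rintro ⟨-, h⟩
      refine ⟨?_, h.subset (subset_insert _ _), hiy, Or.inl h⟩
      exact union_subset (insert_subset (Or.inr hy) (hJ.trans subset_union_left))
        (hC.trans subset_union_right)

/-- A minor of `M₁` that contains `x` yields a minor of the parallel connection in which `x` is
doubled. -/
theorem PathRep.hasMinorIso_parallelConnection [M₁.Finite] [M₂.Finite]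
    (hx : M₁.E ∩ M₂.E = {x}) (hc : M₂.IsConnected) (hE : M₂.E.Nontrivial) {n : ℕ} {e : ℕ → α}
    {P Q : ℕ → ℕ} (hM : PathRep M₁ n e P Q) {t : ℕ} (het : e t = x) {β γ : Type}
    {x₀ : γ} {cond : Set γ → Prop} (hpat : Pat n P Q t x₀ cond) {N : Matroid β} (hNE : N.E = univ)
    {ι : γ → β} (hι : Function.Injective ι) {y₀ : β} (hy₀ : y₀ ∉ range ι)
    (hr : ∀ z, z = y₀ ∨ z ∈ range ι) (hN : ∀ I, N.IsBase (ι '' I) ↔ cond I) (hex : ∃ I, cond I)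
    (hpar : ∀ B, N.IsBase B → ι x₀ ∈ B → y₀ ∉ B)
    (hpar' : ∀ J, ι x₀ ∉ J → y₀ ∉ J → (N.IsBase (insert y₀ J) ↔ N.IsBase (insert (ι x₀) J))) :
    (Matroid.parallelConnection M₁ M₂ x hx).HasMinorIso N := by
  classical
  obtain ⟨φ, C, h1, h2, h3, h4, h5⟩ := hpat
  have hx2 : x ∈ M₂.E := (hx.symm.subset rfl).2
  have hmem : ∀ a ∈ M₁.E, a ∈ M₂.E → a = x := fun a h1 h2 => hx.subset ⟨h1, h2⟩
  obtain ⟨y, C₂, hy, hyx, hC₂, hxC₂, hyC₂, i1, i2, i3⟩ := exists_parallel hc hx2 hE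
  have key := hM.indep_iff_of_pat h3 h4 h5 hι hN hex
  have hsub : ∀ J : Set γ, φ '' J ∪ C ⊆ Iio n := fun J => by
    refine union_subset ?_ h4
    rintro _ ⟨b, -, rfl⟩; exact (h3 b).1
  have hsubE : ∀ J : Set γ, e '' (φ '' J ∪ C) ⊆ M₁.E := fun J =>
    (image_mono (hsub J)).trans hM.ground.subset
  have heC : ∀ b, e (φ b) ∉ e '' C := by
    rintro b ⟨j, hj, hje⟩
    have := hM.injOn (h4 hj) (h3 b).1 hje
    exact (h3 b).2 (this ▸ hj)
  have heE : ∀ b, e (φ b) ∈ M₁.E := fun b => hM.mem_ground (h3 b).1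
  have hy1 : y ∉ M₁.E := fun h => hyx (hmem y h hy)
  -- The two hypotheses on bases say that `y₀` and `ι x₀` are parallel in `N`; here this is
  -- transferred to independent sets.
  have hpar'' : ∀ J, y₀ ∉ J → (N.Indep (insert y₀ J) ↔ ι x₀ ∉ J ∧ N.Indep (insert (ι x₀) J)) := by
    intro J hJ
    have hne : ι x₀ ≠ y₀ := fun h => hy₀ ⟨x₀, h⟩
    constructor
    · intro h
      obtain ⟨B, hB, hJB⟩ := h.exists_isBase_superset
      have hyB : y₀ ∈ B := hJB (mem_insert _ _)
      have hxB : ι x₀ ∉ B := fun h => hpar B hB h hyB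
      refine ⟨fun hm => hxB (hJB (Or.inr hm)), ?_⟩
      have h6 := hpar' (B \ {y₀}) (fun h => hxB h.1) (by simp)
      rw [insert_sdiff_singleton, insert_eq_of_mem hyB] at h6
      exact (h6.1 hB).indep.subset (insert_subset_insert
        (subset_sdiff_singleton ((subset_insert _ _).trans hJB) hJ))
    · rintro ⟨hxJ, h⟩
      obtain ⟨B, hB, hJB⟩ := h.exists_isBase_superset
      have hxB : ι x₀ ∈ B := hJB (mem_insert _ _)
      have hyB : y₀ ∉ B := hpar B hB hxB
      have h6 := hpar' (B \ {ι x₀}) (by simp) (fun h => hyB h.1)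
      rw [insert_sdiff_singleton, insert_eq_of_mem hxB] at h6
      exact (h6.2 hB).indep.subset (insert_subset_insert
        (subset_sdiff_singleton ((subset_insert _ _).trans hJB) hxJ))
  -- The default value `y` is used exactly at `y₀`, the only element outside the range of `ι`.
  set f : β → α := fun z => if h : ∃ b, ι b = z then e (φ h.choose) else y with hf
  have hfι : ∀ b, f (ι b) = e (φ b) := fun b => by
    have h : ∃ b', ι b' = ι b := ⟨b, rfl⟩
    rw [hf]; simp only [h, dif_pos]; rw [hι h.choose_spec]
  have hfy : f y₀ = y := by
    have h : ¬ ∃ b', ι b' = y₀ := hy₀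
    rw [hf]; simp only [h, dif_neg, not_false_iff]
  have hfim : ∀ J, f '' (ι '' J) = e '' (φ '' J) := fun J => by
    simp only [image_image, hfι]
  have hinj : Function.Injective f := by
    intro a b hab
    rcases hr a with rfl | ⟨a, rfl⟩ <;> rcases hr b with rfl | ⟨b, rfl⟩
    · rfl
    · rw [hfy, hfι] at hab; exact absurd (hab ▸ heE b) hy1
    · rw [hfy, hfι] at hab; exact absurd (hab ▸ heE a) hy1
    · rw [hfι, hfι] at hab
      rw [h1 (hM.injOn (h3 a).1 (h3 b).1 hab)]
  refine hasMinorIso_of_indep_iff (C := e '' C ∪ C₂) hinj (fun b => ?_) hNE fun I => ?_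
  · rcases hr b with rfl | ⟨b, rfl⟩
    · rw [hfy]
      refine ⟨Or.inr hy, ?_⟩
      rintro (⟨j, hj, rfl⟩ | h)
      · exact hy1 (hM.mem_ground (h4 hj))
      · exact hyC₂ h
    · rw [hfι]
      refine ⟨Or.inl (heE b), ?_⟩
      rintro (h | h)
      · exact heC b h
      · exact hxC₂ (hmem _ (heE b) (hC₂ h) ▸ h)
  · rw [Matroid.parallelConnection_indep_iff, ← union_assoc]
    by_cases hyI : y₀ ∈ I
    · obtain ⟨J, hJ⟩ : ∃ J, ι '' J = I \ {y₀} := subset_range_iff_exists_image_eq.1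
        (fun z hz => (hr z).resolve_left hz.2)
      have hI : I = insert y₀ (ι '' J) := by
        rw [hJ, insert_sdiff_singleton, insert_eq_of_mem hyI]
      rw [hI, hpar'' _ (by rw [hJ]; simp), image_insert_eq, hfy, hfim, insert_union, ← image_union,
        parallelIndep_insert_union_iff hx hy hyx hC₂ hxC₂ i1 i2 i3 (hsubE J), hι.mem_set_image,
        ← image_insert_eq, key, ← het, ← h2, ← image_insert_eq, image_insert_eq (f := φ),
        insert_union]
      refine and_congr_left fun _ => not_congr ⟨fun h => ⟨_, Or.inl ⟨x₀, h, rfl⟩, rfl⟩, ?_⟩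
      rintro ⟨j, hj, hje⟩
      have := hM.injOn (hsub J hj) (h3 x₀).1 hje
      subst this
      rcases hj with ⟨b, hb, hbx⟩ | hj
      · rwa [← h1 hbx]
      · exact absurd hj (h3 x₀).2
    · obtain ⟨J, rfl⟩ : ∃ J, ι '' J = I := subset_range_iff_exists_image_eq.1
        (fun z hz => (hr z).resolve_left (fun h => hyI (h ▸ hz)))
      rw [hfim, ← image_union, parallelIndep_union_iff hx hC₂ hxC₂ i1 (hsubE J), key]

end Parallel

end LatticePath

namespace LatticePath

/-! ### The bases of the excluded minors -/

theorem isBase_iff_of_ncard {β : Type*} [Finite β] {N : Matroid β} {k : ℕ}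
    (hle : ∀ I, N.Indep I → I.ncard ≤ k) (h0 : ∃ I, N.Indep I ∧ I.ncard = k) (B : Set β) :
    N.IsBase B ↔ N.Indep B ∧ B.ncard = k := by
  obtain ⟨I, hI, rfl⟩ := h0
  have hb : ∀ J, N.Indep J → J.ncard = I.ncard → N.IsBase J := by
    intro J hJ hJc
    obtain ⟨B', hB', hJB⟩ := hJ.exists_isBase_superset
    rwa [eq_of_subset_of_ncard_le hJB (by rw [hJc]; exact hle _ hB'.indep) (toFinite _)]
  refine ⟨fun h => ⟨h.indep, h.ncard_eq_ncard_of_isBase (hb I hI rfl)⟩, fun h => hb B h.1 h.2⟩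

theorem unif_indep_iff (k n : ℕ) (I : Set (Fin n)) : (Matroid.unif k n).Indep I ↔ I.ncard ≤ k := by
  rw [Matroid.unif, Matroid.uniformOnSet, Matroid.truncation_indep_iff, Matroid.freeOn_indep_iff,
    ← (toFinite I).cast_ncard_eq, Nat.cast_le, and_iff_right (subset_univ I)]

theorem sum_ground_eq_univ {β γ : Type*} {M : Matroid β} {N : Matroid γ} (hM : M.E = univ)
    (hN : N.E = univ) : (M.sum N).E = univ := by
  rw [Matroid.sum_ground, hM, hN]; simp

theorem ncard_sum {β γ : Type*} [Finite β] [Finite γ] (I : Set (β ⊕ γ)) :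
    I.ncard = (Sum.inl ⁻¹' I).ncard + (Sum.inr ⁻¹' I).ncard := by
  conv_lhs => rw [← image_preimage_inl_union_image_preimage_inr I]
  rw [ncard_union_eq disjoint_image_inl_image_inr (toFinite _) (toFinite _),
    ncard_image_of_injective _ Sum.inl_injective, ncard_image_of_injective _ Sum.inr_injective]

theorem truncation_indep_iff_ncard {β : Type*} [Finite β] (M : Matroid β) (k : ℕ) (I : Set β) :
    (M.truncation k).Indep I ↔ M.Indep I ∧ I.ncard ≤ k := by
  rw [Matroid.truncation_indep_iff, ← (toFinite I).cast_ncard_eq, Nat.cast_le]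

theorem exists_preimage_eq {β γ : Type*} (A : Set β) (B : Set γ) :
    ∃ I : Set (β ⊕ γ), Sum.inl ⁻¹' I = A ∧ Sum.inr ⁻¹' I = B :=
  ⟨{z | Sum.elim (· ∈ A) (· ∈ B) z}, rfl, rfl⟩

theorem exists_ncard_eq {m a : ℕ} (h : a ≤ m) : ∃ A : Set (Fin m), A.ncard = a := by
  obtain ⟨A, -, hA⟩ := Set.exists_subset_card_eq (s := (univ : Set (Fin m))) (n := a)
    (by simpa using h)
  exact ⟨A, hA⟩

theorem blk_image {β β' γ : Type*} {ι : β → β'} (hι : Function.Injective ι) (g' : γ → β')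
    (g : γ → β) (h : ∀ c, ι (g c) = g' c) (I : Set β) : blk g' (ι '' I) = blk g I := by
  unfold blk
  congr 1
  ext c
  rw [mem_preimage, mem_preimage, ← h, hι.mem_set_image]

theorem blk_insert {β γ : Type*} {g : γ → β} {y : β} (h : y ∉ range g) (J : Set β) :
    blk g (insert y J) = blk g J := by
  unfold blk
  congr 1
  ext c
  exact or_iff_right fun hc => h ⟨c, hc⟩

theorem blk_le {m : ℕ} {β : Type*} (g : Fin m → β) (I : Set β) : blk g I ≤ m := by
  have := blk_compl (g := g) I; omega

theorem exists_blocks₃ {m k : ℕ} {a b c : ℕ} (ha : a ≤ m) (hb : b ≤ m) (hc : c ≤ k) :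
    ∃ I : Set ((Fin m ⊕ Fin m) ⊕ Fin k), blk (Sum.inl ∘ Sum.inl) I = a ∧
      blk (Sum.inl ∘ Sum.inr) I = b ∧ blk Sum.inr I = c := by
  obtain ⟨A, rfl⟩ := exists_ncard_eq ha
  obtain ⟨B, rfl⟩ := exists_ncard_eq hb
  obtain ⟨C, rfl⟩ := exists_ncard_eq hc
  obtain ⟨I, hI, hI'⟩ := exists_preimage_eq A B
  obtain ⟨J, rfl, rfl⟩ := exists_preimage_eq I C
  obtain ⟨rfl, rfl⟩ : Sum.inl ⁻¹' _ = A ∧ Sum.inr ⁻¹' _ = B := ⟨hI, hI'⟩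
  exact ⟨J, rfl, rfl, rfl⟩

theorem exists_blocks₄ {m m' j k : ℕ} {a b c d : ℕ} (ha : a ≤ m) (hb : b ≤ m') (hc : c ≤ j)
    (hd : d ≤ k) : ∃ I : Set (((Fin m ⊕ Fin m') ⊕ Fin j) ⊕ Fin k),
      blk (Sum.inl ∘ Sum.inl ∘ Sum.inl) I = a ∧ blk (Sum.inl ∘ Sum.inl ∘ Sum.inr) I = b ∧
      blk (Sum.inl ∘ Sum.inr) I = c ∧ blk Sum.inr I = d := by
  obtain ⟨A, rfl⟩ := exists_ncard_eq ha
  obtain ⟨B, rfl⟩ := exists_ncard_eq hb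
  obtain ⟨C, rfl⟩ := exists_ncard_eq hc
  obtain ⟨D, rfl⟩ := exists_ncard_eq hd
  obtain ⟨I, rfl, rfl⟩ := exists_preimage_eq A B
  obtain ⟨J, rfl, rfl⟩ := exists_preimage_eq I C
  obtain ⟨K, rfl, rfl⟩ := exists_preimage_eq J D
  exact ⟨K, rfl, rfl, rfl, rfl⟩

theorem ncard_eq_blk₃ {β γ δ : Type*} [Finite β] [Finite γ] [Finite δ] (I : Set ((β ⊕ γ) ⊕ δ)) :
    I.ncard = blk (Sum.inl ∘ Sum.inl) I + blk (Sum.inl ∘ Sum.inr) I + blk Sum.inr I := by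
  rw [ncard_sum, ncard_sum]; rfl

theorem ncard_eq_blk₄ {β γ δ ε : Type*} [Finite β] [Finite γ] [Finite δ] [Finite ε]
    (I : Set (((β ⊕ γ) ⊕ δ) ⊕ ε)) :
    I.ncard = blk (Sum.inl ∘ Sum.inl ∘ Sum.inl) I + blk (Sum.inl ∘ Sum.inl ∘ Sum.inr) I +
      blk (Sum.inl ∘ Sum.inr) I + blk Sum.inr I := by
  rw [ncard_sum, ncard_sum, ncard_sum]; rfl

theorem matB_ground (m k : ℕ) : (Matroid.matB m k).E = univ :=
  sum_ground_eq_univ (sum_ground_eq_univ rfl rfl) rfl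

theorem matB_indep_iff (m k : ℕ) (I : Set ((Fin m ⊕ Fin m) ⊕ Fin k)) :
    (Matroid.matB m k).Indep I ↔ (blk (Sum.inl ∘ Sum.inl) I ≤ m - 1 ∧
      blk (Sum.inl ∘ Sum.inr) I ≤ m - 1 ∧ blk Sum.inr I ≤ k - 1) ∧
      blk (Sum.inl ∘ Sum.inl) I + blk (Sum.inl ∘ Sum.inr) I + blk Sum.inr I ≤ m := by
  rw [Matroid.matB, truncation_indep_iff_ncard, ncard_eq_blk₃, Matroid.sum_indep_iff,
    Matroid.sum_indep_iff, unif_indep_iff, unif_indep_iff, unif_indep_iff]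
  simp only [blk, preimage_comp]
  omega

theorem matB_isBase_iff {m k : ℕ} (hm : 2 ≤ m) (B : Set ((Fin m ⊕ Fin m) ⊕ Fin k)) :
    (Matroid.matB m k).IsBase B ↔ blk (Sum.inl ∘ Sum.inl) B ≤ m - 1 ∧
      blk (Sum.inl ∘ Sum.inr) B ≤ m - 1 ∧ blk Sum.inr B ≤ k - 1 ∧
      blk (Sum.inl ∘ Sum.inl) B + blk (Sum.inl ∘ Sum.inr) B + blk Sum.inr B = m := by
  rw [isBase_iff_of_ncard (k := m), matB_indep_iff, ncard_eq_blk₃]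
  · omega
  · intro I hI
    rw [ncard_eq_blk₃]; exact ((matB_indep_iff m k I).1 hI).2
  · obtain ⟨I, h1, h2, h3⟩ := exists_blocks₃ (m := m) (k := k) (a := m - 1) (b := 1) (c := 0)
      (by omega) (by omega) (by omega)
    refine ⟨I, ?_, ?_⟩
    · rw [matB_indep_iff, h1, h2, h3]; omega
    · rw [ncard_eq_blk₃, h1, h2, h3]; omega

theorem matP_indep_iff (m : ℕ) (I : Set (Fin m ⊕ Fin m)) :
    (Matroid.matP m).Indep I ↔ (blk Sum.inl I ≤ m - 1 ∧ blk Sum.inr I ≤ m - 1) ∧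
      blk Sum.inl I + blk Sum.inr I ≤ m := by
  rw [Matroid.matP, truncation_indep_iff_ncard, ncard_sum, Matroid.sum_indep_iff, unif_indep_iff,
    unif_indep_iff]
  rfl

theorem matP_sum_indep_iff (m : ℕ) (I : Set (TwoBlocks m)) :
    ((Matroid.matP m).sum (Matroid.unif 1 1)).Indep I ↔ blk (Sum.inl ∘ Sum.inl) I ≤ m - 1 ∧
      blk (Sum.inl ∘ Sum.inr) I ≤ m - 1 ∧
      blk (Sum.inl ∘ Sum.inl) I + blk (Sum.inl ∘ Sum.inr) I ≤ m := by
  have := blk_le Sum.inr I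
  rw [Matroid.sum_indep_iff, matP_indep_iff, unif_indep_iff]
  simp only [blk, preimage_comp] at *
  omega

theorem eRank_matP_sum {m : ℕ} (hm : 2 ≤ m) :
    ((Matroid.matP m).sum (Matroid.unif 1 1)).eRank.toNat = m + 1 := by
  obtain ⟨I, h1, h2, h3⟩ := exists_blocks₃ (m := m) (k := 1) (a := m - 1) (b := 1) (c := 1)
    (by omega) (by omega) (by omega)
  have hI : ((Matroid.matP m).sum (Matroid.unif 1 1)).IsBase I := by
    have hI1 : I.ncard = m + 1 := by rw [ncard_eq_blk₃, h1, h2, h3]; omega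
    have hI2 : ((Matroid.matP m).sum (Matroid.unif 1 1)).Indep I := by
      rw [matP_sum_indep_iff, h1, h2]; omega
    rw [isBase_iff_of_ncard (k := m + 1) ?_ ⟨I, hI2, hI1⟩]
    · exact ⟨hI2, hI1⟩
    · intro J hJ
      rw [matP_sum_indep_iff] at hJ
      have := blk_le Sum.inr J
      rw [ncard_eq_blk₃]; omega
  rw [← hI.encard_eq_eRank]
  change I.ncard = m + 1
  rw [ncard_eq_blk₃, h1, h2, h3]; omega

theorem matD_ground (n : ℕ) : (Matroid.matD n).E = univ :=
  sum_ground_eq_univ (sum_ground_eq_univ (sum_ground_eq_univ rfl rfl) rfl) rfl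

theorem matD_indep_iff {n : ℕ} (hn : 3 ≤ n)
    (I : Set (((Fin (n - 1) ⊕ Fin (n - 1)) ⊕ Fin 1) ⊕ Fin 1)) :
    (Matroid.matD n).Indep I ↔ (blk (Sum.inl ∘ Sum.inl ∘ Sum.inl) I ≤ n - 2 ∧
      blk (Sum.inl ∘ Sum.inl ∘ Sum.inr) I ≤ n - 2 ∧
      blk (Sum.inl ∘ Sum.inl ∘ Sum.inl) I + blk (Sum.inl ∘ Sum.inl ∘ Sum.inr) I ≤ n - 1) ∧
      blk (Sum.inl ∘ Sum.inl ∘ Sum.inl) I + blk (Sum.inl ∘ Sum.inl ∘ Sum.inr) I +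
      blk (Sum.inl ∘ Sum.inr) I + blk Sum.inr I ≤ n := by
  have := blk_le Sum.inr I
  rw [Matroid.matD, Matroid.freeExtension, truncation_indep_iff_ncard, ncard_eq_blk₄,
    Matroid.sum_indep_iff, matP_sum_indep_iff, eRank_matP_sum (by omega), unif_indep_iff]
  simp only [blk, preimage_comp] at *
  omega

theorem matE_isBase_iff {n : ℕ} (hn : 3 ≤ n)
    (B : Set (((Fin (n - 1) ⊕ Fin (n - 1)) ⊕ Fin 1) ⊕ Fin 1)) :
    (Matroid.matE n).IsBase B ↔ 1 ≤ blk (Sum.inl ∘ Sum.inl ∘ Sum.inl) B ∧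
      1 ≤ blk (Sum.inl ∘ Sum.inl ∘ Sum.inr) B ∧
      n - 1 ≤ blk (Sum.inl ∘ Sum.inl ∘ Sum.inl) B + blk (Sum.inl ∘ Sum.inl ∘ Sum.inr) B ∧
      blk (Sum.inl ∘ Sum.inl ∘ Sum.inl) B + blk (Sum.inl ∘ Sum.inl ∘ Sum.inr) B +
      blk (Sum.inl ∘ Sum.inr) B + blk Sum.inr B = n := by
  have b1 := blk_compl (g := Sum.inl ∘ Sum.inl ∘ Sum.inl) B
  have b2 := blk_compl (g := Sum.inl ∘ Sum.inl ∘ Sum.inr) B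
  have b3 := blk_compl (g := Sum.inl ∘ Sum.inr) B
  have b4 := blk_compl (g := Sum.inr) B
  rw [Matroid.matE, Matroid.dual_isBase_iff (by rw [matD_ground]; exact subset_univ _),
    matD_ground, ← compl_eq_univ_sdiff, isBase_iff_of_ncard (k := n), matD_indep_iff hn,
    ncard_eq_blk₄]
  · omega
  · intro I hI
    rw [ncard_eq_blk₄]; exact ((matD_indep_iff hn I).1 hI).2
  · obtain ⟨I, h1, h2, h3, h4⟩ := exists_blocks₄ (m := n - 1) (m' := n - 1) (j := 1) (k := 1)
      (a := n - 2) (b := 1) (c := 1) (d := 0) (by omega) (by omega) (by omega) (by omega)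
    refine ⟨I, ?_, ?_⟩
    · rw [matD_indep_iff hn, h1, h2, h3, h4]; omega
    · rw [ncard_eq_blk₄, h1, h2, h3, h4]; omega

theorem matR₃_ground : Matroid.matR₃.E = univ :=
  sum_ground_eq_univ (sum_ground_eq_univ (sum_ground_eq_univ rfl rfl) rfl) rfl

theorem matR₃_indep_iff (I : Set (((Fin 2 ⊕ Fin 2) ⊕ Fin 1) ⊕ Fin 2)) :
    Matroid.matR₃.Indep I ↔ (blk (Sum.inl ∘ Sum.inl ∘ Sum.inl) I ≤ 1 ∧
      blk (Sum.inl ∘ Sum.inl ∘ Sum.inr) I ≤ 1 ∧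
      blk (Sum.inl ∘ Sum.inl ∘ Sum.inl) I + blk (Sum.inl ∘ Sum.inl ∘ Sum.inr) I +
        blk (Sum.inl ∘ Sum.inr) I ≤ 2) ∧
      blk (Sum.inl ∘ Sum.inl ∘ Sum.inl) I + blk (Sum.inl ∘ Sum.inl ∘ Sum.inr) I +
      blk (Sum.inl ∘ Sum.inr) I + blk Sum.inr I ≤ 3 := by
  have := blk_le Sum.inr I
  have := blk_le (Sum.inl ∘ Sum.inr) I
  rw [Matroid.matR₃, truncation_indep_iff_ncard, ncard_eq_blk₄, Matroid.sum_indep_iff,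
    truncation_indep_iff_ncard, ncard_eq_blk₃, Matroid.sum_indep_iff, Matroid.sum_indep_iff,
    unif_indep_iff, unif_indep_iff, unif_indep_iff, unif_indep_iff]
  simp only [blk, preimage_comp] at *
  omega

theorem matR₃_isBase_iff (B : Set (((Fin 2 ⊕ Fin 2) ⊕ Fin 1) ⊕ Fin 2)) :
    Matroid.matR₃.IsBase B ↔ blk (Sum.inl ∘ Sum.inl ∘ Sum.inl) B ≤ 1 ∧
      blk (Sum.inl ∘ Sum.inl ∘ Sum.inr) B ≤ 1 ∧
      blk (Sum.inl ∘ Sum.inl ∘ Sum.inl) B + blk (Sum.inl ∘ Sum.inl ∘ Sum.inr) B +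
        blk (Sum.inl ∘ Sum.inr) B ≤ 2 ∧
      blk (Sum.inl ∘ Sum.inl ∘ Sum.inl) B + blk (Sum.inl ∘ Sum.inl ∘ Sum.inr) B +
      blk (Sum.inl ∘ Sum.inr) B + blk Sum.inr B = 3 := by
  rw [isBase_iff_of_ncard (k := 3), matR₃_indep_iff, ncard_eq_blk₄]
  · omega
  · intro I hI
    rw [ncard_eq_blk₄]; exact ((matR₃_indep_iff I).1 hI).2
  · obtain ⟨I, h1, h2, h3, h4⟩ := exists_blocks₄ (m := 2) (m' := 2) (j := 1) (k := 2)
      (a := 1) (b := 1) (c := 0) (d := 1) (by omega) (by omega) (by omega) (by omega)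
    refine ⟨I, ?_, ?_⟩
    · rw [matR₃_indep_iff, h1, h2, h3, h4]; omega
    · rw [ncard_eq_blk₄, h1, h2, h3, h4]

theorem matR₄_isBase_iff (B : Set (((Fin 2 ⊕ Fin 2) ⊕ Fin 1) ⊕ Fin 2)) :
    Matroid.matR₄.IsBase B ↔ 1 ≤ blk (Sum.inl ∘ Sum.inl ∘ Sum.inl) B ∧
      1 ≤ blk (Sum.inl ∘ Sum.inl ∘ Sum.inr) B ∧
      3 ≤ blk (Sum.inl ∘ Sum.inl ∘ Sum.inl) B + blk (Sum.inl ∘ Sum.inl ∘ Sum.inr) B +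
        blk (Sum.inl ∘ Sum.inr) B ∧
      blk (Sum.inl ∘ Sum.inl ∘ Sum.inl) B + blk (Sum.inl ∘ Sum.inl ∘ Sum.inr) B +
      blk (Sum.inl ∘ Sum.inr) B + blk Sum.inr B = 4 := by
  have b1 := blk_compl (g := Sum.inl ∘ Sum.inl ∘ Sum.inl) B
  have b2 := blk_compl (g := Sum.inl ∘ Sum.inl ∘ Sum.inr) B
  have b3 := blk_compl (g := Sum.inl ∘ Sum.inr) B
  have b4 := blk_compl (g := Sum.inr) B
  rw [Matroid.matR₄, Matroid.dual_isBase_iff (by rw [matR₃_ground]; exact subset_univ _),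
    matR₃_ground, ← compl_eq_univ_sdiff, matR₃_isBase_iff]
  omega

/-! ### The excluded minors in a parallel connection -/

section Parallel

variable {α : Type*} {M₁ M₂ : Matroid α} {x : α} [M₁.Finite] [M₂.Finite] {n : ℕ} {e : ℕ → α}
  {P Q : ℕ → ℕ} {t : ℕ}

/-- Doubling the free element of `P_m + x` turns it into the summand `U_{1,2}` of `B_{m,2}`. -/
theorem hasMinorIso_matB (hx : M₁.E ∩ M₂.E = {x}) (hc : M₂.IsConnected) (hE : M₂.E.Nontrivial)
    (hM : PathRep M₁ n e P Q) (het : e t = x) {m : ℕ} (hm : 2 ≤ m)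
    (hpat : Pat n P Q t (Sum.inr 0) (condB m)) :
    (Matroid.parallelConnection M₁ M₂ x hx).HasMinorIso (Matroid.matB m 2) := by
  have hι : Function.Injective
      (Sum.map id (fun _ => 0) : TwoBlocks m → (Fin m ⊕ Fin m) ⊕ Fin 2) :=
    Function.Injective.sumMap Function.injective_id (fun a b _ => Subsingleton.elim a b)
  have hr : ∀ I : Set (TwoBlocks m), (Sum.inr 1 : (Fin m ⊕ Fin m) ⊕ Fin 2) ∉
      Sum.map id (fun _ => 0) '' I := by
    rintro I ⟨(b | b), -, hb⟩ <;> simp at hb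
  have h0 : ∀ I : Set (TwoBlocks m), (Sum.inr 0 : (Fin m ⊕ Fin m) ⊕ Fin 2) ∈
      Sum.map id (fun _ => 0) '' I ↔ Sum.inr 0 ∈ I := fun I => hι.mem_set_image (a := Sum.inr 0)
  refine PathRep.hasMinorIso_parallelConnection hx hc hE hM het hpat (matB_ground m 2) hι
    (y₀ := Sum.inr 1) ?_ ?_ (fun I => ?_) ?_ (fun B => ?_) (fun J h1 h2 => ?_)
  · rw [← image_univ]; exact hr _
  · rintro (z | z)
    · exact Or.inr ⟨Sum.inl z, rfl⟩
    · fin_cases z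
      · exact Or.inr ⟨Sum.inr 0, rfl⟩
      · exact Or.inl rfl
  · rw [matB_isBase_iff hm, condB, blk_image hι (Sum.inl ∘ Sum.inl) (Sum.inl ∘ Sum.inl) fun _ => rfl,
      blk_image hι (Sum.inl ∘ Sum.inr) (Sum.inl ∘ Sum.inr) fun _ => rfl, blk_fin_two, blk_fin_one, h0,
      ind_false (hr I)]
    have := ind_le_one (Sum.inr 0 ∈ I)
    omega
  · obtain ⟨I, h1, h2, h3⟩ := exists_blocks₃ (m := m) (k := 1) (a := m - 1) (b := 1) (c := 0)
      (by omega) (by omega) (by omega)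
    exact ⟨I, by rw [condB, h1, h2, h3]; omega⟩
  · rw [matB_isBase_iff hm, blk_fin_two]
    intro h h1 h2
    rw [ind_true h2, ind_true (show Sum.inr 0 ∈ B from h1)] at h
    omega
  · replace h1 : Sum.inr 0 ∉ J := h1
    rw [show Sum.map id (fun _ => 0) (Sum.inr 0 : TwoBlocks m) =
      (Sum.inr 0 : (Fin m ⊕ Fin m) ⊕ Fin 2) from rfl]
    rw [matB_isBase_iff hm, matB_isBase_iff hm]
    simp [blk_insert, blk_fin_two, ind, h1, h2]

/-- The two single elements of `E_k` are parallel, since no basis contains both; deleting one of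
them leaves the dual of `P_{k-1} + x`. -/
theorem hasMinorIso_matE (hx : M₁.E ∩ M₂.E = {x}) (hc : M₂.IsConnected) (hE : M₂.E.Nontrivial)
    (hM : PathRep M₁ n e P Q) (het : e t = x) {k : ℕ} (hk : 4 ≤ k)
    (hpat : Pat n P Q t (Sum.inr 0) (condE (k - 1))) :
    (Matroid.parallelConnection M₁ M₂ x hx).HasMinorIso (Matroid.matE k) := by
  have hι : Function.Injective (Sum.inl : TwoBlocks (k - 1) → TwoBlocks (k - 1) ⊕ Fin 1) :=
    Sum.inl_injective
  have hr : ∀ I : Set (TwoBlocks (k - 1)), (Sum.inr 0 : TwoBlocks (k - 1) ⊕ Fin 1) ∉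
      Sum.inl '' I := by
    rintro I ⟨b, -, hb⟩; simp at hb
  refine PathRep.hasMinorIso_parallelConnection hx hc hE hM het hpat (matD_ground k) hι
    (y₀ := Sum.inr 0) ?_ ?_ (fun I => ?_) ?_ (fun B => ?_) (fun J h1 h2 => ?_)
  · rw [← image_univ]; exact hr _
  · rintro (z | z)
    · exact Or.inr ⟨z, rfl⟩
    · exact Or.inl (by rw [Subsingleton.elim z 0])
  · rw [matE_isBase_iff (by omega), condE, blk_image hι (Sum.inl ∘ Sum.inl ∘ Sum.inl) (Sum.inl ∘ Sum.inl) fun _ => rfl,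
      blk_image hι (Sum.inl ∘ Sum.inl ∘ Sum.inr) (Sum.inl ∘ Sum.inr) fun _ => rfl,
      blk_image hι (Sum.inl ∘ Sum.inr) Sum.inr fun _ => rfl, blk_fin_one Sum.inr (Sum.inl '' I),
      ind_false (hr I)]
    have := blk_le Sum.inr I
    omega
  · obtain ⟨I, h1, h2, h3⟩ := exists_blocks₃ (m := k - 1) (k := 1) (a := k - 1) (b := 1) (c := 0)
      (by omega) (by omega) (by omega)
    exact ⟨I, by rw [condE, h1, h2, h3]; omega⟩
  · rw [matE_isBase_iff (by omega), blk_fin_one Sum.inr, blk_fin_one (Sum.inl ∘ Sum.inr)]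
    intro h h1 h2
    rw [ind_true h2, ind_true (show (Sum.inl ∘ Sum.inr) 0 ∈ B from h1)] at h
    omega
  · replace h1 : (Sum.inl ∘ Sum.inr) 0 ∉ J := h1
    rw [matE_isBase_iff (by omega), matE_isBase_iff (by omega)]
    simp only [Function.comp_apply] at h1
    simp [blk_insert, blk_fin_one Sum.inr, blk_fin_one (Sum.inl ∘ Sum.inr), ind, h1, h2]

/-- The basepoint becomes one element of the second parallel pair of `R_3`, and the other single
point of the line keeps that role. -/
theorem hasMinorIso_matR₃ (hx : M₁.E ∩ M₂.E = {x}) (hc : M₂.IsConnected) (hE : M₂.E.Nontrivial)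
    (hM : PathRep M₁ n e P Q) (het : e t = x)
    (hpat : Pat n P Q t (Sum.inl (Sum.inr 0)) condPlane) :
    (Matroid.parallelConnection M₁ M₂ x hx).HasMinorIso Matroid.matR₃ := by
  set ι : PairSinglesPair → ((Fin 2 ⊕ Fin 2) ⊕ Fin 1) ⊕ Fin 2 :=
    Sum.map (Sum.elim (Sum.map Sum.inl id) (fun _ => Sum.inl (Sum.inr 0))) id with hιdef
  have hι : Function.Injective ι := by
    rintro (((a | a) | a) | a) (((b | b) | b) | b) hab <;>
      fin_cases a <;> fin_cases b <;> simp [hιdef] at hab ⊢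
  have hr : ∀ I, Sum.inl (Sum.inl (Sum.inr 1)) ∉ ι '' I := by
    rintro I ⟨(((b | b) | b) | b), -, hb⟩ <;> simp [hιdef] at hb
  have h0 : ∀ I, Sum.inl (Sum.inl (Sum.inr 0)) ∈ ι '' I ↔ Sum.inl (Sum.inr 0) ∈ I :=
    fun I => hι.mem_set_image (a := Sum.inl (Sum.inr 0))
  refine PathRep.hasMinorIso_parallelConnection hx hc hE hM het hpat matR₃_ground hι
    (y₀ := Sum.inl (Sum.inl (Sum.inr 1))) ?_ ?_ (fun I => ?_) ?_ (fun B => ?_) (fun J h1 h2 => ?_)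
  · rw [← image_univ]; exact hr _
  · rintro (((z | z) | z) | z)
    · exact Or.inr ⟨Sum.inl (Sum.inl (Sum.inl z)), rfl⟩
    · fin_cases z
      · exact Or.inr ⟨Sum.inl (Sum.inr 0), rfl⟩
      · exact Or.inl rfl
    · exact Or.inr ⟨Sum.inl (Sum.inl (Sum.inr z)), rfl⟩
    · exact Or.inr ⟨Sum.inr z, rfl⟩
  · rw [matR₃_isBase_iff, condPlane,
      blk_image hι (Sum.inl ∘ Sum.inl ∘ Sum.inl) (Sum.inl ∘ Sum.inl ∘ Sum.inl) fun _ => rfl,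
      blk_image hι (Sum.inl ∘ Sum.inr) (Sum.inl ∘ Sum.inl ∘ Sum.inr) fun _ => rfl,
      blk_image hι (Sum.inr) (Sum.inr) fun _ => rfl, blk_fin_two (Sum.inl ∘ Sum.inl ∘ Sum.inr),
      blk_fin_one (Sum.inl ∘ Sum.inr)]
    simp only [Function.comp_apply, h0, ind_false (hr I)]
    have := ind_le_one (Sum.inl (Sum.inr 0) ∈ I)
    omega
  · obtain ⟨I, h1, h2, h3, h4⟩ := exists_blocks₄ (m := 2) (m' := 1) (j := 1) (k := 2)
      (a := 1) (b := 1) (c := 0) (d := 1) (by omega) (by omega) (by omega) (by omega)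
    exact ⟨I, by rw [condPlane, h1, h2, h3, h4]; omega⟩
  · rw [matR₃_isBase_iff, blk_fin_two (Sum.inl ∘ Sum.inl ∘ Sum.inr)]
    intro h h1 h2
    rw [ind_true (show (Sum.inl ∘ Sum.inl ∘ Sum.inr) 1 ∈ B from h2),
      ind_true (show (Sum.inl ∘ Sum.inl ∘ Sum.inr) 0 ∈ B from h1)] at h
    omega
  · replace h1 : Sum.inl (Sum.inl (Sum.inr 0)) ∉ J := h1
    rw [show ι (Sum.inl (Sum.inr 0)) = Sum.inl (Sum.inl (Sum.inr 0)) from rfl,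
      matR₃_isBase_iff, matR₃_isBase_iff]
    simp [blk_fin_one, blk_fin_two, ind_true, ind_false, h1, h2]

/-- The last two elements of `R_4` are parallel: no basis contains both, as their duals are the two
free points of `R_3`. -/
theorem hasMinorIso_matR₄ (hx : M₁.E ∩ M₂.E = {x}) (hc : M₂.IsConnected) (hE : M₂.E.Nontrivial)
    (hM : PathRep M₁ n e P Q) (het : e t = x)
    (hpat : Pat n P Q t (Sum.inr 0) (fun I => condR Iᶜ)) :
    (Matroid.parallelConnection M₁ M₂ x hx).HasMinorIso Matroid.matR₄ := by
  set ι : TwoPairs → ((Fin 2 ⊕ Fin 2) ⊕ Fin 1) ⊕ Fin 2 := Sum.map id (fun _ => 0) with hιdef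
  have hι : Function.Injective ι :=
    Function.Injective.sumMap Function.injective_id (fun a b _ => Subsingleton.elim a b)
  have hr : ∀ I, Sum.inr 1 ∉ ι '' I := by
    rintro I ⟨(b | b), -, hb⟩ <;> simp [hιdef] at hb
  have h0 : ∀ I, Sum.inr 0 ∈ ι '' I ↔ Sum.inr 0 ∈ I :=
    fun I => hι.mem_set_image (a := Sum.inr 0)
  refine PathRep.hasMinorIso_parallelConnection hx hc hE hM het hpat matR₃_ground hι
    (y₀ := Sum.inr 1) ?_ ?_ (fun I => ?_) ?_ (fun B => ?_) (fun J h1 h2 => ?_)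
  · rw [← image_univ]; exact hr _
  · rintro (z | z)
    · exact Or.inr ⟨Sum.inl z, rfl⟩
    · fin_cases z
      · exact Or.inr ⟨Sum.inr 0, rfl⟩
      · exact Or.inl rfl
  · have b1 := blk_compl (g := Sum.inl ∘ Sum.inl ∘ Sum.inl) I
    have b2 := blk_compl (g := Sum.inl ∘ Sum.inl ∘ Sum.inr) I
    have b3 := blk_compl (g := Sum.inl ∘ Sum.inr) I
    have b4 := blk_compl (g := Sum.inr) I
    rw [matR₄_isBase_iff, condR,
      blk_image hι (Sum.inl ∘ Sum.inl ∘ Sum.inl) (Sum.inl ∘ Sum.inl ∘ Sum.inl) fun _ => rfl,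
      blk_image hι (Sum.inl ∘ Sum.inl ∘ Sum.inr) (Sum.inl ∘ Sum.inl ∘ Sum.inr) fun _ => rfl,
      blk_image hι (Sum.inl ∘ Sum.inr) (Sum.inl ∘ Sum.inr) fun _ => rfl, blk_fin_two Sum.inr, h0,
      ind_false (hr I)]
    rw [blk_fin_one Sum.inr I] at b4
    have := ind_le_one (Sum.inr 0 ∈ I)
    omega
  · obtain ⟨I, h1, h2, h3, h4⟩ := exists_blocks₄ (m := 2) (m' := 2) (j := 1) (k := 1)
      (a := 1) (b := 1) (c := 0) (d := 0) (by omega) (by omega) (by omega) (by omega)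
    exact ⟨Iᶜ, by rw [compl_compl, condR, h1, h2, h3, h4]; omega⟩
  · rw [matR₄_isBase_iff, blk_fin_two Sum.inr]
    intro h h1 h2
    rw [ind_true h2, ind_true (show Sum.inr 0 ∈ B from h1)] at h
    omega
  · replace h1 : Sum.inr 0 ∉ J := h1
    rw [show ι (Sum.inr 0) = Sum.inr 0 from rfl, matR₄_isBase_iff, matR₄_isBase_iff]
    simp [blk_fin_one, blk_fin_two, ind_true, ind_false, h1, h2]

end Parallel

end LatticePath

namespace LatticePath

/-! ### The minor `C_{4,2}` -/

theorem exists_superset_ncard_eq {m a : ℕ} {A : Set (Fin m)} (hA : A.ncard ≤ a) (ha : a ≤ m) :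
    ∃ A', A ⊆ A' ∧ A'.ncard = a := by
  obtain ⟨A', h1, -, h2⟩ := exists_subsuperset_card_eq (subset_univ A) hA (by simpa using ha)
  exact ⟨A', h1, h2⟩

theorem exists_superset_blocks₃ {m k a b c : ℕ} {I : Set ((Fin m ⊕ Fin m) ⊕ Fin k)}
    (ha : blk (Sum.inl ∘ Sum.inl) I ≤ a ∧ a ≤ m) (hb : blk (Sum.inl ∘ Sum.inr) I ≤ b ∧ b ≤ m)
    (hc : blk Sum.inr I ≤ c ∧ c ≤ k) :
    ∃ J, I ⊆ J ∧ blk (Sum.inl ∘ Sum.inl) J = a ∧ blk (Sum.inl ∘ Sum.inr) J = b ∧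
      blk Sum.inr J = c := by
  obtain ⟨A, hA, rfl⟩ := exists_superset_ncard_eq ha.1 ha.2
  obtain ⟨B, hB, rfl⟩ := exists_superset_ncard_eq hb.1 hb.2
  obtain ⟨C, hC, rfl⟩ := exists_superset_ncard_eq hc.1 hc.2
  obtain ⟨D, rfl, rfl⟩ := exists_preimage_eq A B
  obtain ⟨J, rfl, rfl⟩ := exists_preimage_eq D C
  refine ⟨J, ?_, rfl, rfl, rfl⟩
  rintro ((z | z) | z) hz
  · exact hA hz
  · exact hB hz
  · exact hC hz

theorem blk_mono {β : Type*} {m : ℕ} (g : Fin m → β) {I J : Set β} (h : I ⊆ J) :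
    blk g I ≤ blk g J :=
  ncard_le_ncard (preimage_mono h) (toFinite _)

/-- Independence is needed here rather than bases, because for `C_{4,2}` the basepoint itself is
deleted. A set extends to a basis exactly when its block sizes fit under one of `(1, 1, 1)`, `(1, 2,
0)`, `(2, 1, 0)`. -/
theorem exists_condE_two_iff (I : Set (TwoBlocks 2)) : (∃ J, I ⊆ J ∧ condE 2 J) ↔
    (blk (Sum.inl ∘ Sum.inl) I ≤ 1 ∧ blk (Sum.inl ∘ Sum.inr) I ≤ 1) ∨
      (blk Sum.inr I = 0 ∧ (blk (Sum.inl ∘ Sum.inl) I ≤ 1 ∨ blk (Sum.inl ∘ Sum.inr) I ≤ 1)) := by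
  constructor
  · rintro ⟨J, hIJ, h1, h2, h3⟩
    have := blk_mono (Sum.inl ∘ Sum.inl) hIJ
    have := blk_mono (Sum.inl ∘ Sum.inr) hIJ
    have := blk_mono Sum.inr hIJ
    omega
  · have b1 := blk_le (Sum.inl ∘ Sum.inl) I
    have b2 := blk_le (Sum.inl ∘ Sum.inr) I
    have b3 := blk_le Sum.inr I
    have key : ∀ a b c, blk (Sum.inl ∘ Sum.inl) I ≤ a ∧ a ≤ 2 → blk (Sum.inl ∘ Sum.inr) I ≤ b ∧ b ≤ 2
        → blk Sum.inr I ≤ c ∧ c ≤ 1 → 1 ≤ a ∧ 1 ≤ b ∧ a + b + c = 3 → ∃ J, I ⊆ J ∧ condE 2 J := by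
      intro a b c ha hb hc h
      obtain ⟨J, hIJ, rfl, rfl, rfl⟩ := exists_superset_blocks₃ ha hb hc
      exact ⟨J, hIJ, h⟩
    rintro (h | ⟨h, h' | h'⟩)
    · exact key 1 1 1 (by omega) (by omega) (by omega) (by omega)
    · exact key 1 2 0 (by omega) (by omega) (by omega) (by omega)
    · exact key 2 1 0 (by omega) (by omega) (by omega) (by omega)

theorem matC_two_indep_iff (I : Set ((Fin 2 ⊕ Fin 2) ⊕ Fin 2)) : (Matroid.matC 2 2).Indep I ↔
    (blk (Sum.inl ∘ Sum.inl) I ≤ 1 ∧ blk (Sum.inl ∘ Sum.inr) I ≤ 1) ∨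
      (blk Sum.inr I ≤ 1 ∧
        (blk (Sum.inl ∘ Sum.inl) I ≤ 1 ∨ blk (Sum.inl ∘ Sum.inr) I ≤ 1)) := by
  have hB : ∀ B, (Matroid.matC 2 2).IsBase B ↔ 1 ≤ blk (Sum.inl ∘ Sum.inl) B ∧
      1 ≤ blk (Sum.inl ∘ Sum.inr) B ∧ 1 ≤ blk Sum.inr B ∧
      blk (Sum.inl ∘ Sum.inl) B + blk (Sum.inl ∘ Sum.inr) B + blk Sum.inr B = 4 := by
    intro B
    have b1 := blk_compl (g := Sum.inl ∘ Sum.inl) B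
    have b2 := blk_compl (g := Sum.inl ∘ Sum.inr) B
    have b3 := blk_compl (g := Sum.inr) B
    rw [Matroid.matC, Matroid.dual_isBase_iff (by rw [matB_ground]; exact subset_univ _),
      matB_ground, ← compl_eq_univ_sdiff, matB_isBase_iff le_rfl]
    omega
  constructor
  · intro h
    obtain ⟨J, hJ, hIJ⟩ := h.exists_isBase_superset
    have := (hB J).1 hJ
    have := blk_mono (Sum.inl ∘ Sum.inl) hIJ
    have := blk_mono (Sum.inl ∘ Sum.inr) hIJ
    have := blk_mono Sum.inr hIJ
    omega
  · have b1 := blk_le (Sum.inl ∘ Sum.inl) I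
    have b2 := blk_le (Sum.inl ∘ Sum.inr) I
    have b3 := blk_le Sum.inr I
    have key : ∀ a b c, blk (Sum.inl ∘ Sum.inl) I ≤ a ∧ a ≤ 2 → blk (Sum.inl ∘ Sum.inr) I ≤ b ∧ b ≤ 2
        → blk Sum.inr I ≤ c ∧ c ≤ 2 → 1 ≤ a ∧ 1 ≤ b ∧ 1 ≤ c ∧ a + b + c = 4 →
        (Matroid.matC 2 2).Indep I := by
      intro a b c ha hb hc h
      obtain ⟨J, hIJ, rfl, rfl, rfl⟩ := exists_superset_blocks₃ ha hb hc
      exact ((hB J).2 h).indep.subset hIJ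
    rintro (h | ⟨h, h' | h'⟩)
    · exact key 1 1 2 (by omega) (by omega) (by omega) (by omega)
    · exact key 1 2 1 (by omega) (by omega) (by omega) (by omega)
    · exact key 2 1 1 (by omega) (by omega) (by omega) (by omega)

section Parallel

variable {α : Type*} {M₁ M₂ : Matroid α} {x : α}

/-- After `C` is contracted, `x`, `y`, `z` form a triangle. One of `y`, `z` alone does not affect
the side of `M₁`; both together span `x`. -/
theorem parallelIndep_union_union_iff (hx : M₁.E ∩ M₂.E = {x}) {y z : α} {C : Set α}
    (hy : y ∈ M₂.E) (hz : z ∈ M₂.E) (hyx : y ≠ x) (hzx : z ≠ x) (hC : C ⊆ M₂.E) (hxC : x ∉ C)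
    (h1 : M₂.Indep (insert x (insert y C))) (h2 : M₂.Indep (insert x (insert z C)))
    (h3 : M₂.Indep (insert y (insert z C))) (h4 : ¬ M₂.Indep (insert x (insert y (insert z C))))
    {J K : Set α} (hJ : J ⊆ M₁.E) (hxJ : x ∉ J) (hK : K ⊆ {y, z}) :
    Matroid.ParallelIndep M₁ M₂ x (J ∪ K ∪ C) ↔
      M₁.Indep J ∧ (M₁.Indep (insert x J) ∨ ¬ (y ∈ K ∧ z ∈ K)) := by
  have hmem : ∀ a ∈ M₁.E, a ∈ M₂.E → a = x := fun a h1 h2 => hx.subset ⟨h1, h2⟩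
  have hKE : ∀ a ∈ K, a ∈ M₂.E ∧ a ≠ x := by
    intro a ha
    rcases hK ha with rfl | rfl
    · exact ⟨hy, hyx⟩
    · exact ⟨hz, hzx⟩
  have e1 : (J ∪ K ∪ C) ∩ M₁.E = J := by
    ext a
    refine ⟨?_, fun h => ⟨Or.inl (Or.inl h), hJ h⟩⟩
    rintro ⟨(h | h) | h, h'⟩
    · exact h
    · exact absurd (hmem a h' (hKE a h).1) (hKE a h).2
    · exact absurd (hmem a h' (hC h) ▸ h) hxC
  have e2 : (J ∪ K ∪ C) ∩ M₂.E = K ∪ C := by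
    ext a
    constructor
    · rintro ⟨(h | h) | h, h'⟩
      · exact absurd (hmem a (hJ h) h' ▸ h) hxJ
      · exact Or.inl h
      · exact Or.inr h
    · rintro (h | h)
      · exact ⟨Or.inl (Or.inr h), (hKE a h).1⟩
      · exact ⟨Or.inr h, hC h⟩
  have hKC : M₂.Indep (K ∪ C) := h3.subset (by
    rintro a (h | h)
    · rcases hK h with rfl | rfl <;> simp
    · exact Or.inr (Or.inr h))
  have hxK : M₂.Indep (insert x (K ∪ C)) ↔ ¬ (y ∈ K ∧ z ∈ K) := by
    constructor
    · rintro h ⟨hyK, hzK⟩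
      exact h4 (h.subset (insert_subset_insert
        (insert_subset (Or.inl hyK) (insert_subset (Or.inl hzK) subset_union_right))))
    · intro h
      have key : ∀ w w', K ⊆ {w, w'} → w' ∉ K → K ∪ C ⊆ insert w C := by
        rintro w w' hw hw' a (h | h)
        · rcases hw h with rfl | rfl
          · exact Or.inl rfl
          · exact absurd h hw'
        · exact Or.inr h
      by_cases hyK : y ∈ K
      · exact h1.subset (insert_subset_insert (key y z hK fun hzK => h ⟨hyK, hzK⟩))
      · exact h2.subset (insert_subset_insert (key z y (by rwa [pair_comm]) hyK))
  rw [Matroid.ParallelIndep, e1, e2, hxK]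
  constructor
  · rintro ⟨-, h, -, h' | h' | h'⟩
    · exact ⟨h, Or.inl h'⟩
    · exact ⟨h, Or.inr h'⟩
    · exact absurd h1 (h'.2.not_indep_of_mem (mem_insert _ _))
  · rintro ⟨h, h'⟩
    refine ⟨?_, h, hKC, by tauto⟩
    exact union_subset (union_subset_union hJ fun a ha => (hKE a ha).1)
      (hC.trans subset_union_right)

/-- The basepoint is outside the image of the embedding and hence deleted; the two elements `y`, `z`
of the triangle take its place as the third pair of `C_{4,2}`. -/
theorem hasMinorIso_matC [M₁.Finite] [M₂.Finite] {n : ℕ} {e : ℕ → α} {P Q : ℕ → ℕ} {t : ℕ}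
    (hx : M₁.E ∩ M₂.E = {x}) (hc : M₂.IsConnected) (hr : 1 < M₂.eRank)
    (hM : PathRep M₁ n e P Q) (het : e t = x) (hpat : Pat n P Q t (Sum.inr 0) (condE 2)) :
    (Matroid.parallelConnection M₁ M₂ x hx).HasMinorIso (Matroid.matC 2 2) := by
  obtain ⟨φ, C, h1, h2, h3, h4, h5⟩ := hpat
  have hmem : ∀ a ∈ M₁.E, a ∈ M₂.E → a = x := fun a h1 h2 => hx.subset ⟨h1, h2⟩
  obtain ⟨y, z, C₂, hy, hz, hyx, hzx, hyz, hC₂, hxC₂, hyC₂, hzC₂, i1, i2, i3, i4⟩ :=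
    exists_triangle hc (hx.symm.subset rfl).2 hr
  have hex : ∃ I, condE 2 I := by
    obtain ⟨J, -, hJ⟩ := (exists_condE_two_iff ∅).2 (by simp [blk])
    exact ⟨J, hJ⟩
  have key := fun I => (hM.indep_iff_exists_of_pat h3 h4 h5 hex I).trans (exists_condE_two_iff I)
  have hsub : ∀ J, e '' (φ '' J ∪ C) ⊆ M₁.E := by
    rintro J _ ⟨j, ⟨b, -, rfl⟩ | hj, rfl⟩
    · exact hM.mem_ground (h3 b).1
    · exact hM.mem_ground (h4 hj)
  have heE : ∀ b, e (φ b) ∈ M₁.E := fun b => hM.mem_ground (h3 b).1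
  have heC : ∀ b, e (φ b) ∉ e '' C := by
    rintro b ⟨j, hj, hje⟩
    exact (h3 b).2 (hM.injOn (h4 hj) (h3 b).1 hje ▸ hj)
  have hy1 : y ∉ M₁.E := fun h => hyx (hmem y h hy)
  have hz1 : z ∉ M₁.E := fun h => hzx (hmem z h hz)
  have hinj : Function.Injective fun b => e (φ b) :=
    fun a b hab => h1 (hM.injOn (h3 a).1 (h3 b).1 hab)
  have hex' : e (φ (Sum.inr 0)) = x := by rw [h2, het]
  have hne : ∀ a, e (φ (Sum.inl a)) ≠ x := fun a h =>
    absurd (hinj (h.trans hex'.symm : (fun b => e (φ b)) _ = (fun b => e (φ b)) _)) (by simp)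
  have hyC : y ∉ e '' C ∪ C₂ := by
    rintro (⟨j, hj, rfl⟩ | h)
    · exact hy1 (hM.mem_ground (h4 hj))
    · exact hyC₂ h
  have hzC : z ∉ e '' C ∪ C₂ := by
    rintro (⟨j, hj, rfl⟩ | h)
    · exact hz1 (hM.mem_ground (h4 hj))
    · exact hzC₂ h
  refine hasMinorIso_of_indep_iff (C := e '' C ∪ C₂)
    (f := Sum.elim (fun a => e (φ (Sum.inl a))) ![y, z]) ?_ ?_ (matB_ground 2 2) fun I => ?_
  · refine Function.Injective.sumElim (fun a b h => Sum.inl_injective (hinj h)) ?_ ?_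
    · intro a b hab
      fin_cases a <;> fin_cases b <;> simp_all
    · intro a b h
      fin_cases b
      · exact hy1 ((show e (φ (Sum.inl a)) = y from h) ▸ heE _)
      · exact hz1 ((show e (φ (Sum.inl a)) = z from h) ▸ heE _)
  · rintro (a | a)
    · refine ⟨Or.inl (heE _), ?_⟩
      rintro (h | h)
      · exact heC _ h
      · exact hne a (hmem _ (heE _) (hC₂ h))
    · fin_cases a
      · exact ⟨Or.inr hy, hyC⟩
      · exact ⟨Or.inr hz, hzC⟩
  · have hxJ : x ∉ e '' (φ '' (Sum.inl '' (Sum.inl ⁻¹' I)) ∪ C) := by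
      rintro ⟨j, ⟨_, ⟨b, -, rfl⟩, rfl⟩ | hj, hje⟩
      · exact hne b hje
      · exact heC (Sum.inr 0) (hex' ▸ ⟨j, hj, hje⟩)
    have hK : (![y, z] '' (Sum.inr ⁻¹' I) : Set α) ⊆ {y, z} := by
      rintro _ ⟨b, -, rfl⟩
      fin_cases b <;> simp
    have e1 : Sum.elim (fun a => e (φ (Sum.inl a))) ![y, z] '' I ∪ (e '' C ∪ C₂) =
        e '' (φ '' (Sum.inl '' (Sum.inl ⁻¹' I)) ∪ C) ∪ ![y, z] '' (Sum.inr ⁻¹' I) ∪ C₂ := by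
      conv_lhs => rw [← image_preimage_inl_union_image_preimage_inr I]
      simp only [image_union, image_image, Sum.elim_inl, Sum.elim_inr]
      ac_rfl
    have e2 : insert x (e '' (φ '' (Sum.inl '' (Sum.inl ⁻¹' I)) ∪ C)) =
        e '' (φ '' (insert (Sum.inr 0) (Sum.inl '' (Sum.inl ⁻¹' I))) ∪ C) := by
      rw [image_insert_eq, insert_union, image_insert_eq, hex']
    have m0 : y ∈ ![y, z] '' (Sum.inr ⁻¹' I) ↔ Sum.inr 0 ∈ I := by
      simp [Fin.exists_fin_two, hyz.symm]
    have m1 : z ∈ ![y, z] '' (Sum.inr ⁻¹' I) ↔ Sum.inr 1 ∈ I := by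
      simp [Fin.exists_fin_two, hyz]
    have b0 : ∀ A : Set (Fin 2 ⊕ Fin 2), blk (Sum.inr : Fin 1 → TwoBlocks 2) (Sum.inl '' A) = 0 :=
      fun A => by simp [blk_fin_one, ind_false]
    have b1 : ∀ A : Set (TwoBlocks 2),
        blk (Sum.inr : Fin 1 → TwoBlocks 2) (insert (Sum.inr 0) A) = 1 :=
      fun A => by simp [blk_fin_one, ind_true]
    have b2 : blk (Sum.inl ∘ Sum.inl) (Sum.inl '' (Sum.inl ⁻¹' I) : Set (TwoBlocks 2)) =
        blk (Sum.inl ∘ Sum.inl) I :=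
      blk_image Sum.inl_injective (Sum.inl ∘ Sum.inl) Sum.inl (fun _ => rfl) _
    have b3 : blk (Sum.inl ∘ Sum.inr) (Sum.inl '' (Sum.inl ⁻¹' I) : Set (TwoBlocks 2)) =
        blk (Sum.inl ∘ Sum.inr) I :=
      blk_image Sum.inl_injective (Sum.inl ∘ Sum.inr) Sum.inr (fun _ => rfl) _
    rw [Matroid.parallelConnection_indep_iff, e1, parallelIndep_union_union_iff hx hy hz hyx hzx
      hC₂ hxC₂ i1 i2 i3 i4 (hsub _) hxJ hK, e2, key, key, m0, m1, matC_two_indep_iff, b0, b1,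
      blk_insert (by simp), blk_insert (by simp), b2, b3, blk_fin_two Sum.inr]
    by_cases c0 : Sum.inr 0 ∈ I <;> by_cases c1 : Sum.inr 1 ∈ I <;>
      simp only [ind_true, ind_false, c0, c1, not_false_eq_true, and_self, and_false,
        not_true_eq_false, or_true, or_false, and_true, true_and] <;> omega

end Parallel

end LatticePath

namespace LatticePath

/-! ### Parallel connections at terminal elements -/

section Glue

variable {α : Type*} {M₁ M₂ : Matroid α} {x : α}

theorem PathRep.cnt_preimage_inter {M : Matroid α} {n : ℕ} {e : ℕ → α} {P Q : ℕ → ℕ}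
    (h : PathRep M n e P Q) (I : Set α) {v : ℕ} (hv : v ≤ n) :
    cnt (e ⁻¹' (I ∩ M.E)) v = cnt (e ⁻¹' I) v :=
  cnt_congr fun _ hj => and_iff_left (h.mem_ground (by omega))

theorem PathRep.cnt_insert_of_mem_or {M : Matroid α} {n : ℕ} {e : ℕ → α} {P Q : ℕ → ℕ}
    (h : PathRep M n e P Q) {i : ℕ} (hi : i < n) (K : Set α) {v : ℕ} (hv : v ≤ n) :
    cnt (e ⁻¹' insert (e i) K) v =
      cnt (e ⁻¹' K) v + (1 - ind (e i ∈ K)) * ind (i < v) := by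
  by_cases hK : e i ∈ K
  · simp [insert_eq_of_mem hK, ind_true hK]
  · simp [h.cnt_insert hi hK hv, ind_false hK]

/-- The only interval of `M₁` that contains its last element `x` and the only interval of `M₂` that
contains its first element `x` are merged. At `x` both glued paths take an east step, at distance
one. An interval of positions across `x` then expresses that the parts on the two sides cannot both
require the merged interval. -/
theorem PathRep.glue [M₁.Finite] [M₂.Finite] (hx : M₁.E ∩ M₂.E = {x}) {a n : ℕ}
    {e₁ e₂ : ℕ → α} {P₁ Q₁ P₂ Q₂ : ℕ → ℕ} {s : ℕ} (h₁ : PathRep M₁ (a + 1) e₁ P₁ Q₁)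
    (h₂ : PathRep M₂ n e₂ P₂ Q₂) (hn : 0 < n) (he₁ : e₁ a = x) (he₂ : e₂ 0 = x)
    (hP₁ : P₁ a = s + 1) (hP₁' : P₁ (a + 1) = s + 1) (hQ₁ : Q₁ a = s)
    (hP₂ : P₂ 1 = 1) (hQ₂ : Q₂ 1 = 0) (hloop : M₂.Indep {x}) :
    PathRep (Matroid.parallelConnection M₁ M₂ x hx) (a + n)
      (fun j => if j < a then e₁ j else e₂ (j - a))
      (fun j => if j ≤ a then P₁ j else s + P₂ (j - a))
      (fun j => if j ≤ a then Q₁ j else s + Q₂ (j - a)) := by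
  have hB₁ := h₁.bounds
  have hB₂ := h₂.bounds
  have hmem : ∀ b ∈ M₁.E, b ∈ M₂.E → b = x := fun b h1 h2 => hx.subset ⟨h1, h2⟩
  have hP0 : ∀ j, j ≤ a → (if j ≤ a then P₁ j else s + P₂ (j - a)) = P₁ j := fun j hj => if_pos hj
  have hQ0 : ∀ j, j ≤ a → (if j ≤ a then Q₁ j else s + Q₂ (j - a)) = Q₁ j := fun j hj => if_pos hj
  have hP1 : ∀ w, 0 < w → (if a + w ≤ a then P₁ (a + w) else s + P₂ (a + w - a)) = s + P₂ w :=
    fun w hw => by rw [if_neg (by omega), Nat.add_sub_cancel_left]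
  have hQ1 : ∀ w, 0 < w → (if a + w ≤ a then Q₁ (a + w) else s + Q₂ (a + w - a)) = s + Q₂ w :=
    fun w hw => by rw [if_neg (by omega), Nat.add_sub_cancel_left]
  have e1 : ∀ j, j < a → (if j < a then e₁ j else e₂ (j - a)) = e₁ j := fun j hj => if_pos hj
  have e2 : ∀ w, (if a + w < a then e₁ (a + w) else e₂ (a + w - a)) = e₂ w := fun w => by
    rw [if_neg (by omega), Nat.add_sub_cancel_left]
  have hne : ∀ i w, i < a → w < n → e₁ i ≠ e₂ w := by
    intro i w hi hw h
    have h3 := hmem _ (h₁.mem_ground (by omega : i < a + 1)) (h ▸ h₂.mem_ground hw)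
    have := h₁.injOn (show i < a + 1 by omega) (show a < a + 1 by omega) (h3.trans he₁.symm)
    omega
  refine ⟨⟨?_, ?_, fun j => ?_, fun j => ?_, ?_, fun j hj => ?_⟩, ?_, ?_, fun I hI => ?_⟩
  · rw [hP0 0 (by omega), hB₁.P0]
  · rw [hQ0 0 (by omega), hB₁.Q0]
  · rcases lt_trichotomy j a with h | rfl | h
    · rw [hP0 j (by omega), hP0 (j + 1) (by omega)]; exact hB₁.P_step j
    · rw [hP0 j le_rfl, hP1 1 (by omega)]; omega
    · obtain ⟨w, rfl⟩ := Nat.exists_eq_add_of_lt h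
      rw [show a + w + 1 = a + (w + 1) by omega, hP1 _ (by omega), add_assoc, hP1 _ (by omega)]
      have := hB₂.P_step (w + 1)
      omega
  · rcases lt_trichotomy j a with h | rfl | h
    · rw [hQ0 j (by omega), hQ0 (j + 1) (by omega)]; exact hB₁.Q_step j
    · rw [hQ0 j le_rfl, hQ1 1 (by omega)]; omega
    · obtain ⟨w, rfl⟩ := Nat.exists_eq_add_of_lt h
      rw [show a + w + 1 = a + (w + 1) by omega, hQ1 _ (by omega), add_assoc, hQ1 _ (by omega)]
      have := hB₂.Q_step (w + 1)
      omega
  · rw [hP1 _ hn, hQ1 _ hn, hB₂.eq_n]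
  · by_cases h : j ≤ a
    · rw [hP0 j h, hQ0 j h]; exact hB₁.le j (by omega)
    · obtain ⟨w, rfl⟩ := Nat.exists_eq_add_of_lt (not_le.1 h)
      rw [add_assoc, hP1 _ (by omega), hQ1 _ (by omega)]
      have := hB₂.le (w + 1) (by omega)
      omega
  · intro i hi j hj hij
    simp only [mem_Iio] at hi hj hij
    by_cases hia : i < a <;> by_cases hja : j < a
    · rw [e1 i hia, e1 j hja] at hij
      exact h₁.injOn (show i < a + 1 by omega) (show j < a + 1 by omega) hij
    · rw [e1 i hia, if_neg hja] at hij
      exact absurd hij (hne i _ hia (by omega))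
    · rw [e1 j hja, if_neg hia] at hij
      exact absurd hij.symm (hne j _ hja (by omega))
    · rw [if_neg hia, if_neg hja] at hij
      have := h₂.injOn (show i - a < n by omega) (show j - a < n by omega) hij
      omega
  · rw [Matroid.parallelConnection_ground]
    refine subset_antisymm ?_ (union_subset ?_ ?_)
    · rintro _ ⟨j, hj, rfl⟩
      simp only [mem_Iio] at hj ⊢
      split_ifs with h
      · exact Or.inl (h₁.mem_ground (by omega))
      · exact Or.inr (h₂.mem_ground (by omega))
    · intro b hb
      obtain ⟨j, hj, rfl⟩ := h₁.ground.symm.subset hb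
      simp only [mem_Iio] at hj
      by_cases h : j < a
      · exact ⟨j, show j < a + n by omega, e1 j h⟩
      · refine ⟨a, show a < a + n by omega, ?_⟩
        rw [show j = a by omega, he₁, ← he₂]; exact e2 0
    · intro b hb
      obtain ⟨j, hj, rfl⟩ := h₂.ground.symm.subset hb
      simp only [mem_Iio] at hj
      exact ⟨a + j, show a + j < a + n by omega, e2 j⟩
  · rw [Matroid.parallelConnection_indep_iff]
    have hI₁ := h₁.indep_iff (I ∩ M₁.E) inter_subset_right
    have hI₂ := h₂.indep_iff (I ∩ M₂.E) inter_subset_right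
    have hxI₁ := h₁.indep_iff (insert x (I ∩ M₁.E))
      (insert_subset (he₁ ▸ h₁.mem_ground (by omega)) inter_subset_right)
    have hxI₂ := h₂.indep_iff (insert x (I ∩ M₂.E))
      (insert_subset (he₂ ▸ h₂.mem_ground (by omega)) inter_subset_right)
    have hx1 : x ∈ M₁.E := he₁ ▸ h₁.mem_ground (by omega)
    have hx2 : x ∈ M₂.E := he₂ ▸ h₂.mem_ground hn
    rw [Matroid.ParallelIndep, hI₁, hI₂, hxI₁, hxI₂]
    set χ := ind (x ∈ I) with hχ
    have hχ1 : χ ≤ 1 := ind_le_one _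
    set S := (fun j => if j < a then e₁ j else e₂ (j - a)) ⁻¹' I with hS
    set c := fun v => cnt (e₁ ⁻¹' (I ∩ M₁.E)) v with hc
    set d := fun w => cnt (e₂ ⁻¹' (I ∩ M₂.E)) w with hd
    have c1 : c (a + 1) = c a + χ := by
      simp only [hc]
      rw [cnt_succ, hχ, mem_preimage, he₁]
      congr 1
      exact ind_congr (and_iff_left hx1)
    have d1 : d 1 = χ := by
      simp only [hd]
      rw [cnt_succ, cnt_zero, hχ, mem_preimage, he₂, zero_add]
      exact ind_congr (and_iff_left hx2)
    have d0 : d 0 = 0 := cnt_zero _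
    have s1 : ∀ v ≤ a, cnt S v = c v := by
      intro v hv
      simp only [hc]
      rw [h₁.cnt_preimage_inter I (by omega)]
      refine cnt_congr fun j hj => ?_
      rw [hS, mem_preimage, mem_preimage, e1 j (by omega)]
    have s2 : ∀ w ≤ n, cnt S (a + w) = c a + d w := by
      intro w hw
      rw [cnt_add, s1 a le_rfl]
      simp only [hd]
      rw [h₂.cnt_preimage_inter I hw]
      congr 1
      refine cnt_congr fun j hj => ?_
      rw [hS, mem_preimage, mem_preimage, mem_preimage, e2 j]
    have c2 : ∀ v ≤ a + 1, cnt (e₁ ⁻¹' insert x (I ∩ M₁.E)) v =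
        c v + (1 - χ) * ind (a < v) := by
      intro v hv
      rw [← he₁, h₁.cnt_insert_of_mem_or (by omega) _ hv, he₁]
      rw [show ind (x ∈ I ∩ M₁.E) = χ from ind_congr (and_iff_left hx1)]
    have d2 : ∀ w ≤ n, cnt (e₂ ⁻¹' insert x (I ∩ M₂.E)) w = d w + (1 - χ) * ind (0 < w) := by
      intro w hw
      rw [← he₂, h₂.cnt_insert_of_mem_or (by omega) _ hw, he₂]
      rw [show ind (x ∈ I ∩ M₂.E) = χ from ind_congr (and_iff_left hx2)]
    constructor
    · rintro ⟨-, i1, i2, i3⟩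
      have j1 : ∀ u v, u ≤ v → v ≤ a + 1 → c v + Q₁ u ≤ P₁ v + c u := i1
      have j2 : ∀ u v, u ≤ v → v ≤ n → d v + Q₂ u ≤ P₂ v + d u := i2
      -- Independence together with `x` on one side saves the one unit by which the sum of the
      -- separate inequalities on the two sides would be too weak.
      have key : ∀ u w, u ≤ a → 0 < w → w ≤ n → c a + d w + Q₁ u ≤ s + P₂ w + c u := by
        intro u w hu hw hwn
        rcases i3 with h | h | h
        · have h3 := h u (a + 1) (by omega) le_rfl
          rw [c2 _ le_rfl, c2 u (by omega), ind_true (show a < a + 1 by omega),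
            ind_false (by omega : ¬ a < u), c1] at h3
          have h4 := j2 0 w (by omega) hwn
          have := hB₂.Q0
          omega
        · have h3 := h 0 w (by omega) hwn
          rw [d2 w hwn, d2 0 (by omega), ind_true hw, ind_false (by omega : ¬ 0 < 0)] at h3
          have h4 := j1 u (a + 1) (by omega) le_rfl
          have := hB₂.Q0
          omega
        · exact absurd hloop (h.2.not_indep_of_mem rfl)
      intro u v huv hv
      dsimp only
      by_cases hva : v ≤ a
      · rw [hP0 v hva, hQ0 u (by omega), s1 v hva, s1 u (by omega)]
        exact j1 u v huv (by omega)
      · obtain ⟨w, rfl⟩ := Nat.exists_eq_add_of_lt (not_le.1 hva)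
        rw [add_assoc, hP1 _ (by omega), s2 _ (by omega)]
        by_cases hua : u ≤ a
        · rw [hQ0 u hua, s1 u hua]
          exact key u (w + 1) hua (by omega) (by omega)
        · obtain ⟨z, rfl⟩ := Nat.exists_eq_add_of_lt (not_le.1 hua)
          rw [show a + z + 1 = a + (z + 1) by omega, hQ1 _ (by omega), s2 _ (by omega)]
          have := j2 (z + 1) (w + 1) (by omega) (by omega)
          omega
    · intro h
      have j1 : ∀ u v, u ≤ v → v ≤ a → c v + Q₁ u ≤ P₁ v + c u := by
        intro u v huv hv
        have h3 := h u v huv (by omega)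
        dsimp only at h3
        rwa [hP0 v hv, hQ0 u (by omega), s1 v hv, s1 u (by omega)] at h3
      have j2 : ∀ u v, 0 < u → u ≤ v → v ≤ n → d v + Q₂ u ≤ P₂ v + d u := by
        intro u v hu huv hv
        have h3 := h (a + u) (a + v) (by omega) (by omega)
        dsimp only at h3
        rw [hP1 v (by omega), hQ1 u hu, s2 v hv, s2 u (by omega)] at h3
        omega
      have j3 : ∀ u w, u ≤ a → 0 < w → w ≤ n → c a + d w + Q₁ u ≤ s + P₂ w + c u := by
        intro u w hu hw hwn
        have h3 := h u (a + w) (by omega) (by omega)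
        dsimp only at h3
        rwa [hP1 w hw, hQ0 u hu, s2 w hwn, s1 u hu] at h3
      have k1 : IndepCond (a + 1) P₁ Q₁ (e₁ ⁻¹' (I ∩ M₁.E)) := by
        intro u v huv hv
        change c v + Q₁ u ≤ P₁ v + c u
        by_cases hva : v ≤ a
        · exact j1 u v huv hva
        · obtain rfl : v = a + 1 := by omega
          by_cases hua : u ≤ a
          · have := j3 u 1 hua (by omega) (by omega)
            omega
          · obtain rfl : u = a + 1 := by omega
            have := hB₁.le _ le_rfl
            omega
      have k2 : IndepCond n P₂ Q₂ (e₂ ⁻¹' (I ∩ M₂.E)) := by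
        intro u v huv hv
        change d v + Q₂ u ≤ P₂ v + d u
        rcases Nat.eq_zero_or_pos u with rfl | hu
        · have := hB₂.Q0
          rcases Nat.eq_zero_or_pos v with rfl | hv0
          · omega
          · have := j3 a v le_rfl hv0 hv
            omega
        · exact j2 u v hu huv hv
      refine ⟨hI, k1, k2, ?_⟩
      -- If `x` could be added on neither side, then `[u, a)` is tight in `M₁`, and `[0, w)` becomes
      -- overfull in `M₂` with `x`; the inequality for the combined interval rules this out.
      by_contra hcon
      have q1 : ∃ u ≤ a, s + c u < c a + Q₁ u := by
        by_contra! hq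
        refine hcon (Or.inl fun u v huv hv => ?_)
        rw [c2 v hv, c2 u (by omega)]
        have h3 := k1 u v huv hv
        change c v + Q₁ u ≤ P₁ v + c u at h3
        rcases Nat.lt_or_ge a u with hu | hu
        · rw [ind_true hu, ind_true (show a < v by omega)]; omega
        · rw [ind_false (by omega : ¬ a < u)]
          rcases Nat.lt_or_ge a v with hv' | hv'
          · obtain rfl : v = a + 1 := by omega
            have := hq u hu
            rw [ind_true hv']; omega
          · rw [ind_false (by omega : ¬ a < v)]; omega
      have q2 : ∃ w, 0 < w ∧ w ≤ n ∧ P₂ w < d w + (1 - χ) := by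
        by_contra! hq
        refine hcon (Or.inr (Or.inl fun u v huv hv => ?_))
        rw [d2 v hv, d2 u (by omega)]
        have h3 := k2 u v huv hv
        change d v + Q₂ u ≤ P₂ v + d u at h3
        rcases Nat.eq_zero_or_pos u with rfl | hu
        · rw [ind_false (by omega : ¬ 0 < 0)]
          rcases Nat.eq_zero_or_pos v with rfl | hv0
          · rw [ind_false (by omega : ¬ 0 < 0)]; omega
          · have := hq v hv0 hv
            have := hB₂.Q0
            rw [ind_true hv0]; omega
        · rw [ind_true hu, ind_true (show 0 < v by omega)]; omega
      obtain ⟨u, hu, hu'⟩ := q1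
      obtain ⟨w, hw0, hwn, hw⟩ := q2
      have := j3 u w hu hw0 hwn
      omega

end Glue

/-! ### Matroids that are parallel connections at a given element -/

section Separation

variable {α : Type*} {M : Matroid α} {n : ℕ} {e : ℕ → α} {P Q : ℕ → ℕ} {t : ℕ} {A : Set α}

/-- No circuit of the contraction of `x` meets both `A` and its complement. -/
def Separates (M : Matroid α) (x : α) (A : Set α) : Prop :=
  ∀ p p' D, p ∈ A → p' ∉ A → p ≠ x → x ∈ D → M.Indep (insert p D) → M.Indep (insert p' D) →
    M.Indep (insert p (insert p' D))

/-- On each side the enlarged set looks like one of the two given independent sets, and since `x` is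
already in `D` the compatibility condition is automatic. -/
theorem separates_parallelConnection {N₁ N₂ : Matroid α} {x : α} [N₁.Finite] [N₂.Finite]
    (hx : N₁.E ∩ N₂.E = {x}) :
    Separates (Matroid.parallelConnection N₁ N₂ x hx) x N₁.E := by
  intro p p' D hp hp' hpx hxD h h'
  rw [Matroid.parallelConnection_indep_iff] at *
  have hp2 : p ∉ N₂.E := fun h2 => hpx (hx.subset ⟨hp, h2⟩)
  have hp2' : p' ∈ N₂.E := (h'.1 (mem_insert _ _)).resolve_left hp'
  have hx1 : x ∈ N₁.E := (hx.symm.subset rfl).1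
  have e1 : insert p (insert p' D) ∩ N₁.E = insert p D ∩ N₁.E := by
    rw [insert_comm, insert_inter_of_notMem hp']
  have e2 : insert p (insert p' D) ∩ N₂.E = insert p' D ∩ N₂.E := insert_inter_of_notMem hp2
  refine ⟨insert_subset (Or.inl hp) h'.1, e1 ▸ h.2.1, e2 ▸ h'.2.2.1, Or.inl ?_⟩
  rw [e1, insert_eq_of_mem (show x ∈ insert p D ∩ N₁.E from ⟨Or.inr hxD, hx1⟩)]
  exact h.2.1

/-- The condition `hv` leaves room to postpone the north step from `i` to `i'`, so both the old and
the new set are bases containing `e t`. Were `e i` and `e i'` on different sides, their union would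
be independent, although it properly contains a basis. -/
theorem PathRep.mem_iff_mem_of_exchange (hM : PathRep M n e P Q) (hA : Separates M (e t) A)
    {S : Set ℕ} (hS : Good n P Q S) (hSn : S ⊆ Iio n) (ht : t ∈ S) {i i' : ℕ} (hi : i ∈ S)
    (hi' : i' ∉ S) (hin : i' < n) (hii : i < i') (hit : i ≠ t)
    (hv : ∀ v, i < v → v ≤ i' → Q v + 1 ≤ cnt S v) : e i ∈ A ↔ e i' ∈ A := by
  have hitn : ∀ j, j ∈ S → j < n := fun j hj => hSn hj
  have hne : ∀ j k, j < n → k < n → j ≠ k → e j ≠ e k := fun j k hj hk hjk h =>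
    hjk (hM.injOn hj hk h)
  have hD : ∀ v, cnt S v = cnt (S \ {i}) v + ind (i < v) := fun v => by
    rw [← LatticePath.cnt_insert (by simp), insert_sdiff_singleton, insert_eq_of_mem hi]
  have hD' : ∀ v, cnt (insert i' (S \ {i})) v = cnt (S \ {i}) v + ind (i' < v) := fun v =>
    LatticePath.cnt_insert (fun h => hi' h.1) v
  have hS' : Good n P Q (insert i' (S \ {i})) := by
    intro v hvn
    have h1 := hS v hvn
    have h2 := hD v
    have h3 := hD' v
    by_cases q1 : i < v
    · rw [ind_true q1] at h2
      by_cases q2 : i' < v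
      · rw [ind_true q2] at h3; omega
      · rw [ind_false q2] at h3
        have := hv v q1 (by omega)
        omega
    · rw [ind_false q1] at h2
      rw [ind_false (by omega : ¬ i' < v)] at h3
      omega
  have hsub' : insert i' (S \ {i}) ⊆ Iio n := insert_subset hin (sdiff_subset.trans hSn)
  have hB := (hM.isBase_image_iff hSn).2 hS
  have hB' := (hM.isBase_image_iff hsub').2 hS'
  have b1 : e '' S = insert (e i) (e '' (S \ {i})) := by
    rw [← image_insert_eq, insert_sdiff_singleton, insert_eq_of_mem hi]
  rw [image_insert_eq] at hB'
  have htD : e t ∈ e '' (S \ {i}) := ⟨t, ⟨ht, fun h => hit h.symm⟩, rfl⟩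
  have hcon : ¬ M.Indep (insert (e i') (e '' S)) := by
    intro h
    have h1 := hB.eq_of_subset_indep h (subset_insert _ _)
    have h2 : e i' ∈ e '' S := h1 ▸ mem_insert _ _
    obtain ⟨j, hj, hje⟩ := h2
    exact hi' (hM.injOn (hSn hj) hin hje ▸ hj)
  have hi't : i' ≠ t := fun h => hi' (h ▸ ht)
  constructor
  · intro h
    by_contra h'
    refine hcon ?_
    rw [b1, insert_comm]
    exact hA _ _ _ h h' (hne _ _ (hitn i hi) (hitn t ht) hit) htD (b1 ▸ hB.indep) hB'.indep
  · intro h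
    by_contra h'
    refine hcon ?_
    rw [b1]
    exact hA _ _ _ h h' (hne _ _ hin (hitn t ht) hi't) htD hB'.indep (b1 ▸ hB.indep)

theorem PathRep.mem_iff_mem_of_path (hM : PathRep M n e P Q) (hA : Separates M (e t) A)
    (π : ℕ → ℕ) (hπ0 : π 0 = 0) (hπ : ∀ j < n, π j ≤ π (j + 1) ∧ π (j + 1) ≤ π j + 1)
    (hle : ∀ j ≤ n, Q j ≤ π j ∧ π j ≤ P j) (htn : t < n) (ht : π (t + 1) = π t + 1) {i i' : ℕ}
    (hi : π (i + 1) = π i + 1) (hi' : π (i' + 1) = π i') (hin : i' < n) (hii : i < i')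
    (hit : i ≠ t) (hv : ∀ v, i < v → v ≤ i' → Q v + 1 ≤ π v) : e i ∈ A ↔ e i' ∈ A := by
  have hcnt : ∀ v ≤ n, cnt {j | j < n ∧ π j < π (j + 1)} v = π v :=
    fun v hv => cnt_steps n hπ0 hπ hv
  refine hM.mem_iff_mem_of_exchange hA (S := {j | j < n ∧ π j < π (j + 1)}) (fun v hv => ?_)
    (fun j hj => hj.1) ⟨htn, by omega⟩ ⟨by omega, by omega⟩ (fun h => ?_) hin hii hit
    (fun v h1 h2 => ?_)
  · rw [hcnt v hv]; exact hle v hv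
  · have := h.2; omega
  · rw [hcnt v (by omega)]; exact hv v h1 h2

theorem PathRep.mem_iff_mem_left (hM : PathRep M n e P Q) (hA : Separates M (e t) A)
    (hd : ∀ j, 0 < j → j < n → Q j < P j) (htn : t < n) (h2 : Q t + 2 ≤ P (t + 1)) {i : ℕ}
    (hit : i + 1 < t) : e i ∈ A ↔ e (i + 1) ∈ A := by
  have hB := hM.bounds
  have d1 := hd (i + 1) (by omega) (by omega)
  have p1 := hB.P_step i
  have q0 := hB.Q_step i
  have q1 : Q (i + 1) ≤ Q (i + 2) ∧ Q (i + 2) ≤ Q (i + 1) + 1 := hB.Q_step (i + 1)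
  have q2 := hB.Q_step t
  have Qm := fun {u v} (h : u ≤ v) => step_mono hB.Q_step h
  have Pm := fun {u v} (h : u ≤ v) => step_mono hB.P_step h
  have m1 := Qm (show i + 1 ≤ t by omega)
  -- A path with a north step at `i`, an east step at `i + 1` and a north step at `t`. It arrives at
  -- `i` at height `Q (i + 1)`, and after `i` it is raised only as `Q` demands, apart from the step
  -- at `t`; the depth at `t` makes room for that step.
  set π : ℕ → ℕ := fun j => if j ≤ i then min (P j) (Q (i + 1)) else
    if j ≤ t then max (Q (i + 1) + 1) (Q j) else max (max (Q (i + 1) + 1) (Q t) + 1) (Q j) with hπ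
  have f1 : ∀ j ≤ i, π j = min (P j) (Q (i + 1)) := fun j hj => by simp [hπ, hj]
  have f2 : ∀ j, i < j → j ≤ t → π j = max (Q (i + 1) + 1) (Q j) := fun j hj hj' => by
    simp [hπ, hj', not_le.2 hj]
  have f3 : ∀ j, t < j → π j = max (max (Q (i + 1) + 1) (Q t) + 1) (Q j) := fun j hj => by
    simp [hπ, not_le.2 hj, not_le.2 (show i < j by omega)]
  have g1 := f1 i le_rfl
  have g2 := f2 (i + 1) (by omega) (by omega)
  have g3 := f2 (i + 2) (by omega) (by omega)
  have g4 := f2 t (by omega) le_rfl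
  have g5 := f3 (t + 1) (by omega)
  refine hM.mem_iff_mem_of_path hA π ?_ (fun j hj => ?_) (fun j hj => ?_) htn ?_ ?_ ?_
    (by omega) (by omega) (by omega) (fun v hv hv' => ?_)
  · rw [f1 0 (by omega), hB.P0]; simp
  · have := hB.P_step j
    have := hB.Q_step j
    rcases lt_trichotomy j i with h | rfl | h
    · rw [f1 j (by omega), f1 (j + 1) (by omega)]; omega
    · omega
    · rcases lt_trichotomy j t with h' | rfl | h'
      · rw [f2 j h (by omega), f2 (j + 1) (by omega) (by omega)]; omega
      · omega
      · rw [f3 j h', f3 (j + 1) (by omega)]; omega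
  · have hl := hB.le j hj
    rcases Nat.lt_or_ge i j with h | h
    · have := Pm (show i + 1 ≤ j by omega)
      rcases Nat.lt_or_ge t j with h' | h'
      · have := Pm (show t + 1 ≤ j by omega)
        rw [f3 j h']; omega
      · rw [f2 j h h']; omega
    · have := Qm (show j ≤ i + 1 by omega)
      rw [f1 j h]; omega
  · omega
  · omega
  · change π (i + 2) = _; omega
  · obtain rfl : v = i + 1 := by omega
    omega

theorem PathRep.mem_iff_mem_middle (hM : PathRep M n e P Q) (hA : Separates M (e t) A)
    (ht0 : 0 < t) (htn : t + 1 < n) (h2 : Q t + 2 ≤ P (t + 1)) :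
    e (t - 1) ∈ A ↔ e (t + 1) ∈ A := by
  have hB := hM.bounds
  obtain ⟨s, rfl⟩ := Nat.exists_eq_add_of_lt ht0
  rw [zero_add] at *
  rw [Nat.add_sub_cancel]
  have q0 := hB.Q_step s
  have q1 := hB.Q_step (s + 1)
  have q2 := hB.Q_step (s + 2)
  have p0 := hB.P_step s
  have p1 := hB.P_step (s + 1)
  have Qm := fun {u v} (h : u ≤ v) => step_mono hB.Q_step h
  have Pm := fun {u v} (h : u ≤ v) => step_mono hB.P_step h
  simp only [show s + 1 + 1 = s + 2 by omega, show s + 2 + 1 = s + 3 by omega] at *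
  -- With `t = s + 1`, this path has north steps at `s` and at `t` and an east step at `t + 1`; its
  -- height `Q t + 2` after `t` fits below `P` by the depth hypothesis.
  set π : ℕ → ℕ := fun j => if j ≤ s then min (P j) (Q (s + 1)) else
    if j ≤ s + 1 then Q (s + 1) + 1 else max (Q (s + 1) + 2) (Q j) with hπ
  have f1 : ∀ j ≤ s, π j = min (P j) (Q (s + 1)) := fun j hj => by simp [hπ, hj]
  have f2 : π (s + 1) = Q (s + 1) + 1 := by simp [hπ]
  have f3 : ∀ j, s + 1 < j → π j = max (Q (s + 1) + 2) (Q j) := fun j hj => by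
    simp [hπ, not_le.2 hj, not_le.2 (show s < j by omega)]
  have g1 := f1 s le_rfl
  have g2 := f3 (s + 2) (by omega)
  have g3 := f3 (s + 3) (by omega)
  refine hM.mem_iff_mem_of_path hA π ?_ (fun j hj => ?_) (fun j hj => ?_) (by omega) ?_ ?_ ?_
    htn (by omega) (by omega) (fun v hv hv' => ?_)
  · rw [f1 0 (by omega), hB.P0]; simp
  · have := hB.P_step j
    have := hB.Q_step j
    rcases lt_trichotomy j s with h | rfl | h
    · rw [f1 j (by omega), f1 (j + 1) (by omega)]; omega
    · omega
    · rcases Nat.lt_or_ge (s + 1) j with h' | h'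
      · rw [f3 j h', f3 (j + 1) (by omega)]; omega
      · obtain rfl : j = s + 1 := by omega
        change _ ≤ π (s + 2) ∧ π (s + 2) ≤ _; omega
  · have hl := hB.le j hj
    rcases Nat.lt_or_ge s j with h | h
    · rcases Nat.lt_or_ge (s + 1) j with h' | h'
      · have := Pm (show s + 2 ≤ j by omega)
        rw [f3 j h']; omega
      · obtain rfl : j = s + 1 := by omega
        omega
    · have := Qm (show j ≤ s + 1 by omega)
      rw [f1 j h]; omega
  · change π (s + 2) = _; omega
  · omega
  · change π (s + 3) = _; omega
  · rcases Nat.lt_or_ge (s + 1) v with h' | h'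
    · obtain rfl : v = s + 2 := by omega
      omega
    · obtain rfl : v = s + 1 := by omega
      omega

/-- If the contraction of `e t` is disconnected then the bounding paths are as close to each other
at the position `t` as they can be. -/
theorem PathRep.le_of_separates (hM : PathRep M n e P Q) (hA : Separates M (e t) A)
    (hd : ∀ j, 0 < j → j < n → Q j < P j) (htn : t < n) {p q : α} (hp : p ∈ M.E) (hq : q ∈ M.E)
    (hpt : p ≠ e t) (hqt : q ≠ e t) (hpA : p ∈ A) (hqA : q ∉ A) : P (t + 1) ≤ Q t + 1 := by
  by_contra hcon
  have h2 : Q t + 2 ≤ P (t + 1) := by omega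
  have hB := hM.bounds
  have right : ∀ i, t < i → i + 1 < n → (e i ∈ A ↔ e (i + 1) ∈ A) := by
    intro i hti hin
    have h3 := hM.rev.mem_iff_mem_left (t := n - 1 - t) (A := A) (i := n - 2 - i)
      (by rwa [show n - 1 - (n - 1 - t) = t by omega]) (fun j hj hjn => ?_) (by omega) ?_ (by omega)
    · rw [show n - 1 - (n - 2 - i) = i + 1 by omega,
        show n - 1 - (n - 2 - i + 1) = i by omega] at h3
      exact h3.symm
    · have h4 := hd (n - j) (by omega) (by omega)
      have h5 := step_mono hB.P_step (show n - j ≤ n by omega)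
      simp only [revP, revQ]; omega
    · have h5 := step_mono hB.P_step (show t + 1 ≤ n by omega)
      simp only [revP, revQ]
      rw [show n - (n - 1 - t) = t + 1 by omega, show n - (n - 1 - t + 1) = t by omega]
      omega
  -- The index runs through all positions except `t`, in order, and every element is compared with
  -- the first of them, which is `1` only if `t = 0`.
  have hall : ∀ j, j + 1 < n →
      (e (if j < t then j else j + 1) ∈ A ↔ e (if 0 < t then 0 else 1) ∈ A) := by
    intro j
    induction j with
    | zero => intro _; rfl
    | succ j ih =>
      intro hj
      rw [← ih (by omega)]
      rcases lt_trichotomy (j + 1) t with h | h | h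
      · rw [if_pos h, if_pos (by omega)]
        exact (hM.mem_iff_mem_left hA hd htn h2 h).symm
      · rw [if_neg (by omega), if_pos (by omega)]
        have := hM.mem_iff_mem_middle hA (by omega) (by omega) h2
        subst h
        simpa using this.symm
      · rw [if_neg (by omega), if_neg (by omega)]
        exact (right (j + 1) (by omega) hj).symm
  have hsame : ∀ r ∈ M.E, r ≠ e t → (r ∈ A ↔ e (if 0 < t then 0 else 1) ∈ A) := by
    intro r hr hrt
    obtain ⟨j, hj, rfl⟩ := hM.ground.symm.subset hr
    simp only [mem_Iio] at hj
    have hjt : j ≠ t := fun h => hrt (by rw [h])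
    rcases Nat.lt_or_ge j t with h | h
    · have := hall j (by omega)
      rwa [if_pos h] at this
    · have := hall (j - 1) (by omega)
      rwa [if_neg (by omega), Nat.sub_add_cancel (by omega)] at this
  exact hqA ((hsame q hq hqt).2 ((hsame p hp hpt).1 hpA))

end Separation

end LatticePath

namespace LatticePath

/-! ### Doubling an element -/

section Double

variable {α : Type*} {M₁ M₂ : Matroid α} {x : α}

theorem indep_singleton_of_isConnected {M : Matroid α} (hc : M.IsConnected) (hx : x ∈ M.E)
    (hE : M.E.Nontrivial) : M.Indep {x} := by
  obtain ⟨y, C, -, -, -, -, -, h, -, -⟩ := exists_parallel hc hx hE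
  exact h.subset (singleton_subset_iff.2 (mem_insert _ _))

/-- The new element `y` is placed right after `x`. The upper path pauses at the second of the two
positions and the lower path at the first, so the interval containing `x` is extended over both. As
at most one interval meets the two positions, `x` and `y` are parallel. -/
theorem PathRep.double [M₁.Finite] [M₂.Finite] (hx : M₁.E ∩ M₂.E = {x}) {n t : ℕ} {e : ℕ → α}
    {P Q : ℕ → ℕ} {y : α} (h : PathRep M₁ n e P Q) (htn : t < n) (het : e t = x)
    (hPQ : P (t + 1) ≤ Q t + 1) (hyx : y ≠ x) (hM₂ : M₂ = Matroid.uniformOnSet {x, y} 1) :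
    PathRep (Matroid.parallelConnection M₁ M₂ x hx) (n + 1)
      (fun j => if j ≤ t then e j else if j = t + 1 then y else e (j - 1))
      (fun j => if j ≤ t + 1 then P j else P (j - 1))
      (fun j => if j ≤ t then Q j else Q (j - 1)) := by
  have hB := h.bounds
  have hE₂ : M₂.E = {x, y} := by rw [hM₂]; rfl
  have hI₂ : ∀ K, M₂.Indep K ↔ K ⊆ {x, y} ∧ K.encard ≤ 1 := by
    intro K
    rw [hM₂, Matroid.uniformOnSet, Matroid.truncation_indep_iff, Matroid.freeOn_indep_iff]
    rfl
  have hy2 : y ∈ M₂.E := by simp [hE₂]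
  have hy1 : y ∉ M₁.E := fun hy => hyx (hx.subset ⟨hy, hy2⟩)
  have hx1 : x ∈ M₁.E := het ▸ h.mem_ground htn
  have hix : M₂.Indep (insert x ∅) := by rw [hI₂]; simp
  have hiy : M₂.Indep (insert y ∅) := by rw [hI₂]; simp
  have hixy : ¬ M₂.Indep (insert x (insert y ∅)) := by
    rw [hI₂]
    intro hc
    have := hc.2
    rw [insert_empty_eq, encard_pair hyx.symm] at this
    exact absurd this (by norm_num)
  set e' : ℕ → α := fun j => if j ≤ t then e j else if j = t + 1 then y else e (j - 1) with he'
  set P' : ℕ → ℕ := fun j => if j ≤ t + 1 then P j else P (j - 1) with hP'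
  set Q' : ℕ → ℕ := fun j => if j ≤ t then Q j else Q (j - 1) with hQ'
  have P1 : ∀ j ≤ t + 1, P' j = P j := fun j hj => if_pos hj
  have P2 : ∀ j, t + 1 ≤ j → P' (j + 1) = P j := fun j hj => by
    simp only [hP']; rw [if_neg (by omega), Nat.add_sub_cancel]
  have Q1 : ∀ j ≤ t, Q' j = Q j := fun j hj => if_pos hj
  have Q2 : ∀ j, t ≤ j → Q' (j + 1) = Q j := fun j hj => by
    simp only [hQ']; rw [if_neg (by omega), Nat.add_sub_cancel]
  have e1 : ∀ j ≤ t, e' j = e j := fun j hj => if_pos hj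
  have e2 : e' (t + 1) = y := by
    simp [he']
  have e3 : ∀ j, t < j → e' (j + 1) = e j := fun j hj => by
    simp only [he']; rw [if_neg (by omega), if_neg (by omega), Nat.add_sub_cancel]
  have Qm := fun {u v} (h : u ≤ v) => step_mono hB.Q_step h
  have Pm := fun {u v} (h : u ≤ v) => step_mono hB.P_step h
  have shift : ∀ j, t + 1 < j → ∃ k, j = k + 1 ∧ t < k := fun j hj =>
    ⟨j - 1, by omega, by omega⟩
  have hcase : ∀ j < n + 1, j ≤ t ∨ j = t + 1 ∨ ∃ k, j = k + 1 ∧ t < k ∧ k < n := by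
    intro j hj
    rcases lt_trichotomy j (t + 1) with h1 | h1 | h1
    · exact Or.inl (by omega)
    · exact Or.inr (Or.inl h1)
    · obtain ⟨k, rfl, hk⟩ := shift j h1
      exact Or.inr (Or.inr ⟨k, rfl, hk, by omega⟩)
  have hne : ∀ j < n, e j ≠ y := fun j hj hy => hy1 (hy ▸ h.mem_ground hj)
  refine ⟨⟨?_, ?_, fun j => ?_, fun j => ?_, ?_, fun j hj => ?_⟩, ?_, ?_, fun I hI => ?_⟩
  · rw [P1 0 (by omega), hB.P0]
  · rw [Q1 0 (by omega), hB.Q0]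
  · rcases lt_trichotomy j (t + 1) with h1 | rfl | h1
    · rw [P1 j (by omega), P1 (j + 1) (by omega)]; exact hB.P_step j
    · rw [P1 _ le_rfl, P2 _ le_rfl]; omega
    · obtain ⟨k, rfl, hk⟩ := shift j h1
      rw [P2 k (by omega), P2 (k + 1) (by omega)]; exact hB.P_step k
  · rcases lt_trichotomy j t with h1 | rfl | h1
    · rw [Q1 j (by omega), Q1 (j + 1) (by omega)]; exact hB.Q_step j
    · rw [Q1 _ le_rfl, Q2 _ le_rfl]; omega
    · obtain ⟨k, rfl⟩ := Nat.exists_eq_add_of_lt h1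
      rw [Q2 (t + k) (by omega), Q2 (t + k + 1) (by omega)]; exact hB.Q_step _
  · rw [P2 n (by omega), Q2 n (by omega), hB.eq_n]
  · rcases lt_trichotomy j (t + 1) with h1 | rfl | h1
    · rw [P1 j (by omega), Q1 j (by omega)]; exact hB.le j (by omega)
    · rw [P1 _ le_rfl, Q2 _ le_rfl]
      exact (Qm (show t ≤ t + 1 by omega)).trans (hB.le _ (by omega))
    · obtain ⟨k, rfl, hk⟩ := shift j h1
      rw [P2 k (by omega), Q2 k (by omega)]; exact hB.le k (by omega)
  · intro i hi j hj hij
    rcases hcase i hi with h1 | rfl | ⟨i, rfl, h1, h1'⟩ <;>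
      rcases hcase j hj with h2 | rfl | ⟨j, rfl, h2, h2'⟩
    · rw [e1 i h1, e1 j h2] at hij
      exact h.injOn (show i < n by omega) (show j < n by omega) hij
    · rw [e1 i h1, e2] at hij; exact absurd hij (hne i (by omega))
    · rw [e1 i h1, e3 j h2] at hij
      have := h.injOn (show i < n by omega) (show j < n by omega) hij
      omega
    · rw [e1 j h2, e2] at hij; exact absurd hij.symm (hne j (by omega))
    · rfl
    · rw [e3 j h2, e2] at hij; exact absurd hij.symm (hne j (by omega))
    · rw [e3 i h1, e1 j h2] at hij
      have := h.injOn (show i < n by omega) (show j < n by omega) hij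
      omega
    · rw [e3 i h1, e2] at hij; exact absurd hij (hne i (by omega))
    · rw [e3 i h1, e3 j h2] at hij
      rw [h.injOn (show i < n by omega) (show j < n by omega) hij]
  · rw [Matroid.parallelConnection_ground, hE₂]
    refine subset_antisymm ?_ (union_subset ?_ ?_)
    · rintro _ ⟨j, hj, rfl⟩
      rcases hcase j hj with h1 | rfl | ⟨j, rfl, h1, h1'⟩
      · rw [e1 j h1]; exact Or.inl (h.mem_ground (by omega))
      · rw [e2]; exact Or.inr (Or.inr rfl)
      · rw [e3 j h1]; exact Or.inl (h.mem_ground (by omega))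
    · intro b hb
      obtain ⟨j, hj, rfl⟩ := h.ground.symm.subset hb
      simp only [mem_Iio] at hj
      by_cases hjt : j ≤ t
      · exact ⟨j, show j < n + 1 by omega, e1 j hjt⟩
      · exact ⟨j + 1, show j + 1 < n + 1 by omega, e3 j (by omega)⟩
    · rintro b (rfl | rfl)
      · exact ⟨t, show t < n + 1 by omega, (e1 t le_rfl).trans het⟩
      · exact ⟨t + 1, show t + 1 < n + 1 by omega, e2⟩
  · rw [Matroid.parallelConnection_indep_iff]
    obtain ⟨J, hJI, hJ⟩ : ∃ J ⊆ M₁.E, I = J ∨ I = insert y J := by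
      refine ⟨I \ {y}, ?_, ?_⟩
      · rintro b ⟨hb, hby⟩
        rcases hI hb with hb1 | hb2
        · exact hb1
        · rw [hE₂] at hb2
          rcases hb2 with rfl | hb2
          · exact hx1
          · exact absurd hb2 hby
      · by_cases hy : y ∈ I
        · right; rw [insert_sdiff_singleton, insert_eq_of_mem hy]
        · left; rw [sdiff_singleton_eq_self hy]
    have hyJ : y ∉ J := fun hy => hy1 (hJI hy)
    set c := cnt (e ⁻¹' J) with hc
    have c1 : ∀ v ≤ t + 1, cnt (e' ⁻¹' J) v = c v := fun v hv =>
      cnt_congr fun j hj => by rw [mem_preimage, e1 j (by omega), mem_preimage]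
    have c2 : ∀ v, t + 1 ≤ v → cnt (e' ⁻¹' J) (v + 1) = c v := by
      intro v hv
      induction v, hv using Nat.le_induction with
      | base => rw [cnt_succ, c1 _ le_rfl, mem_preimage, e2, ind_false hyJ, add_zero]
      | succ v hv ih => rw [cnt_succ, ih, mem_preimage, e3 v (by omega), hc, cnt_succ, mem_preimage]
    have cm := fun {u v} (h : u ≤ v) => cnt_mono (e ⁻¹' J) h
    have hcs : c (t + 1) = c t + ind (x ∈ J) := by
      rw [hc, cnt_succ, mem_preimage, het]
    rcases hJ with rfl | hJ
    · have h0 := parallelIndep_union_iff hx (empty_subset _) (notMem_empty _) hix hJI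
      rw [union_empty] at h0
      rw [h0, h.indep_iff I hJI]
      constructor
      · intro hI u v huv hv
        have hI' : ∀ u v, u ≤ v → v ≤ n → c v + Q u ≤ P v + c u := hI
        rcases lt_trichotomy u (t + 1) with h1 | rfl | h1
        · rw [c1 u (by omega), Q1 u (by omega)]
          rcases Nat.lt_or_ge (t + 1) v with h2 | h2
          · obtain ⟨k, rfl, hk⟩ := shift v h2
            rw [c2 k (by omega), P2 k (by omega)]
            exact hI' u k (by omega) (by omega)
          · rw [c1 v h2, P1 v h2]
            exact hI' u v huv (by omega)
        · rw [c1 _ le_rfl, Q2 _ le_rfl]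
          have := cm (show t ≤ t + 1 by omega)
          rcases Nat.lt_or_ge (t + 1) v with h2 | h2
          · obtain ⟨k, rfl, hk⟩ := shift v h2
            rw [c2 k (by omega), P2 k (by omega)]
            have := hI' t k (by omega) (by omega)
            omega
          · rw [c1 v h2, P1 v h2]
            have := hI' t v (by omega) (by omega)
            omega
        · obtain ⟨k, rfl, hk⟩ := shift u h1
          obtain ⟨l, rfl, hl⟩ := shift v (by omega)
          rw [c2 k (by omega), Q2 k (by omega), c2 l (by omega), P2 l (by omega)]
          exact hI' k l (by omega) (by omega)
      · intro hI u v huv hv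
        change c v + Q u ≤ P v + c u
        -- An interval of old positions is enlarged to one in the new order that ends after `y` or
        -- begins after it; since `y` is not in the set, the counts agree.
        have up : ∀ u, cnt (e' ⁻¹' I) (if u ≤ t then u else u + 1) = c u ∧
            Q' (if u ≤ t then u else u + 1) = Q u ∧ P' (if u ≤ t then u else u + 1) = P u := by
          intro u
          by_cases h1 : u ≤ t
          · rw [if_pos h1]; exact ⟨c1 u (by omega), Q1 u h1, P1 u (by omega)⟩
          · rw [if_neg h1]; exact ⟨c2 u (by omega), Q2 u (by omega), P2 u (by omega)⟩
        have := hI (if u ≤ t then u else u + 1) (if v ≤ t then v else v + 1)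
          (by split_ifs <;> omega) (by split_ifs <;> omega)
        rwa [(up u).1, (up u).2.1, (up v).1, (up v).2.2] at this
    · have h0 := parallelIndep_insert_union_iff hx hy2 hyx (empty_subset _) (notMem_empty _)
        hix hiy hixy hJI
      rw [union_empty, ← hJ] at h0
      rw [h0, h.indep_iff _ (insert_subset hx1 hJI)]
      have d : ∀ v ≤ n + 1, cnt (e' ⁻¹' I) v = cnt (e' ⁻¹' J) v + ind (t + 1 < v) := by
        intro v hv
        rw [← LatticePath.cnt_insert (show t + 1 ∉ e' ⁻¹' J by rwa [mem_preimage, e2]), hJ]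
        refine cnt_congr fun j hj => or_congr_left ⟨fun hjy => ?_, fun hjt => hjt ▸ e2⟩
        rcases hcase j (by omega) with h1 | rfl | ⟨k, rfl, h1, h1'⟩
        · exact absurd ((e1 j h1).symm.trans hjy) (hne j (by omega))
        · rfl
        · exact absurd ((e3 k h1).symm.trans hjy) (hne k h1')
      have d1 : ∀ v ≤ t + 1, cnt (e' ⁻¹' I) v = c v := fun v hv => by
        rw [d v (by omega), c1 v hv, ind_false (by omega), add_zero]
      have d2 : ∀ v, t + 1 ≤ v → v ≤ n → cnt (e' ⁻¹' I) (v + 1) = c v + 1 := fun v hv hvn => by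
        rw [d _ (by omega), c2 v hv, ind_true (by omega)]
      have hxc : ∀ v ≤ n, x ∉ J → cnt (e ⁻¹' insert x J) v = c v + ind (t < v) :=
        fun v hv hxJ => by rw [← het]; exact h.cnt_insert htn (het ▸ hxJ) hv
      constructor
      · rintro ⟨hxJ, hI⟩ u v huv hv
        rw [ind_false hxJ] at hcs
        have hI1 : ∀ u v, u ≤ v → v ≤ t → c v + Q u ≤ P v + c u := by
          intro u v huv hv
          have := hI u v huv (by omega)
          rwa [hxc v (by omega) hxJ, hxc u (by omega) hxJ, ind_false (by omega),
            ind_false (by omega)] at this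
        have hI2 : ∀ u v, u ≤ t → t < v → v ≤ n → c v + 1 + Q u ≤ P v + c u := by
          intro u v hu hv hvn
          have := hI u v (by omega) (by omega)
          rwa [hxc v (by omega) hxJ, hxc u (by omega) hxJ, ind_true hv,
            ind_false (by omega)] at this
        have hI3 : ∀ u v, t < u → u ≤ v → v ≤ n → c v + Q u ≤ P v + c u := by
          intro u v hu huv hvn
          have := hI u v (by omega) (by omega)
          rw [hxc v (by omega) hxJ, hxc u (by omega) hxJ, ind_true (by omega : t < v),
            ind_true hu] at this
          omega
        rcases lt_trichotomy u (t + 1) with h1 | rfl | h1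
        · rw [d1 u (by omega), Q1 u (by omega)]
          rcases lt_trichotomy v (t + 1) with h2 | rfl | h2
          · rw [d1 v (by omega), P1 v (by omega)]; exact hI1 u v huv (by omega)
          · rw [d1 _ le_rfl, P1 _ le_rfl]
            have := hI1 u t (by omega) le_rfl
            have := Pm (show t ≤ t + 1 by omega)
            omega
          · obtain ⟨k, rfl, hk⟩ := shift v h2
            rw [d2 k (by omega) (by omega), P2 k (by omega)]; exact hI2 u k (by omega) hk (by omega)
        · rw [d1 _ le_rfl, Q2 _ le_rfl]
          rcases Nat.lt_or_ge (t + 1) v with h2 | h2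
          · obtain ⟨k, rfl, hk⟩ := shift v h2
            rw [d2 k (by omega) (by omega), P2 k (by omega)]
            have := hI2 t k le_rfl hk (by omega)
            omega
          · obtain rfl : v = t + 1 := by omega
            rw [d1 _ le_rfl, P1 _ le_rfl]
            have := Qm (show t ≤ t + 1 by omega)
            have := hB.le (t + 1) (by omega)
            omega
        · obtain ⟨k, rfl, hk⟩ := shift u h1
          obtain ⟨l, rfl, hl⟩ := shift v (by omega)
          rw [d2 k (by omega) (by omega), Q2 k (by omega), d2 l (by omega) (by omega), P2 l (by omega)]
          have := hI3 k l hk (by omega) (by omega)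
          omega
      · intro hI
        -- The two positions `t` and `t + 1` hold `x` and `y`, and at most one interval meets them.
        have hxJ : x ∉ J := by
          intro hxJ
          rw [ind_true hxJ] at hcs
          have := hI t (t + 2) (by omega) (by omega)
          rw [d1 t (by omega), Q1 t le_rfl, d2 (t + 1) le_rfl (by omega), P2 (t + 1) le_rfl] at this
          omega
        refine ⟨hxJ, fun u v huv hv => ?_⟩
        rw [hxc v hv hxJ, hxc u (by omega) hxJ]
        rcases Nat.lt_or_ge t v with h2 | h2
        · rw [ind_true h2]
          rcases Nat.lt_or_ge t u with h1 | h1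
          · have := hI (u + 1) (v + 1) (by omega) (by omega)
            rw [d2 v (by omega) (by omega), d2 u (by omega) (by omega), Q2 u (by omega), P2 v (by omega)] at this
            rw [ind_true h1]
            omega
          · have := hI u (v + 1) (by omega) (by omega)
            rw [d2 v (by omega) (by omega), d1 u (by omega), Q1 u (by omega), P2 v (by omega)] at this
            rw [ind_false (by omega)]
            omega
        · have := hI u v huv (by omega)
          rw [d1 v (by omega), d1 u (by omega), Q1 u (by omega), P1 v (by omega)] at this
          rw [ind_false (by omega), ind_false (by omega)]
          omega

end Double

/-! ### The three parts of the theorem -/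

section Main

variable {α : Type*} {M₁ M₂ : Matroid α} {x : α}

theorem exists_pathRep_of_isLatticePath {M : Matroid α} (h : M.IsLatticePath) (x : α) :
    ∃ n e P Q, PathRep M n e P Q := by
  obtain ⟨n, e, he⟩ := h
  obtain ⟨P, Q, hPQ⟩ := exists_pathRep x he
  exact ⟨n, _, P, Q, hPQ⟩

theorem exists_pathRep_first {M : Matroid α} (h : M.IsTerminal x) :
    ∃ n e P Q, PathRep M n e P Q ∧ 0 < n ∧ e 0 = x := by
  obtain ⟨n, e, he, i, hi, h0⟩ := h
  obtain ⟨P, Q, hPQ⟩ := exists_pathRep x he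
  have hin := i.2
  rcases h0 with h0 | h0
  · refine ⟨n, _, P, Q, hPQ, by omega, ?_⟩
    have hn : 0 < n := by omega
    simp only [hn, dif_pos]
    rw [← hi]; congr 1; exact Fin.ext h0.symm
  · refine ⟨n, _, _, _, hPQ.rev, by omega, ?_⟩
    have hn : n - 1 - 0 < n := by omega
    simp only [hn, dif_pos]
    rw [← hi]; congr 1; exact Fin.ext (by simp only; omega)

/-- The order of `M₁` is reversed so that `x` comes last; connectedness supplies the heights at the
ends that the gluing requires. -/
theorem isLatticePath_of_isTerminal [M₁.Finite] [M₂.Finite] (hx : M₁.E ∩ M₂.E = {x})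
    (hc₁ : M₁.IsConnected) (hc₂ : M₂.IsConnected) (hE₁ : M₁.E.Nontrivial) (hE₂ : M₂.E.Nontrivial)
    (h₁ : M₁.IsTerminal x) (h₂ : M₂.IsTerminal x) :
    (Matroid.parallelConnection M₁ M₂ x hx).IsLatticePath := by
  obtain ⟨n₁, e₁, P₁, Q₁, r₁, hn₁, he₁⟩ := exists_pathRep_first h₁
  obtain ⟨n₂, e₂, P₂, Q₂, r₂, hn₂, he₂⟩ := exists_pathRep_first h₂
  have hn₂' := r₂.two_le hE₂
  have hn₁' := r₁.two_le hE₁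
  have r₁' := r₁.rev
  obtain ⟨a, rfl⟩ : ∃ a, n₁ = a + 1 := ⟨n₁ - 1, by omega⟩
  obtain ⟨-, -, c1, c2⟩ := r₁'.bounds.ends hn₁' fun j => r₁'.depth_of_isConnected hc₁
  obtain ⟨d1, d2, -, -⟩ := r₂.bounds.ends hn₂' fun j => r₂.depth_of_isConnected hc₂
  rw [Nat.add_sub_cancel] at c1 c2
  exact ⟨_, _, (PathRep.glue hx r₁' r₂ (by omega) (by simpa using he₁) he₂ (c1.trans c2.symm)
    c2.symm rfl d1 d2 (indep_singleton_of_isConnected hc₂ (hx.symm.subset rfl).2 hE₂)).isPathOrder⟩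

theorem isLatticePath_of_isParallelConnectionAt [M₁.Finite] [M₂.Finite]
    (hx : M₁.E ∩ M₂.E = {x}) (hL : M₁.IsLatticePath) (hc : M₁.IsConnected)
    (h₁ : M₁.IsParallelConnectionAt x) {y : α} (hyx : y ≠ x)
    (hM₂ : M₂ = Matroid.uniformOnSet {x, y} 1) :
    (Matroid.parallelConnection M₁ M₂ x hx).IsLatticePath := by
  obtain ⟨n, e, P, Q, h⟩ := exists_pathRep_of_isLatticePath hL x
  obtain ⟨t, htn, het⟩ := h.ground.symm.subset (hx.symm.subset rfl).1
  obtain ⟨N₁, N₂, f₁, f₂, hN, nt₁, nt₂, hM₁⟩ := h₁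
  obtain ⟨p, hp, hpx⟩ := nt₁.exists_ne x
  obtain ⟨q, hq, hqx⟩ := nt₂.exists_ne x
  have hsep : Separates M₁ (e t) N₁.E := by
    rw [hM₁, het]; exact separates_parallelConnection hN
  have hE : M₁.E = N₁.E ∪ N₂.E := by rw [hM₁]; rfl
  have hPQ := h.le_of_separates hsep (fun j => h.depth_of_isConnected hc) htn
    (hE ▸ Or.inl hp) (hE ▸ Or.inr hq) (het ▸ hpx) (het ▸ hqx) hp
    (fun hq1 => hqx (hN.subset ⟨hq1, hq⟩))
  exact ⟨_, _, (h.double hx htn het hPQ hyx hM₂).isPathOrder⟩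

/-- The number of intervals containing `x = e t` is `P (t + 1) - Q t`. If it is one, the contraction
of `x` is disconnected and the rank hypothesis on `M₂` becomes available; otherwise doubling `x`
suffices. -/
theorem hasMinorIso_of_not_isTerminal [M₁.Finite] [M₂.Finite] (hx : M₁.E ∩ M₂.E = {x})
    (hL : M₁.IsLatticePath) (hc₁ : M₁.IsConnected) (hc₂ : M₂.IsConnected)
    (hE₁ : M₁.E.Nontrivial) (hE₂ : M₂.E.Nontrivial) (ht : ¬ M₁.IsTerminal x)
    (hr : ¬ (M₁.contract {x}).IsConnected → 1 < M₂.eRank) :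
    (∃ n, 2 ≤ n ∧ (Matroid.parallelConnection M₁ M₂ x hx).HasMinorIso (Matroid.matB n 2)) ∨
      (Matroid.parallelConnection M₁ M₂ x hx).HasMinorIso (Matroid.matC 2 2) ∨
      (∃ n, 4 ≤ n ∧ (Matroid.parallelConnection M₁ M₂ x hx).HasMinorIso (Matroid.matE n)) ∨
      (Matroid.parallelConnection M₁ M₂ x hx).HasMinorIso Matroid.matR₃ ∨
      (Matroid.parallelConnection M₁ M₂ x hx).HasMinorIso Matroid.matR₄ := by
  have hx1 : x ∈ M₁.E := (hx.symm.subset rfl).1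
  obtain ⟨n, e, P, Q, h⟩ := exists_pathRep_of_isLatticePath hL x
  obtain ⟨t, htn, het⟩ := h.ground.symm.subset hx1
  replace htn : t < n := htn
  have hB := h.bounds
  have hd : ∀ j, 0 < j → j < n → Q j < P j := fun j => h.depth_of_isConnected hc₁
  have hn := h.two_le hE₁
  have hlt := h.left_of_not_isTerminal htn (het ▸ ht)
  have hrt := h.right_of_not_isTerminal htn (het ▸ ht)
  have ht0 : 0 < t := by
    rcases hlt with ⟨i, k, h1, h2, -⟩ | ⟨i, k, h1, h2, -⟩ <;> omega
  have htn' : t + 1 < n := by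
    rcases hrt with ⟨i, k, h1, h2, h3, -⟩ | ⟨i, k, h1, h2, h3, -⟩ <;> omega
  have hdt := hd (t + 1) (by omega) htn'
  have hqt := (hB.Q_step t).1
  by_cases hcut : P (t + 1) = Q t + 1
  · have hdis := h.not_isConnected_contract ht0 htn'
      (het ▸ indep_singleton_of_isConnected hc₁ hx1 hE₁) hcut
    rw [het] at hdis
    exact Or.inr (Or.inl (hasMinorIso_matC hx hc₂ (hr hdis) h het
      (pat_of_cut hB hn hd ht0 htn hlt hrt hcut)))
  · rcases exists_pat hB hn hd htn hlt hrt (by omega) with ⟨m, hm, hp⟩ | ⟨m, hm, hp⟩ | hp | hp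
    · exact Or.inl ⟨m, hm, hasMinorIso_matB hx hc₂ hE₂ h het hm hp⟩
    · obtain ⟨k, rfl⟩ : ∃ k, m = k - 1 := ⟨m + 1, rfl⟩
      exact Or.inr (Or.inr (Or.inl
        ⟨k, by omega, hasMinorIso_matE hx hc₂ hE₂ h het (by omega) hp⟩))
    · exact Or.inr (Or.inr (Or.inr (Or.inl (hasMinorIso_matR₃ hx hc₂ hE₂ h het hp))))
    · exact Or.inr (Or.inr (Or.inr (Or.inr (hasMinorIso_matR₄ hx hc₂ hE₂ h het hp))))

end Main

end LatticePath

/-! ### The main theorem -/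

theorem mainTheorem2 {α : Type*} (M₁ M₂ : Matroid α) [M₁.Finite] [M₂.Finite] (x : α)
    (hx : M₁.E ∩ M₂.E = {x})
    (hL₁ : M₁.IsLatticePath) (hL₂ : M₂.IsLatticePath)
    (hc₁ : M₁.IsConnected) (hc₂ : M₂.IsConnected)
    (hn₁ : M₁.IsNontrivial) (hn₂ : M₂.IsNontrivial)
    (hr₁ : 0 < M₁.eRank) (hr₂ : 0 < M₂.eRank) :
    (M₁.IsTerminal x → M₂.IsTerminal x →
      (Matroid.parallelConnection M₁ M₂ x hx).IsLatticePath) ∧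
    (M₁.IsParallelConnectionAt x → (∃ y, y ≠ x ∧ M₂ = Matroid.uniformOnSet {x, y} 1) →
      (Matroid.parallelConnection M₁ M₂ x hx).IsLatticePath) ∧
    (¬ M₁.IsTerminal x → (¬ (M₁.contract {x}).IsConnected → 1 < M₂.eRank) →
      (∃ n, 2 ≤ n ∧ (Matroid.parallelConnection M₁ M₂ x hx).HasMinorIso (Matroid.matB n 2)) ∨
      (Matroid.parallelConnection M₁ M₂ x hx).HasMinorIso (Matroid.matC 2 2) ∨
      (∃ n, 4 ≤ n ∧ (Matroid.parallelConnection M₁ M₂ x hx).HasMinorIso (Matroid.matE n)) ∨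
      (Matroid.parallelConnection M₁ M₂ x hx).HasMinorIso Matroid.matR₃ ∨
      (Matroid.parallelConnection M₁ M₂ x hx).HasMinorIso Matroid.matR₄) := by
  have hE₁ := LatticePath.ground_nontrivial_of_isNontrivial hn₁ hr₁
  have hE₂ := LatticePath.ground_nontrivial_of_isNontrivial hn₂ hr₂
  refine ⟨fun h₁ h₂ => LatticePath.isLatticePath_of_isTerminal hx hc₁ hc₂ hE₁ hE₂ h₁ h₂, ?_,
    fun ht hr => LatticePath.hasMinorIso_of_not_isTerminal hx hL₁ hc₁ hc₂ hE₁ hE₂ ht hr⟩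
  rintro h₁ ⟨y, hyx, hM₂⟩
  exact LatticePath.isLatticePath_of_isParallelConnectionAt hx hL₁ hc₁ h₁ hyx hM₂
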